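/- **Conventions.** All C*-algebras below are unital unless said otherwise. $\mathcal M_k$ is the algebra of complex $k\times k$ matrices with the operator norm, and $\tau_k=\frac1k\mathrm{Tr}$. For a sequence $(m_k)$ of positive integers, $\prod_k\mathcal M_{m_k}$ is the C*-algebra of norm-bounded sequences and $\sum_k\mathcal M_{m_k}$ its ideal of sequences with norms tending to $0$. A C*-algebra is an *MF-algebra* if for some (strictly) increasing sequence $(m_k)$ of positive integers it embeds (by an injective, not necessarily unital, $*$-homomorphism) into $\prod_k\mathcal M_{m_k}/\sum_k\mathcal M_{m_k}$. A tracial state is a state $\tau$ with $\tau(ab)=\tau(ba)$. Let $\mathcal D$ be a C*-algebra generated, as a unital C*-algebra, by a family $x=(x_i)_{i\in I}$. A tracial state $\tau$ on $\mathcal D$ is an *MF-trace* if there are positive integers $m_k$ and matrices $A_{i,k}\in\mathcal M_{m_k}$ ($i\in I$, $k\in\mathbb N$) such that for every $*$-polynomial $p$ $$\lim_{k\to\infty}\|p((A_{i,k})_i)\|=\|p(x)\|\quad\text{and}\quad\lim_{k\to\infty}\tau_{m_k}(p((A_{i,k})_i))=\tau(p(x)).$$ $\mathcal T_{MF}(\mathcal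 D)$ is the set of MF-traces; the statements below hold for every choice of the generating families involved. For an ultrafilter $\alpha$ on $\mathbb N=\{1,2,\dots\}$, $\prod^\alpha\mathcal M_k$ is the C*-algebra of bounded sequences $(A_k)$, $A_k\in\mathcal M_k$, modulo the sequences with $\lim_{k\to\alpha}\|A_k\|=0$, and $\tau_\alpha(\{A_k\}_\alpha)=\lim_{k\to\alpha}\tau_k(A_k)$. A tracial state $\tau$ on $\mathcal D$ is *finite-dimensional* if $\tau=\rho\circ\pi$ for a unital $*$-homomorphism $\pi$ from $\mathcal D$ to a finite-dimensional C*-algebra with a tracial state $\rho$. A C*-algebra $\mathcal D$ is *exact* if for every (not necessarily unital) C*-algebra $\mathcal C$ and every closed two-sided ideal $\mathcal J$ of $\mathcal C$ the sequence $0\to\mathcal D\otimes_{\min}\mathcal J\to\mathcal D\otimes_{\min}\mathcal C\to\mathcal D\otimes_{\min}(\mathcal C/\mathcal J)\to0$ is exact. **Proposition.** Let $\mathcal A=C^*(x_1,\dots,x_n)\neq 0$ be an MF-algebra. 1. $\mathcal T_{MF}(\mathcal A)$ is nonempty, convex and weak*-compact. 2. Every finite-dimensional tracial state on $\mathcal A$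 is in $\mathcal T_{MF}(\mathcal A)$. 3. If $\pi$ is a unital $*$-homomorphism from $\mathcal A$ to a C*-algebra and $\pi(\mathcal A)$ is an MF-algebra, then $\{\varphi\circ\pi:\varphi\in\mathcal T_{MF}(\pi(\mathcal A))\}\subseteq\mathcal T_{MF}(\mathcal A)$. 4. A tracial state $\psi$ on $\mathcal A$ is in $\mathcal T_{MF}(\mathcal A)$ if and only if there are a free ultrafilter $\alpha$ on $\mathbb N$ and a unital $*$-homomorphism $\pi:\mathcal A\to\prod^\alpha\mathcal M_k$ with $\psi=\tau_\alpha\circ\pi$. 5. If $\mathcal B$ is a unital C*-subalgebra of $\mathcal A$ and $\varphi\in\mathcal T_{MF}(\mathcal A)$, then $\varphi|_{\mathcal B}\in\mathcal T_{MF}(\mathcal B)$. 6. Let $\mathcal B=C^*(y_1,\dots,y_m)$ be an MF-algebra, let $\nu$ be a C*-norm on the algebraic tensor product of $\mathcal A$ and $\mathcal B$ such that the completion $\mathcal A\otimes_\nu\mathcal B$ is an MF-algebra, and let $\mathcal A$ or $\mathcal B$ be exact. If $\alpha\in\mathcal T_{MF}(\mathcal A)$ and $\beta\in\mathcal T_{MF}(\mathcal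 B)$, then there is a bounded functional $\alpha\otimes\beta$ on $\mathcal A\otimes_\nu\mathcal B$ with $(\alpha\otimes\beta)(a\otimes b)=\alpha(a)\beta(b)$ for all $a\in\mathcal A$, $b\in\mathcal B$, and $\alpha\otimes\beta\in\mathcal T_{MF}(\mathcal A\otimes_\nu\mathcal B)$. -/

import Mathlib

open Filter Topology
open scoped TensorProduct ComplexOrder Matrix.Norms.L2Operator

universe u v w

noncomputable section

namespace MFAlg

/-! ### Matrix algebras, bounded sequences of matrices, and their quotients -/

/-- The C*-algebra `M_k(ℂ)`; its norm is the operator norm on `ℂ^k`. -/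
abbrev Mat (k : ℕ) : Type := Matrix (Fin k) (Fin k) ℂ

/-- The normalized trace `τ_k = (1/k) Tr` on `M_k(ℂ)`. -/
def normTrace (k : ℕ) (A : Mat k) : ℂ := (k : ℂ)⁻¹ * A.trace

/-- The C*-direct product `∏_k M_{m k}(ℂ)`: all norm-bounded sequences of matrices, with
entrywise operations. -/
def boundedProd (m : ℕ → ℕ) : StarSubalgebra ℂ (∀ k, Mat (m k)) where
  carrier := {a | ∃ C : ℝ, ∀ k, ‖a k‖ ≤ C}
  mul_mem' := by
    rintro a b ⟨C, hC⟩ ⟨D, hD⟩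
    refine ⟨C * D, fun k => (norm_mul_le _ _).trans ?_⟩
    exact mul_le_mul (hC k) (hD k) (norm_nonneg _) ((norm_nonneg _).trans (hC k))
  add_mem' := by
    rintro a b ⟨C, hC⟩ ⟨D, hD⟩
    exact ⟨C + D, fun k => (norm_add_le _ _).trans (add_le_add (hC k) (hD k))⟩
  algebraMap_mem' := by
    intro r
    refine ⟨‖r‖ * 1, fun k => ?_⟩
    rw [Pi.algebraMap_apply, Algebra.algebraMap_eq_smul_one]
    refine (norm_smul_le _ _).trans (mul_le_mul_of_nonneg_left ?_ (norm_nonneg _))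
    rcases subsingleton_or_nontrivial (Mat (m k)) with h | h
    · rw [Subsingleton.elim (1 : Mat (m k)) 0, norm_zero]; exact zero_le_one
    · exact (CStarRing.norm_one (E := Mat (m k))).le
  star_mem' := by
    rintro a ⟨C, hC⟩
    exact ⟨C, fun k => by rw [Pi.star_apply, norm_star]; exact hC k⟩

/-- Two bounded sequences are congruent along the filter `l` if the norms of their differences
tend to `0` along `l`; that is, congruence modulo the closed two-sided ideal of bounded sequences
with norms tending to `0` along `l`. -/
def nullCon (m : ℕ → ℕ) (l : Filter ℕ) : RingCon (boundedProd m) where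
  r a b := Tendsto (fun k => ‖a.1 k - b.1 k‖) l (𝓝 0)
  iseqv :=
    { refl := fun a => by simpa using tendsto_const_nhds
      symm := fun {a b} h => by simpa only [norm_sub_rev] using h
      trans := fun {a b c} h h' => by
        refine squeeze_zero (fun k => norm_nonneg _) (fun k => ?_) (by simpa using h.add h')
        exact norm_sub_le_norm_sub_add_norm_sub _ _ _ }
  mul' := by
    rintro a b c d h h'
    obtain ⟨C, hC⟩ := b.2
    obtain ⟨D, hD⟩ := c.2
    have key : Tendsto (fun k => ‖a.1 k - b.1 k‖ * D + C * ‖c.1 k - d.1 k‖) l (𝓝 0) := by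
      simpa using (h.mul_const D).add (h'.const_mul C)
    refine squeeze_zero (fun k => norm_nonneg _) (fun k => ?_) key
    have e : (a * c).1 k - (b * d).1 k
        = (a.1 k - b.1 k) * c.1 k + b.1 k * (c.1 k - d.1 k) := by
      change a.1 k * c.1 k - b.1 k * d.1 k = _
      noncomm_ring
    rw [e]
    refine (norm_add_le _ _).trans (add_le_add ?_ ?_)
    · exact (norm_mul_le _ _).trans (mul_le_mul_of_nonneg_left (hD k) (norm_nonneg _))
    · exact (norm_mul_le _ _).trans (mul_le_mul_of_nonneg_right (hC k) (norm_nonneg _))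
  add' := by
    rintro a b c d h h'
    refine squeeze_zero (fun k => norm_nonneg _) (fun k => ?_) (by simpa using h.add h')
    have e : (a + c).1 k - (b + d).1 k = (a.1 k - b.1 k) + (c.1 k - d.1 k) := by
      change a.1 k + c.1 k - (b.1 k + d.1 k) = _
      abel
    rw [e]
    exact norm_add_le _ _

/-- The quotient of `∏_k M_{m k}(ℂ)` by the ideal of sequences whose norms tend to `0` along `l`.
For `l = atTop` this is `∏_k M_{m k}(ℂ) / ∑_k M_{m k}(ℂ)`, where `∑` is the `c₀`-direct sum;
for `l` an ultrafilter it is the C*-algebraic (norm) ultraproduct. -/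
def MatQuot (m : ℕ → ℕ) (l : Filter ℕ) : Type := (nullCon m l).Quotient

namespace MatQuot

variable (m : ℕ → ℕ) (l : Filter ℕ)

instance : Ring (MatQuot m l) := inferInstanceAs (Ring (nullCon m l).Quotient)

instance : Algebra ℂ (MatQuot m l) := inferInstanceAs (Algebra ℂ (nullCon m l).Quotient)

/-- The class of a bounded sequence. -/
def mk (a : boundedProd m) : MatQuot m l := (a : (nullCon m l).Quotient)

instance : StarRing (MatQuot m l) where
  star := Quotient.map' (fun a => star a) (fun a b h => by
    change Tendsto (fun k => ‖star (a.1 k) - star (b.1 k)‖) l (𝓝 0)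
    have h' : Tendsto (fun k => ‖a.1 k - b.1 k‖) l (𝓝 0) := h
    simpa only [← star_sub, norm_star] using h')
  star_involutive := by
    rintro ⟨a⟩
    exact congrArg (mk m l) (star_star a)
  star_mul := by
    rintro ⟨a⟩ ⟨b⟩
    exact congrArg (mk m l) (star_mul a b)
  star_add := by
    rintro ⟨a⟩ ⟨b⟩
    exact congrArg (mk m l) (star_add a b)

end MatQuot

/-- The ultraproduct `∏^α M_k(ℂ)`, `k = 1, 2, 3, …`, for an ultrafilter `α` on `ℕ`; the algebra
with index `k = 0, 1, 2, …` is `M_{k+1}(ℂ)`. -/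
abbrev MatUltraproduct (α : Ultrafilter ℕ) : Type := MatQuot (fun k => k + 1) (α : Filter ℕ)

theorem norm_normTrace_le (k : ℕ) (A : Mat k) : ‖normTrace k A‖ ≤ ‖A‖ := by
  have hent : ∀ i, ‖A i i‖ ≤ ‖A‖ := fun i => by
    have h := Matrix.l2_opNorm_mulVec A (EuclideanSpace.single i (1 : ℂ))
    have h2 := (PiLp.norm_apply_le
      (WithLp.toLp 2 (A.mulVec (EuclideanSpace.single i (1 : ℂ)).ofLp)) i).trans h
    simpa using h2
  rcases Nat.eq_zero_or_pos k with rfl | hk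
  · simp [normTrace]
  · have hk' : (0 : ℝ) < k := by exact_mod_cast hk
    have h1 : ‖A.trace‖ ≤ k * ‖A‖ := by
      refine (norm_sum_le _ _).trans ((Finset.sum_le_sum fun i _ => hent i).trans ?_)
      simp
    rw [normTrace, norm_mul, norm_inv, Complex.norm_natCast]
    rw [inv_mul_le_iff₀ hk']
    exact h1

/-- For every bounded sequence `a` representing `q`, the normalized traces converge along the
ultrafilter; this limit is `τ_α q`. -/
def ultraTrace (α : Ultrafilter ℕ) (q : MatUltraproduct α) : ℂ :=
  Quotient.liftOn' q
    (fun a : boundedProd (fun k => k + 1) =>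
      limUnder (α : Filter ℕ) (fun k => normTrace (k + 1) (a.1 k)))
    (fun a b h => by
      have hlim : ∀ c : boundedProd (fun k => k + 1),
          ∃ z, Tendsto (fun k => normTrace (k + 1) (c.1 k)) (α : Filter ℕ) (𝓝 z) := by
        intro c
        obtain ⟨C, hC⟩ := c.2
        obtain ⟨z, -, hz⟩ := (isCompact_closedBall (0 : ℂ) C).ultrafilter_le_nhds
          (α.map (fun k => normTrace (k + 1) (c.1 k))) (by
            rw [le_principal_iff]
            refine Filter.mem_map.2 (Filter.univ_mem' fun k => ?_)
            simpa using (norm_normTrace_le (k + 1) (c.1 k)).trans (hC k))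
        exact ⟨z, hz⟩
      obtain ⟨z, hz⟩ := hlim a
      have h0 : Tendsto (fun k => normTrace (k + 1) (b.1 k) - normTrace (k + 1) (a.1 k))
          (α : Filter ℕ) (𝓝 0) := by
        rw [tendsto_zero_iff_norm_tendsto_zero]
        have h' : Tendsto (fun k => ‖a.1 k - b.1 k‖) (α : Filter ℕ) (𝓝 0) := h
        refine squeeze_zero (fun k => norm_nonneg _) (fun k => ?_) h'
        have e : normTrace (k + 1) (b.1 k) - normTrace (k + 1) (a.1 k)
            = normTrace (k + 1) (b.1 k - a.1 k) := by
          simp only [normTrace, Matrix.trace_sub, mul_sub]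
        rw [e, norm_sub_rev (a.1 k)]
        exact norm_normTrace_le _ _
      have hzb : Tendsto (fun k => normTrace (k + 1) (b.1 k)) (α : Filter ℕ) (𝓝 z) := by
        simpa using h0.add hz
      change limUnder _ _ = limUnder _ _
      rw [hz.limUnder_eq, hzb.limUnder_eq])

/-! ### MF-algebras, tracial states and MF-traces -/

/-- `A` is an MF-algebra: for some strictly increasing sequence of positive integers `m k` there is
an embedding (an injective, not necessarily unital, *-homomorphism) of `A` into
`∏_k M_{m k}(ℂ) / ∑_k M_{m k}(ℂ)`. -/
def IsMF (A : Type*) [Semiring A] [Algebra ℂ A] [Star A] : Prop :=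
  ∃ m : ℕ → ℕ, StrictMono m ∧ (∀ k, 0 < m k) ∧
    ∃ Φ : A →⋆ₙₐ[ℂ] MatQuot m atTop, Function.Injective Φ

section Traces

variable {A : Type*} [NormedRing A] [StarRing A] [NormedAlgebra ℂ A]

/-- A tracial state: a positive functional of value `1` at the unit with `τ(ab) = τ(ba)`. -/
def IsTracialState (τ : WeakDual ℂ A) : Prop :=
  (∀ a : A, 0 ≤ τ (star a * a)) ∧ τ 1 = 1 ∧ ∀ a b : A, τ (a * b) = τ (b * a)

/-- The value at the tuple `x` of a *-polynomial in the free variables `t_i`, `i : ι`. Such a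
polynomial is a noncommutative polynomial in the `t_i` (`Sum.inl i`) and `t_i^*` (`Sum.inr i`). -/
def starEval {A : Type*} [Semiring A] [Algebra ℂ A] [Star A] {ι : Type*} (x : ι → A)
    (p : FreeAlgebra ℂ (ι ⊕ ι)) : A :=
  FreeAlgebra.lift ℂ (Sum.elim x fun i => star (x i)) p

/-- `A = C*(x_i : i ∈ ι)`: the unital *-subalgebra generated by the family `x` is dense. -/
def Generates [StarModule ℂ A] {ι : Type*} (x : ι → A) : Prop :=
  Dense (StarAlgebra.adjoin ℂ (Set.range x) : Set A)

/-- The MF-traces of the C*-algebra generated by the family `x`: the tracial states `τ` for which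
there are positive integers `m k` and matrices `T i k ∈ M_{m k}(ℂ)` such that for every
*-polynomial `p` the norms and the normalized traces of `p` at `(T i k)_i` converge, as `k → ∞`,
to `‖p(x)‖` and `τ(p(x))`. -/
def MFTraces {ι : Type*} (x : ι → A) : Set (WeakDual ℂ A) :=
  {τ | IsTracialState τ ∧ ∃ m : ℕ → ℕ, (∀ k, 0 < m k) ∧ ∃ T : ι → ∀ k, Mat (m k),
    ∀ p : FreeAlgebra ℂ (ι ⊕ ι),
      Tendsto (fun k => ‖starEval (fun i => T i k) p‖) atTop (𝓝 ‖starEval x p‖) ∧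
      Tendsto (fun k => normTrace (m k) (starEval (fun i => T i k) p)) atTop
        (𝓝 (τ (starEval x p)))}

/-- The state `τ` factors through a tracial state of a finite-dimensional C*-algebra by a unital
*-homomorphism. -/
def IsFiniteDimensionalTrace (τ : WeakDual ℂ A) : Prop :=
  ∃ (D : Type v) (_ : CStarAlgebra D) (_ : FiniteDimensional ℂ D) (ρ : WeakDual ℂ D)
    (π : A →⋆ₐ[ℂ] D), IsTracialState ρ ∧ ∀ a, τ a = ρ (π a)

/-- The restriction of a functional to a unital *-subalgebra. -/
def restrictTo [StarModule ℂ A] (B : StarSubalgebra ℂ A) (φ : WeakDual ℂ A) : WeakDual ℂ B :=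
  StrongDual.toWeakDual ((WeakDual.toStrongDual φ).comp
    ⟨B.subtype.toAlgHom.toLinearMap, continuous_subtype_val⟩)

end Traces

/-- The composite `φ ∘ π` of a functional `φ` on `π(A)` with `π`. -/
def compRange {A : Type*} {C : Type*} [CStarAlgebra A] [CStarAlgebra C] (π : A →⋆ₐ[ℂ] C)
    (φ : WeakDual ℂ π.range) : WeakDual ℂ A :=
  StrongDual.toWeakDual ((WeakDual.toStrongDual φ).comp
    ⟨π.rangeRestrict.toAlgHom.toLinearMap, Continuous.subtype_mk
      (AddMonoidHomClass.continuous_of_bound π 1 fun a => by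
        simpa using NonUnitalStarAlgHom.norm_apply_le π a) _⟩)

/-! ### The completion of a normed *-algebra with the C*-identity -/

section Completion

open UniformSpace

variable {E : Type*} [NormedRing E] [StarRing E] [CStarRing E] [NormedAlgebra ℂ E] [StarModule ℂ E]

theorem uniformContinuous_star' : UniformContinuous (star : E → E) :=
  (starₗᵢ ℂ : E ≃ₗᵢ⋆[ℂ] E).isometry.uniformContinuous

/-- The involution of the completion, the continuous extension of the given one. -/
instance completionStar : Star (Completion E) := ⟨Completion.map star⟩

instance completionContinuousStar : ContinuousStar (Completion E) := ⟨Completion.continuous_map⟩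

theorem star_coe (a : E) : star (a : Completion E) = ((star a : E) : Completion E) :=
  Completion.map_coe uniformContinuous_star' a

instance completionStarRing : StarRing (Completion E) where
  star_involutive x := by
    induction x using Completion.induction_on with
    | hp => exact isClosed_eq (continuous_star.comp continuous_star) continuous_id
    | ih a => rw [star_coe, star_coe, star_star]
  star_mul x y := by
    induction x, y using Completion.induction_on₂ with
    | hp => apply isClosed_eq <;> fun_prop
    | ih a b => simp only [← Completion.coe_mul, star_coe, star_mul]
  star_add x y := by
    induction x, y using Completion.induction_on₂ with
    | hp => apply isClosed_eq <;> fun_prop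
    | ih a b => simp only [← Completion.coe_add, star_coe, star_add]

instance completionCStarRing : CStarRing (Completion E) where
  norm_mul_self_le x := by
    induction x using Completion.induction_on with
    | hp => apply isClosed_le <;> fun_prop
    | ih a =>
      rw [star_coe, ← Completion.coe_mul, Completion.norm_coe, Completion.norm_coe]
      exact CStarRing.norm_mul_self_le a

instance completionNormedAlgebra : NormedAlgebra ℂ (Completion E) where
  norm_smul_le := norm_smul_le

theorem star_smul_completion (r : ℂ) (x : Completion E) : star (r • x) = star r • star x := by
  induction x using Completion.induction_on with
  | hp =>
    exact isClosed_eq (continuous_star.comp (continuous_const_smul r))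
      (continuous_star.const_smul (star r))
  | ih a => rw [← Completion.coe_smul, star_coe, star_coe, ← Completion.coe_smul, star_smul]

instance completionStarModule : StarModule ℂ (Completion E) where
  star_smul := star_smul_completion

instance completionCStarAlgebra : CStarAlgebra (Completion E) where

end Completion

/-! ### C*-tensor products -/

section Tensor

variable (A : Type u) (B : Type v) [CStarAlgebra A] [CStarAlgebra B]

/-- A C*-norm on the algebraic tensor product `A ⊗ B`: a submultiplicative norm with
`‖x* x‖ = ‖x‖²`. -/
structure CStarTensorNorm extends AlgebraNorm ℂ (A ⊗[ℂ] B) where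
  cstar' : ∀ x : A ⊗[ℂ] B, toFun (star x * x) = toFun x ^ 2

variable {A B}

namespace CStarTensorNorm

/-- The algebraic tensor product, carrying the norm `ν`. -/
def Alg (_ν : CStarTensorNorm A B) : Type (max u v) := A ⊗[ℂ] B

variable (ν : CStarTensorNorm A B)

instance : NormedRing ν.Alg := ν.toRingNorm.toNormedRing

instance : StarRing ν.Alg := inferInstanceAs (StarRing (A ⊗[ℂ] B))

instance : Algebra ℂ ν.Alg := inferInstanceAs (Algebra ℂ (A ⊗[ℂ] B))

instance : NormedAlgebra ℂ ν.Alg where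
  norm_smul_le r x := (ν.smul' r x).le

instance : StarModule ℂ ν.Alg := inferInstanceAs (StarModule ℂ (A ⊗[ℂ] B))

instance : CStarRing ν.Alg where
  norm_mul_self_le x := by
    have h := ν.cstar' x
    rw [pow_two] at h
    exact h.ge

/-- The C*-algebra `A ⊗_ν B`: the completion of the algebraic tensor product in the norm `ν`. -/
abbrev Tensor : Type (max u v) := UniformSpace.Completion ν.Alg

/-- An element of the algebraic tensor product, seen in the normed algebra `ν.Alg`. -/
def ofTensor (x : A ⊗[ℂ] B) : ν.Alg := x

/-- The element `a ⊗ b` of `A ⊗_ν B`. -/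
def tmul (a : A) (b : B) : ν.Tensor := (ν.ofTensor (a ⊗ₜ[ℂ] b) : ν.Tensor)

end CStarTensorNorm

end Tensor

/-! ### The spatial norm and exact C*-algebras -/

section Exact

/-- For *-representations `π` of `A` on `H` and `ρ` of `C` on `K`, the map
`∑ a_i ⊗ c_i ↦ ∑ π(a_i) ⊗ ρ(c_i)` into the bounded operators on `H ⊗ K`. (The algebraic tensor
product `H ⊗ K` has its inner product and is dense in the Hilbert space tensor product, so that
operator norms are the same on both.) -/
def tensorRep {A : Type*} {C : Type*} [NonUnitalCStarAlgebra A] [NonUnitalCStarAlgebra C]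
    {H : Type*} [NormedAddCommGroup H] [InnerProductSpace ℂ H] [CompleteSpace H]
    {K : Type*} [NormedAddCommGroup K] [InnerProductSpace ℂ K] [CompleteSpace K]
    (π : A →⋆ₙₐ[ℂ] (H →L[ℂ] H)) (ρ : C →⋆ₙₐ[ℂ] (K →L[ℂ] K)) :
    A ⊗[ℂ] C →ₗ[ℂ] ((H ⊗[ℂ] K) →L[ℂ] (H ⊗[ℂ] K)) :=
  TensorProduct.lift (LinearMap.mk₂ ℂ (fun a c => TensorProduct.mapL (π a) (ρ c))
    (fun a a' c => by rw [map_add, TensorProduct.mapL_add_left])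
    (fun r a c => by rw [map_smul, TensorProduct.mapL_smul_left])
    (fun a c c' => by rw [map_add, TensorProduct.mapL_add_right])
    (fun r a c => by rw [map_smul, TensorProduct.mapL_smul_right]))

/-- The minimal (spatial) C*-norm on `A ⊗ C`: the supremum of `‖(π ⊗ ρ)(x)‖` over all
*-representations `π` of `A` and `ρ` of `C` on Hilbert spaces. -/
def minNorm {A : Type u} {C : Type v} [NonUnitalCStarAlgebra A] [NonUnitalCStarAlgebra C]
    (x : A ⊗[ℂ] C) : ℝ :=
  sSup {r : ℝ | ∃ (H : Type u) (_ : NormedAddCommGroup H) (_ : InnerProductSpace ℂ H)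
    (_ : CompleteSpace H) (K : Type v) (_ : NormedAddCommGroup K) (_ : InnerProductSpace ℂ K)
    (_ : CompleteSpace K) (π : A →⋆ₙₐ[ℂ] (H →L[ℂ] H)) (ρ : C →⋆ₙₐ[ℂ] (K →L[ℂ] K)),
    r = ‖tensorRep π ρ x‖}

/-- `A` is exact: for every extension `0 → J → C → D → 0` of C*-algebras the sequence
`0 → A ⊗_min J → A ⊗_min C → A ⊗_min D → 0` is exact, that is, the canonical map
`(A ⊗_min C) / (A ⊗_min J) → A ⊗_min D` is isometric: the minimal norm of `(id ⊗ q)(x)` is the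
distance, in the minimal norm, from `x` to the algebraic tensor product of `A` and `J = ker q`.
(The distance is never smaller, and by density it suffices to take `x` in the algebraic tensor
product. Every separable C*-algebra is isomorphic to one in the lowest universe, and separable `C`
suffice.) -/
def IsExact (A : Type u) [NonUnitalCStarAlgebra A] : Prop :=
  ∀ (C D : Type) [NonUnitalCStarAlgebra C] [NonUnitalCStarAlgebra D] (q : C →⋆ₙₐ[ℂ] D),
    Function.Surjective q → ∀ (x : A ⊗[ℂ] C) (ε : ℝ), 0 < ε →
      ∃ y ∈ Submodule.span ℂ {t : A ⊗[ℂ] C | ∃ (a : A) (c : C), q c = 0 ∧ t = a ⊗ₜ[ℂ] c},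
        minNorm (x - y) ≤
          minNorm (TensorProduct.map LinearMap.id (q : C →ₗ[ℂ] D) x) + ε

end Exact

end MFAlg

end

open MFAlg

/-! An MF-trace asks for matrix models whose norms and traces are both correct in the limit. For a
tracial state on an MF-algebra, upper norm bounds suffice: for every finite set of *-polynomials and
every ε, one tuple of matrices whose norms are at most ε too large and whose traces are within ε
(`UpperApprox`). Indeed the MF property supplies tuples with almost correct norms; added as a direct
summand of small relative dimension, such a tuple repairs the norms from below and hardly moves the
trace. Treating more and more members of a countable dense family of polynomials then gives a
sequence (`mem_MFTraces_of_upperApprox`).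

The same data can be read as linear maps into matrix algebras that are asymptotically unital
*-homomorphisms along a filter (`IsAsympHom`). These are automatically asymptotically contractive,
because an identity `‖a‖² = a*a + b*b` is asymptotically preserved. They no longer mention
generators, so MF-traces do not depend on the generating family and restrict to subalgebras.

Limits of traces along an ultrafilter give existence, direct sums with multiplicities give
convexity, and closedness holds because a finite set of polynomials sees finitely many values of the
trace. Quotient maps and maps into ultraproducts provide upper norm bounds only, which is all that
is needed; in the other direction a matrix model is amplified to pairwise distinct sizes and placed
in an ultraproduct. For finite-dimensional traces, Krein–Milman reduces to an extreme trace of a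
finite-dimensional algebra. The normalized trace of its GNS representation is dominated by a
multiple of it, so extremality makes the two equal.

For tensor products, Takesaki's theorem is proved first: product states are contractive for every
C*-norm (`CStarTensorNorm.norm_prodFun_le`), so the product functional exists and the spatial norm
is the least C*-norm. Given models `s j` of one factor and `t k` of the other, the traces of `s j ⊗
t k` converge to the product; the point is the upper norm bound. Say the first factor is exact. The
second is a quotient of an algebra of bounded sequences of matrices by null sequences, so exactness
lifts a tensor to sequences with almost no increase of the spatial norm, up to a correction by null
sequences. For fixed `k`, tensoring `s j` with the `k`-th coordinate is asymptotically contractive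
for the spatial norm as `j → ∞`; the correction disappears as `k → ∞`. The resulting iterated limit
is recorded by a filter on pairs of indices. -/

set_option linter.unusedSectionVars false

namespace MFAlg

/-! ### Evaluation of *-polynomials -/

section StarEval

variable {A B : Type*} [Semiring A] [Algebra ℂ A] [Star A] [Semiring B] [Algebra ℂ B] [Star B]
  {ι : Type*}

@[simp] theorem starEval_algebraMap (x : ι → A) (r : ℂ) :
    starEval x (algebraMap ℂ _ r) = algebraMap ℂ A r := by simp [starEval]

@[simp] theorem starEval_inl (x : ι → A) (i : ι) :
    starEval x (FreeAlgebra.ι ℂ (Sum.inl i)) = x i := by simp [starEval]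

@[simp] theorem starEval_inr (x : ι → A) (i : ι) :
    starEval x (FreeAlgebra.ι ℂ (Sum.inr i)) = star (x i) := by simp [starEval]

@[simp] theorem starEval_add (x : ι → A) (p q) :
    starEval x (p + q) = starEval x p + starEval x q := by simp [starEval]

@[simp] theorem starEval_mul (x : ι → A) (p q) :
    starEval x (p * q) = starEval x p * starEval x q := by simp [starEval]

@[simp] theorem starEval_smul (x : ι → A) (r : ℂ) (p) :
    starEval x (r • p) = r • starEval x p := by simp [starEval]

@[simp] theorem starEval_one (x : ι → A) : starEval x 1 = 1 := by simp [starEval]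

@[simp] theorem starEval_zero (x : ι → A) : starEval x 0 = 0 := by simp [starEval]

theorem starEval_sub {A : Type*} [Ring A] [Algebra ℂ A] [Star A] (x : ι → A) (p q) :
    starEval x (p - q) = starEval x p - starEval x q := by simp [starEval]

theorem map_starEval (f : A →⋆ₐ[ℂ] B) (x : ι → A) (p) :
    f (starEval x p) = starEval (fun i => f (x i)) p := by
  induction p using FreeAlgebra.induction with
  | grade0 r => simpa using AlgHomClass.commutes f r
  | grade1 j => rcases j with j | j <;> simp [map_star]
  | mul p q hp hq => simp [hp, hq]
  | add p q hp hq => simp [hp, hq]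

/-- Every *-polynomial has an adjoint. -/
theorem exists_starEval_eq_star (p : FreeAlgebra ℂ (ι ⊕ ι)) :
    ∃ q : FreeAlgebra ℂ (ι ⊕ ι),
      (∀ {A : Type u} [Ring A] [StarRing A] [Algebra ℂ A] [StarModule ℂ A] (x : ι → A),
        starEval x q = star (starEval x p)) ∧
      (∀ {A : Type v} [Ring A] [StarRing A] [Algebra ℂ A] [StarModule ℂ A] (x : ι → A),
        starEval x q = star (starEval x p)) := by
  induction p using FreeAlgebra.induction with
  | grade0 r =>
    refine ⟨algebraMap ℂ _ (star r), fun x => ?_, fun x => ?_⟩ <;>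
    rw [starEval_algebraMap, starEval_algebraMap, algebraMap_star_comm]
  | grade1 j =>
    rcases j with j | j
    · exact ⟨FreeAlgebra.ι ℂ (Sum.inr j), fun x => by simp, fun x => by simp⟩
    · exact ⟨FreeAlgebra.ι ℂ (Sum.inl j), fun x => by simp, fun x => by simp⟩
  | mul p q hp hq =>
    obtain ⟨p', hp, hp'⟩ := hp
    obtain ⟨q', hq, hq'⟩ := hq
    exact ⟨q' * p', fun x => by simp [hp, hq], fun x => by simp [hp', hq']⟩
  | add p q hp hq =>
    obtain ⟨p', hp, hp'⟩ := hp
    obtain ⟨q', hq, hq'⟩ := hq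
    exact ⟨p' + q', fun x => by simp [hp, hq], fun x => by simp [hp', hq']⟩

end StarEval

theorem Generates.exists_starEval_near {A : Type u} [NormedRing A] [StarRing A] [NormedAlgebra ℂ A]
    [StarModule ℂ A] {ι : Type*} {x : ι → A} (hx : Generates x) (a : A) {ε : ℝ} (hε : 0 < ε) :
    ∃ p, ‖a - starEval x p‖ < ε := by
  obtain ⟨b, hb, hab⟩ := Metric.mem_closure_iff.1 (hx a) ε hε
  have : ∃ p, starEval x p = b := by
    clear hab
    induction hb using StarAlgebra.adjoin_induction with
    | mem b hb =>
      obtain ⟨i, rfl⟩ := hb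
      exact ⟨FreeAlgebra.ι ℂ (Sum.inl i), by simp⟩
    | algebraMap r => exact ⟨algebraMap ℂ _ r, by simp⟩
    | add a b _ _ ha hb =>
      obtain ⟨p, rfl⟩ := ha
      obtain ⟨q, rfl⟩ := hb
      exact ⟨p + q, by simp⟩
    | mul a b _ _ ha hb =>
      obtain ⟨p, rfl⟩ := ha
      obtain ⟨q, rfl⟩ := hb
      exact ⟨p * q, by simp⟩
    | star a _ ha =>
      obtain ⟨p, rfl⟩ := ha
      obtain ⟨q, hq, -⟩ := exists_starEval_eq_star.{u, u} p
      exact ⟨q, hq x⟩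
  obtain ⟨p, rfl⟩ := this
  exact ⟨p, by rwa [dist_eq_norm] at hab⟩

/-! ### Asymptotic equality of families of matrices along a filter -/

section AsympEq

variable {I : Type*} {l : Filter I} {m : I → ℕ}

/-- The norms of the differences tend to `0` along `l`. -/
def AsympEq (l : Filter I) (c d : ∀ i, Mat (m i)) : Prop :=
  Tendsto (fun i => ‖c i - d i‖) l (𝓝 0)

/-- The norms are bounded along `l`. -/
def EvBdd (l : Filter I) (c : ∀ i, Mat (m i)) : Prop :=
  ∃ C : ℝ, ∀ᶠ i in l, ‖c i‖ ≤ C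

variable {c c' c'' d d' : ∀ i, Mat (m i)}

theorem AsympEq.refl (c : ∀ i, Mat (m i)) : AsympEq l c c := by
  simpa [AsympEq] using tendsto_const_nhds

theorem AsympEq.of_eq (h : ∀ i, c i = d i) : AsympEq l c d := by
  obtain rfl : c = d := funext h
  exact .refl c

theorem AsympEq.symm (h : AsympEq l c d) : AsympEq l d c := by
  simpa only [AsympEq, norm_sub_rev] using h

theorem AsympEq.trans (h : AsympEq l c c') (h' : AsympEq l c' c'') : AsympEq l c c'' := by
  refine squeeze_zero (fun k => norm_nonneg _) (fun k => ?_) (by simpa using h.add h')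
  exact norm_sub_le_norm_sub_add_norm_sub _ _ _

theorem AsympEq.mono {l' : Filter I} (h : AsympEq l c d) (hl : l' ≤ l) : AsympEq l' c d :=
  h.mono_left hl

theorem AsympEq.of_le {f : I → ℝ} (hf : Tendsto f l (𝓝 0)) (h : ∀ i, ‖c i - d i‖ ≤ f i) :
    AsympEq l c d :=
  squeeze_zero (fun _ => norm_nonneg _) h hf

theorem AsympEq.eventually_le (h : AsympEq l c d) {ε : ℝ} (hε : 0 < ε) :
    ∀ᶠ i in l, ‖c i - d i‖ ≤ ε :=
  (h.eventually (gt_mem_nhds hε)).mono fun _ h => h.le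

theorem asympEq_of_eventually_le (h : ∀ ε : ℝ, 0 < ε → ∀ᶠ i in l, ‖c i - d i‖ ≤ ε) :
    AsympEq l c d := by
  rw [AsympEq, Metric.tendsto_nhds]
  intro ε hε
  filter_upwards [h (ε / 2) (by positivity)] with i hi
  simp only [dist_zero_right, norm_norm]
  linarith

theorem AsympEq.add (h : AsympEq l c d) (h' : AsympEq l c' d') :
    AsympEq l (fun i => c i + c' i) (fun i => d i + d' i) := by
  refine .of_le (by simpa using Tendsto.add h h') fun i => ?_
  rw [add_sub_add_comm]
  exact norm_add_le _ _

theorem AsympEq.sub (h : AsympEq l c d) (h' : AsympEq l c' d') :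
    AsympEq l (fun i => c i - c' i) (fun i => d i - d' i) := by
  refine .of_le (by simpa using Tendsto.add h h') fun i => ?_
  rw [sub_sub_sub_comm]
  exact norm_sub_le _ _

theorem AsympEq.smul (h : AsympEq l c d) (r : ℂ) :
    AsympEq l (fun i => r • c i) (fun i => r • d i) := by
  refine .of_le (by simpa using Tendsto.const_mul ‖r‖ h) fun i => ?_
  rw [← smul_sub, norm_smul]

theorem AsympEq.conj (h : AsympEq l c d) :
    AsympEq l (fun i => star (c i)) (fun i => star (d i)) := by
  simpa only [AsympEq, ← star_sub, norm_star] using h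

theorem AsympEq.evBdd (h : AsympEq l c d) (hd : EvBdd l d) : EvBdd l c := by
  obtain ⟨C, hC⟩ := hd
  refine ⟨1 + C, ?_⟩
  filter_upwards [hC, h.eventually_le one_pos] with i h1 h2
  calc ‖c i‖ = ‖(c i - d i) + d i‖ := by rw [sub_add_cancel]
    _ ≤ _ := (norm_add_le _ _).trans (add_le_add h2 h1)

theorem AsympEq.mul (h : AsympEq l c d) (h' : AsympEq l c' d') (hc : EvBdd l d)
    (hd : EvBdd l c') : AsympEq l (fun i => c i * c' i) (fun i => d i * d' i) := by
  obtain ⟨C, hC⟩ := hc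
  obtain ⟨D, hD⟩ := hd
  have key : Tendsto (fun i => ‖c i - d i‖ * D + C * ‖c' i - d' i‖) l (𝓝 0) := by
    simpa using (Tendsto.mul_const D h).add (Tendsto.const_mul C h')
  refine squeeze_zero' (Eventually.of_forall fun i => norm_nonneg _) ?_ key
  filter_upwards [hC, hD] with i h1 h2
  have e : c i * c' i - d i * d' i = (c i - d i) * c' i + d i * (c' i - d' i) := by noncomm_ring
  rw [e]
  refine (norm_add_le _ _).trans (add_le_add ?_ ?_)
  · exact (norm_mul_le _ _).trans (mul_le_mul_of_nonneg_left h2 (norm_nonneg _))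
  · exact (norm_mul_le _ _).trans (mul_le_mul_of_nonneg_right h1 (norm_nonneg _))

theorem norm_one_mat_le (k : ℕ) : ‖(1 : Mat k)‖ ≤ 1 := by
  rcases subsingleton_or_nontrivial (Mat k) with h | h
  · rw [Subsingleton.elim (1 : Mat k) 0, norm_zero]; exact zero_le_one
  · exact (CStarRing.norm_one (E := Mat k)).le

theorem evBdd_one : EvBdd l (fun i => (1 : Mat (m i))) :=
  ⟨1, Eventually.of_forall fun _ => norm_one_mat_le _⟩

theorem EvBdd.add (h : EvBdd l c) (h' : EvBdd l d) : EvBdd l (fun i => c i + d i) := by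
  obtain ⟨C, hC⟩ := h
  obtain ⟨D, hD⟩ := h'
  exact ⟨C + D, by filter_upwards [hC, hD] with i h1 h2 using
    (norm_add_le _ _).trans (add_le_add h1 h2)⟩

theorem EvBdd.mul (h : EvBdd l c) (h' : EvBdd l d) : EvBdd l (fun i => c i * d i) := by
  obtain ⟨C, hC⟩ := h
  obtain ⟨D, hD⟩ := h'
  refine ⟨C * D, ?_⟩
  filter_upwards [hC, hD] with i h1 h2
  exact (norm_mul_le _ _).trans
    (mul_le_mul h1 h2 (norm_nonneg _) ((norm_nonneg _).trans h1))

theorem EvBdd.conj (h : EvBdd l c) : EvBdd l (fun i => star (c i)) := by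
  simpa only [EvBdd, norm_star] using h

theorem AsympEq.tendsto_norm (h : AsympEq l c d) {r : ℝ} (hd : Tendsto (fun i => ‖d i‖) l (𝓝 r)) :
    Tendsto (fun i => ‖c i‖) l (𝓝 r) := by
  have h0 : Tendsto (fun i => ‖c i‖ - ‖d i‖) l (𝓝 0) :=
    squeeze_zero_norm (fun i => abs_norm_sub_norm_le _ _) h
  simpa using h0.add hd

theorem normTrace_sub (k : ℕ) (a b : Mat k) : normTrace k (a - b) = normTrace k a - normTrace k b := by
  simp only [normTrace, Matrix.trace_sub, mul_sub]

theorem normTrace_add (k : ℕ) (a b : Mat k) : normTrace k (a + b) = normTrace k a + normTrace k b := by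
  simp only [normTrace, Matrix.trace_add, mul_add]

theorem normTrace_smul (k : ℕ) (r : ℂ) (a : Mat k) : normTrace k (r • a) = r * normTrace k a := by
  simp only [normTrace, Matrix.trace_smul, smul_eq_mul]; ring

theorem normTrace_mul_comm (k : ℕ) (a b : Mat k) : normTrace k (a * b) = normTrace k (b * a) := by
  simp only [normTrace, Matrix.trace_mul_comm a b]

theorem normTrace_one {k : ℕ} (hk : 0 < k) : normTrace k 1 = 1 := by
  have : (k : ℂ) ≠ 0 := by exact_mod_cast hk.ne'
  simp [normTrace, this]

theorem normTrace_star_mul_self_nonneg (k : ℕ) (a : Mat k) : 0 ≤ normTrace k (star a * a) := by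
  have h : (0 : ℂ) ≤ (star a * a).trace := (Matrix.posSemidef_conjTranspose_mul_self a).trace_nonneg
  have h' : (0 : ℂ) ≤ (k : ℂ)⁻¹ := by
    have : (0 : ℝ) ≤ (k : ℝ)⁻¹ := by positivity
    rw [← Complex.ofReal_natCast, ← Complex.ofReal_inv]
    exact_mod_cast this
  exact mul_nonneg h' h

theorem AsympEq.tendsto_normTrace (h : AsympEq l c d) {r : ℂ}
    (hd : Tendsto (fun i => normTrace (m i) (d i)) l (𝓝 r)) :
    Tendsto (fun i => normTrace (m i) (c i)) l (𝓝 r) := by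
  have h0 : Tendsto (fun i => normTrace (m i) (c i) - normTrace (m i) (d i)) l (𝓝 0) :=
    squeeze_zero_norm (fun i => by rw [← normTrace_sub]; exact norm_normTrace_le _ _) h
  simpa using h0.add hd

end AsympEq

/-! ### Asymptotic *-homomorphisms into matrix algebras -/

section AsympHom

variable {I : Type*} {l : Filter I} {m : I → ℕ} {A : Type*}

/-- A family of linear maps into matrix algebras which is asymptotically a unital *-homomorphism
along `l`. -/
structure IsAsympHom [Ring A] [StarRing A] [Algebra ℂ A] (l : Filter I)
    (s : ∀ i, A →ₗ[ℂ] Mat (m i)) : Prop where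
  asymp_one : AsympEq l (fun i => s i 1) (fun _ => 1)
  asymp_mul : ∀ a b, AsympEq l (fun i => s i (a * b)) (fun i => s i a * s i b)
  asymp_star : ∀ a, AsympEq l (fun i => s i (star a)) (fun i => star (s i a))
  bdd : ∀ a, EvBdd l (fun i => s i a)

theorem IsAsympHom.mono [Ring A] [StarRing A] [Algebra ℂ A] {s : ∀ i, A →ₗ[ℂ] Mat (m i)}
    (h : IsAsympHom l s) {l' : Filter I} (hl : l' ≤ l) : IsAsympHom l' s where
  asymp_one := h.asymp_one.mono hl
  asymp_mul a b := (h.asymp_mul a b).mono hl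
  asymp_star a := (h.asymp_star a).mono hl
  bdd a := by
    obtain ⟨C, hC⟩ := h.bdd a
    exact ⟨C, hl hC⟩

/-- `limsup ‖s i a‖ ≤ ‖a‖` along `l`, for all `a`. -/
def Contractive [SeminormedAddCommGroup A] [Module ℂ A] (l : Filter I)
    (s : ∀ i, A →ₗ[ℂ] Mat (m i)) : Prop :=
  ∀ a, ∀ ε : ℝ, 0 < ε → ∀ᶠ i in l, ‖s i a‖ ≤ ‖a‖ + ε

/-- This passes between asymptotic homomorphisms and tuples of matrices: products are handled by
boundedness of the factors, constants by asymptotic unitality. -/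
theorem IsAsympHom.asympEq_starEval [Ring A] [StarRing A] [Algebra ℂ A]
    {s : ∀ i, A →ₗ[ℂ] Mat (m i)} (h : IsAsympHom l s) {ι : Type*} (x : ι → A)
    (p : FreeAlgebra ℂ (ι ⊕ ι)) :
    AsympEq l (fun i => starEval (fun j => s i (x j)) p) (fun i => s i (starEval x p)) := by
  induction p using FreeAlgebra.induction with
  | grade0 r =>
    have := (h.asymp_one.smul r).symm
    simpa [Algebra.algebraMap_eq_smul_one] using this
  | grade1 j =>
    rcases j with j | j
    · simpa using AsympEq.refl _
    · simpa using (h.asymp_star (x j)).symm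
  | mul p q hp hq =>
    have := (hp.mul hq (h.bdd _) (hq.evBdd (h.bdd _))).trans
      (h.asymp_mul (starEval x p) (starEval x q)).symm
    simpa using this
  | add p q hp hq =>
    simpa using hp.add hq

end AsympHom

/-! ### Norm estimates in C*-algebras -/

section CStarEstimates

/-- The norm is monotone on positive elements and `a*a ≤ a*a + b*b`. With `e` a scalar, an
approximate identity in matrices becomes a norm bound. -/
theorem norm_sq_le_of_sum_squares {M : Type*} [CStarAlgebra M] (a b e : M) :
    ‖a‖ ^ 2 ≤ ‖e - (star a * a + star b * b)‖ + ‖e‖ := by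
  let _ := CStarAlgebra.spectralOrder M
  have := CStarAlgebra.spectralOrderedRing M
  have h1 : star a * a ≤ star a * a + star b * b :=
    le_add_of_nonneg_right (star_mul_self_nonneg b)
  have h2 := CStarAlgebra.norm_le_norm_of_nonneg_of_le (star_mul_self_nonneg a) h1
  rw [CStarRing.norm_star_mul_self, ← sq] at h2
  refine h2.trans ?_
  calc ‖star a * a + star b * b‖
      = ‖e - (e - (star a * a + star b * b))‖ := by rw [sub_sub_cancel]
    _ ≤ _ := by rw [add_comm ‖e - (star a * a + star b * b)‖]; exact norm_sub_le e _

theorem mul_norm_le_norm_sq_add {M : Type*} [CStarAlgebra M] (e : M) {r : ℝ} (hr : 0 ≤ r) :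
    r * ‖star e * e‖ ≤ ‖(star e * e) * (star e * e) + (r : ℂ) • (star e * e)‖ := by
  rw [Complex.coe_smul]
  let _ := CStarAlgebra.spectralOrder M
  have := CStarAlgebra.spectralOrderedRing M
  have h0 : 0 ≤ star e * e := star_mul_self_nonneg e
  have h1 : r • (star e * e) ≤ (star e * e) * (star e * e) + r • (star e * e) := by
    refine le_add_of_nonneg_left ?_
    have := star_mul_self_nonneg (star e * e)
    simpa [mul_assoc] using this
  have h2 := CStarAlgebra.norm_le_norm_of_nonneg_of_le (smul_nonneg hr h0) h1
  rwa [norm_smul, Real.norm_of_nonneg hr] at h2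

/-- The inequality `a*a ≤ ‖a‖²` becomes an algebraic identity, which asymptotic homomorphisms and
positive functionals respect without reference to an order. -/
theorem exists_star_mul_self_eq_sub {A : Type*} [CStarAlgebra A] (a : A) :
    ∃ b : A, ((‖a‖ ^ 2 : ℝ) : ℂ) • (1 : A) = star a * a + star b * b := by
  simp only [Complex.coe_smul]
  let _ := CStarAlgebra.spectralOrder A
  have := CStarAlgebra.spectralOrderedRing A
  have h := IsSelfAdjoint.le_algebraMap_norm_self (a := star a * a) (.star_mul_self a)
  rw [CStarRing.norm_star_mul_self, ← sq, Algebra.algebraMap_eq_smul_one] at h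
  obtain ⟨b, hb⟩ := CStarAlgebra.nonneg_iff_eq_star_mul_self.1 (sub_nonneg.2 h)
  exact ⟨b, by rw [← hb]; abel⟩

/-- A bump at the top of the spectrum of a positive element. -/
theorem exists_bump {A : Type*} [CStarAlgebra A] [Nontrivial A] (b : A) {r : ℝ}
    (hrb : r < ‖star b * b‖) :
    ∃ e : A, IsSelfAdjoint e ∧ e ≠ 0 ∧
      (star b * b) * (star e * e) = (star e * e) * (star e * e) + (r : ℂ) • (star e * e) := by
  simp only [Complex.coe_smul]
  let _ := CStarAlgebra.spectralOrder A
  have := CStarAlgebra.spectralOrderedRing A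
  set a := star b * b with ha
  have hsa : IsSelfAdjoint a := .star_mul_self b
  -- `g` is the square root of `f t = max (t - r) 0`, so `e = g(a)` has `e*e = f(a)`, and the
  -- required identity is `t * f t = f t * f t + r * f t`.
  let g : ℝ → ℝ := fun t => Real.sqrt (max (t - r) 0)
  have hg : Continuous g := by fun_prop
  let f : ℝ → ℝ := fun t => max (t - r) 0
  have hf : Continuous f := by fun_prop
  have hgg : ∀ t, g t * g t = f t := fun t => Real.mul_self_sqrt (le_max_right _ _)
  have hstar : IsSelfAdjoint (cfc g a) := cfc_predicate g a
  have he : star (cfc g a) * cfc g a = cfc f a := by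
    rw [hstar.star_eq, ← cfc_mul g g a hg.continuousOn hg.continuousOn]
    simp only [hgg]
  refine ⟨cfc g a, hstar, ?_, ?_⟩
  · intro h0
    have hn : ‖a‖ ∈ spectrum ℝ a := by
      exact CStarAlgebra.norm_mem_spectrum_of_nonneg (star_mul_self_nonneg b)
    have h1 := norm_apply_le_norm_cfc f a hn hf.continuousOn hsa
    rw [← he, h0] at h1
    simp only [mul_zero, norm_zero] at h1
    have h2 : f ‖a‖ = ‖a‖ - r := max_eq_left (by linarith)
    rw [h2, Real.norm_of_nonneg (by linarith)] at h1
    linarith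
  · rw [he]
    have h1 : cfc (fun t => t * f t) a = a * cfc f a := by
      rw [cfc_mul (fun t => t) f a continuousOn_id hf.continuousOn, cfc_id' ℝ a]
    have h2 : cfc (fun t => f t * f t + r * f t) a = cfc f a * cfc f a + r • cfc f a := by
      rw [cfc_add (a := a) (fun t => f t * f t) (fun t => r * f t) (by fun_prop) (by fun_prop),
        cfc_mul f f a hf.continuousOn hf.continuousOn, cfc_const_mul r f a hf.continuousOn]
    rw [← h1, ← h2]
    congr 1
    funext t
    rcases le_total (t - r) 0 with h | h
    · simp [f, max_eq_right h]
    · simp only [f, max_eq_left h]; ring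

end CStarEstimates

/-- Taking `2 ^ k`-th roots and letting `k → ∞` removes the constant. This turns bounds with a crude
constant into sharp ones. -/
theorem le_of_pow_two_pow_le {u r C : ℝ} (hr : 0 ≤ r)
    (h : ∀ k : ℕ, u ^ 2 ^ k ≤ C * r ^ 2 ^ k) : u ≤ r := by
  by_contra! hlt
  have hu : 0 < u := hr.trans_lt hlt
  rcases hr.eq_or_lt with rfl | hr
  · have := h 0
    simp at this
    linarith
  · have h1 : 1 < u / r := (one_lt_div hr).2 hlt
    obtain ⟨n, hn⟩ := pow_unbounded_of_one_lt C h1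
    have h2 := h n
    have h3 : (u / r) ^ n ≤ (u / r) ^ 2 ^ n := pow_le_pow_right₀ h1.le n.lt_two_pow_self.le
    have h4 : (u / r) ^ 2 ^ n ≤ C := by
      rw [div_pow, div_le_iff₀ (by positivity)]
      exact h2
    linarith

/-! ### Norm bounds for asymptotic homomorphisms -/

section Estimates

variable {I : Type*} {l : Filter I} {m : I → ℕ} {A : Type*} [CStarAlgebra A]
  {s : ∀ i, A →ₗ[ℂ] Mat (m i)}

theorem IsAsympHom.asymp_star_mul_self (h : IsAsympHom l s) (c : A) :
    AsympEq l (fun i => s i (star c * c)) (fun i => star (s i c) * s i c) :=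
  (h.asymp_mul _ _).trans ((h.asymp_star c).mul (.refl _) (h.bdd c).conj (h.bdd c))

/-- The classical argument survives asymptotically: `‖a‖² = a*a + b*b` passes to the matrices up to
a small error, and there it bounds the norm of the image of `a`. -/
theorem IsAsympHom.contractive (h : IsAsympHom l s) : Contractive l s := by
  intro a ε hε
  obtain ⟨b, hb⟩ := exists_star_mul_self_eq_sub a
  have h2 : AsympEq l (fun i => ((‖a‖ ^ 2 : ℝ) : ℂ) • (1 : Mat (m i)))
      (fun i => star (s i a) * s i a + star (s i b) * s i b) := by
    refine AsympEq.trans (c' := fun i => s i (((‖a‖ ^ 2 : ℝ) : ℂ) • (1 : A))) ?_ (AsympEq.trans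
      (.of_eq fun i => ?_) ((h.asymp_star_mul_self a).add (h.asymp_star_mul_self b)))
    · simpa only [map_smul] using h.asymp_one.symm.smul ((‖a‖ ^ 2 : ℝ) : ℂ)
    · rw [hb, map_add]
  -- An error `ε²` in the identity is harmless because `‖a‖² + ε² ≤ (‖a‖ + ε)²`.
  filter_upwards [h2.eventually_le (show 0 < ε ^ 2 by positivity)] with i hi
  have h3 := norm_sq_le_of_sum_squares (s i a) (s i b) (((‖a‖ ^ 2 : ℝ) : ℂ) • 1)
  have h4 : ‖((‖a‖ ^ 2 : ℝ) : ℂ) • (1 : Mat (m i))‖ ≤ ‖a‖ ^ 2 := by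
    rw [norm_smul, Complex.norm_real, Real.norm_of_nonneg (by positivity)]
    exact mul_le_of_le_one_right (by positivity) (norm_one_mat_le _)
  refine abs_le_of_sq_le_sq' ?_ (by positivity) |>.2
  nlinarith [norm_nonneg a]

/-- An asymptotically injective asymptotic *-homomorphism is norming. -/
theorem IsAsympHom.frequently_lt_norm [l.NeBot] [Nontrivial A] (h : IsAsympHom l s)
    (hinj : ∀ a, Tendsto (fun i => ‖s i a‖) l (𝓝 0) → a = 0) (a : A) {ρ : ℝ}
    (hρ : ρ < ‖a‖) : ∃ᶠ i in l, ρ < ‖s i a‖ := by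
  rcases lt_or_ge ρ 0 with h0 | h0
  · exact Frequently.of_forall fun i => h0.trans_le (norm_nonneg _)
  intro hev
  simp only [not_lt] at hev
  obtain ⟨r, hr1, hr2⟩ := exists_between (show ρ ^ 2 < ‖a‖ ^ 2 by gcongr)
  have hr0 : 0 ≤ r := (sq_nonneg ρ).trans hr1.le
  rw [sq ‖a‖, ← CStarRing.norm_star_mul_self] at hr2
  -- If the images of `a` eventually have norm at most `ρ`, the identity for `e` forces its image to
  -- `0`: the left side has norm at most `ρ² ‖s i e‖²`, the right side at least `r ‖s i e‖²`, and `r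
  -- > ρ²`. Asymptotic injectivity then contradicts `e ≠ 0`.
  obtain ⟨e, -, he0, he⟩ := exists_bump a hr2
  have hc := h.asymp_star_mul_self e
  have h1 : AsympEq l (fun i => star (s i a) * s i a * (star (s i e) * s i e))
      (fun i => star (s i e) * s i e * (star (s i e) * s i e) +
        (r : ℂ) • (star (s i e) * s i e)) := by
    have hb : ∀ c, EvBdd l (fun i => star (s i c) * s i c) := fun c =>
      (h.bdd c).conj.mul (h.bdd c)
    refine AsympEq.trans ((h.asymp_star_mul_self a).symm.mul hc.symm (h.bdd _) (hb e)) ?_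
    refine (h.asymp_mul _ _).symm.trans ?_
    simp only [he, map_add, map_smul]
    exact ((h.asymp_mul _ _).trans (hc.mul hc (hb e) (h.bdd _))).add (hc.smul r)
  refine he0 (hinj e ?_)
  have h2 : ∀ᶠ i in l, ‖s i e‖ ^ 2 ≤ (r - ρ ^ 2)⁻¹ *
      ‖star (s i a) * s i a * (star (s i e) * s i e) - (star (s i e) * s i e *
        (star (s i e) * s i e) + (r : ℂ) • (star (s i e) * s i e))‖ := by
    filter_upwards [hev] with i hi
    rw [le_inv_mul_iff₀ (by linarith)]
    have h3 := mul_norm_le_norm_sq_add (s i e) hr0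
    have h4 : ‖star (s i a) * s i a * (star (s i e) * s i e)‖ ≤ ρ ^ 2 * ‖s i e‖ ^ 2 := by
      refine (norm_mul_le _ _).trans ?_
      rw [CStarRing.norm_star_mul_self, CStarRing.norm_star_mul_self, ← sq, ← sq]
      gcongr
    rw [CStarRing.norm_star_mul_self, ← sq] at h3
    have h5 := norm_sub_norm_le (star (s i e) * s i e *
        (star (s i e) * s i e) + (r : ℂ) • (star (s i e) * s i e))
        (star (s i a) * s i a * (star (s i e) * s i e))
    rw [norm_sub_rev] at h5
    linarith
  have h6 : Tendsto (fun i => ‖s i e‖ ^ 2) l (𝓝 0) :=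
    squeeze_zero' (Eventually.of_forall fun _ => by positivity) h2
      (by simpa using Tendsto.const_mul (r - ρ ^ 2)⁻¹ h1)
  have h7 := h6.sqrt
  simpa using h7

end Estimates

/-! ### Lifting homomorphisms into the quotient to sequences -/

section Lift

variable {m : ℕ → ℕ} {l : Filter ℕ}

theorem MatQuot.mk_eq_mk {a b : boundedProd m} :
    MatQuot.mk m l a = MatQuot.mk m l b ↔ AsympEq l a.1 b.1 :=
  (nullCon m l).eq

/-- The quotient map as a linear map. -/
noncomputable def MatQuot.mkₗ (m : ℕ → ℕ) (l : Filter ℕ) : boundedProd m →ₗ[ℂ] MatQuot m l where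
  toFun := MatQuot.mk m l
  map_add' _ _ := rfl
  map_smul' _ _ := rfl

/-- A linear right inverse of the quotient map exists by linear algebra alone. It need not be
continuous: contractivity is recovered from `IsAsympHom.contractive`. -/
theorem MatQuot.exists_linear_lift {A : Type*} [AddCommGroup A] [Module ℂ A]
    (Φ : A →ₗ[ℂ] MatQuot m l) :
    ∃ σ : A →ₗ[ℂ] boundedProd m, ∀ a, MatQuot.mk m l (σ a) = Φ a := by
  have hs : Function.Surjective (MatQuot.mkₗ m l) := by
    rintro ⟨a⟩
    exact ⟨a, rfl⟩
  obtain ⟨g, hg⟩ := (MatQuot.mkₗ m l).exists_rightInverse_of_surjective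
    (LinearMap.range_eq_top.2 hs)
  exact ⟨g ∘ₗ Φ, fun a => LinearMap.congr_fun hg (Φ a)⟩

/-- The `k`-th entry of a bounded sequence. -/
def boundedProd.entry (m : ℕ → ℕ) (k : ℕ) : boundedProd m →ₗ[ℂ] Mat (m k) where
  toFun a := a.1 k
  map_add' _ _ := rfl
  map_smul' _ _ := rfl

theorem exists_asymp_of_hom {A : Type*} [Ring A] [StarRing A] [Algebra ℂ A]
    (Φ : A →⋆ₙₐ[ℂ] MatQuot m l) :
    ∃ σ : A →ₗ[ℂ] boundedProd m, (∀ a, MatQuot.mk m l (σ a) = Φ a) ∧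
      (∀ a b, AsympEq l (σ (a * b)).1 (fun k => (σ a).1 k * (σ b).1 k)) ∧
      (∀ a, AsympEq l (σ (star a)).1 (fun k => star ((σ a).1 k))) := by
  obtain ⟨σ, hσ⟩ := MatQuot.exists_linear_lift (Φ : A →ₗ[ℂ] MatQuot m l)
  have hσ : ∀ a, MatQuot.mk m l (σ a) = Φ a := hσ
  refine ⟨σ, hσ, fun a b => ?_, fun a => ?_⟩
  · refine MatQuot.mk_eq_mk (b := σ a * σ b) |>.1 ?_
    rw [hσ, map_mul, ← hσ, ← hσ]
    rfl
  · refine MatQuot.mk_eq_mk (b := star (σ a)) |>.1 ?_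
    rw [hσ, map_star, ← hσ]
    rfl

theorem exists_isAsympHom_of_hom {A : Type*} [Ring A] [StarRing A] [Algebra ℂ A]
    (Φ : A →⋆ₐ[ℂ] MatQuot m l) :
    ∃ σ : A →ₗ[ℂ] boundedProd m, (∀ a, MatQuot.mk m l (σ a) = Φ a) ∧
      IsAsympHom l (fun k => boundedProd.entry m k ∘ₗ σ) := by
  obtain ⟨σ, hσ, h1, h2⟩ := exists_asymp_of_hom (Φ : A →⋆ₙₐ[ℂ] MatQuot m l)
  refine ⟨σ, hσ, ?_, h1, h2, fun a => ?_⟩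
  · refine MatQuot.mk_eq_mk (a := σ 1) (b := 1) |>.1 ?_
    rw [hσ]
    exact map_one Φ
  · obtain ⟨C, hC⟩ := (σ a).2
    exact ⟨C, Eventually.of_forall hC⟩

end Lift

/-! ### Cutting down to unital asymptotic homomorphisms -/

section Compression

/-- An isometry onto the range of the spectral projection of a Hermitian matrix near `1`. -/
theorem exists_isometry_near {k : ℕ} {Q : Mat k} (hQ : Q.IsHermitian) :
    ∃ (r : ℕ) (V : Matrix (Fin k) (Fin r) ℂ), V.conjTranspose * V = 1 ∧
      ‖V * V.conjTranspose - Q‖ ≤ 2 * ‖Q * Q - Q‖ := by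
  classical
  -- The columns of `V` are the eigenvectors with eigenvalue at least `1/2`; there may be none, and
  -- then `r = 0`.
  let J := {j : Fin k // 1 / 2 ≤ hQ.eigenvalues j}
  let e : Fin (Fintype.card J) ≃ J := (Fintype.equivFin J).symm
  let U : Mat k := (hQ.eigenvectorUnitary : Mat k)
  have hUU : star U * U = 1 := Unitary.coe_star_mul_self hQ.eigenvectorUnitary
  let V : Matrix (Fin k) (Fin (Fintype.card J)) ℂ := U.submatrix id (fun i => (e i).1)
  have conj_norm : ∀ X : Mat k, ‖U * X * star U‖ = ‖X‖ := fun X => by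
    have h1 := CStarRing.norm_coe_unitary_mul hQ.eigenvectorUnitary (X * star U)
    have h2 := CStarRing.norm_mul_coe_unitary X (star hQ.eigenvectorUnitary)
    rw [mul_assoc]
    exact h1.trans h2
  let d : Fin k → ℂ := fun j => if 1 / 2 ≤ hQ.eigenvalues j then 1 else 0
  have hV : V * V.conjTranspose = U * Matrix.diagonal d * star U := by
    ext a b
    rw [Matrix.mul_apply, Matrix.mul_apply]
    simp only [Matrix.mul_diagonal]
    have : ∀ j : Fin k, U a j * d j * star U j b
        = if 1 / 2 ≤ hQ.eigenvalues j then U a j * star U j b else 0 := by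
      intro j; simp only [d]; split_ifs <;> simp
    simp only [this]
    rw [← Finset.sum_filter, Finset.sum_subtype (p := fun j => 1 / 2 ≤ hQ.eigenvalues j)
      (Finset.univ.filter fun j => 1 / 2 ≤ hQ.eigenvalues j) (by simp)]
    exact Equiv.sum_comp e (fun j : J => U a j.1 * star U j.1 b)
  have hS : Q = U * Matrix.diagonal (fun j => (hQ.eigenvalues j : ℂ)) * star U := by
    have := hQ.spectral_theorem
    rw [Unitary.conjStarAlgAut_apply] at this
    exact this
  refine ⟨_, V, ?_, ?_⟩
  · ext a b
    have h1 : (V.conjTranspose * V) a b = (star U * U) (e a).1 (e b).1 := rfl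
    rw [h1, hUU, Matrix.one_apply, Matrix.one_apply]
    congr 1
    simp [Subtype.val_inj]
  · have e1 : V * V.conjTranspose - Q
        = U * Matrix.diagonal (fun j => d j - (hQ.eigenvalues j : ℂ)) * star U := by
      rw [hV]
      conv_lhs => rw [hS]
      rw [← sub_mul, ← mul_sub, Matrix.diagonal_sub]
    have e2 : Q * Q - Q = U * Matrix.diagonal
        (fun j => (hQ.eigenvalues j : ℂ) * hQ.eigenvalues j - hQ.eigenvalues j) * star U := by
      conv_lhs => rw [hS]
      have : ∀ X Y : Mat k, U * X * star U * (U * Y * star U) = U * (X * Y) * star U := by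
        intro X Y
        calc _ = U * X * (star U * U) * Y * star U := by simp only [mul_assoc]
          _ = _ := by rw [hUU]; simp only [mul_assoc, one_mul]
      rw [this, ← sub_mul, ← mul_sub, Matrix.diagonal_mul_diagonal, Matrix.diagonal_sub]
    rw [e1, e2, conj_norm, conj_norm, Matrix.l2_opNorm_diagonal, Matrix.l2_opNorm_diagonal]
    refine (pi_norm_le_iff_of_nonneg (by positivity)).2 fun j => ?_
    refine le_trans ?_ (mul_le_mul_of_nonneg_left (norm_le_pi_norm _ j) (by norm_num))
    set t := hQ.eigenvalues j with ht
    have e3 : ((t : ℂ) * t - t) = ((t * t - t : ℝ) : ℂ) := by push_cast; ring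
    rw [e3, Complex.norm_real, Real.norm_eq_abs]
    simp only [d, ← ht]
    -- The factor 2 comes from `|1 - t| ≤ 2 |t (1 - t)|` for `t ≥ 1/2` and `|t| ≤ 2 |t (1 - t)|` for
    -- `t < 1/2`.
    split_ifs with hc
    · have : (1 - (t : ℂ)) = ((1 - t : ℝ) : ℂ) := by push_cast; ring
      rw [this, Complex.norm_real, Real.norm_eq_abs]
      have : t * t - t = - (t * (1 - t)) := by ring
      rw [this, abs_neg, abs_mul, abs_of_nonneg (by linarith : 0 ≤ t)]
      nlinarith [abs_nonneg (1 - t)]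
    · rw [zero_sub, norm_neg, Complex.norm_real, Real.norm_eq_abs]
      have : t * t - t = - (t * (1 - t)) := by ring
      rw [this, abs_neg, abs_mul, abs_of_nonneg (by linarith : 0 ≤ 1 - t)]
      nlinarith [abs_nonneg t]

end Compression

section Compression

/-- The compression `X ↦ Vᴴ X V`. -/
def compress {k r : ℕ} (V : Matrix (Fin k) (Fin r) ℂ) : Mat k →ₗ[ℂ] Mat r where
  toFun X := V.conjTranspose * X * V
  map_add' X Y := by rw [Matrix.mul_add, Matrix.add_mul]
  map_smul' c X := by simp

theorem norm_isometry_le {k r : ℕ} {V : Matrix (Fin k) (Fin r) ℂ}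
    (hV : V.conjTranspose * V = 1) : ‖V‖ ≤ 1 := by
  have h := Matrix.l2_opNorm_conjTranspose_mul_self V
  rw [hV] at h
  have h1 := norm_one_mat_le r
  nlinarith [norm_nonneg V]

theorem norm_compress_le {k r : ℕ} {V : Matrix (Fin k) (Fin r) ℂ}
    (hV : V.conjTranspose * V = 1) (X : Mat k) : ‖compress V X‖ ≤ ‖X‖ := by
  have hn := norm_isometry_le hV
  have h1 := Matrix.l2_opNorm_mul (V.conjTranspose * X) V
  have h2 := Matrix.l2_opNorm_mul V.conjTranspose X
  rw [Matrix.l2_opNorm_conjTranspose] at h2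
  calc ‖compress V X‖ ≤ ‖V.conjTranspose * X‖ * ‖V‖ := h1
    _ ≤ (‖V‖ * ‖X‖) * ‖V‖ := by gcongr
    _ ≤ (1 * ‖X‖) * 1 := by gcongr
    _ = ‖X‖ := by ring

theorem norm_expand_le {k r : ℕ} {V : Matrix (Fin k) (Fin r) ℂ}
    (hV : V.conjTranspose * V = 1) (X : Mat r) : ‖V * X * V.conjTranspose‖ ≤ ‖X‖ := by
  have hn := norm_isometry_le hV
  have h1 := Matrix.l2_opNorm_mul (V * X) V.conjTranspose
  have h2 := Matrix.l2_opNorm_mul V X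
  rw [Matrix.l2_opNorm_conjTranspose] at h1
  calc ‖V * X * V.conjTranspose‖ ≤ ‖V * X‖ * ‖V‖ := h1
    _ ≤ (‖V‖ * ‖X‖) * ‖V‖ := by gcongr
    _ ≤ (1 * ‖X‖) * 1 := by gcongr
    _ = ‖X‖ := by ring

variable {I : Type*} {l : Filter I} {m r : I → ℕ}

theorem AsympEq.compress {V : ∀ i, Matrix (Fin (m i)) (Fin (r i)) ℂ}
    (hV : ∀ i, (V i).conjTranspose * V i = 1) {c d : ∀ i, Mat (m i)} (h : AsympEq l c d) :
    AsympEq l (fun i => MFAlg.compress (V i) (c i)) (fun i => MFAlg.compress (V i) (d i)) :=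
  .of_le h fun i => by rw [← map_sub]; exact norm_compress_le (hV i) _

/-- A not necessarily unital asymptotic *-homomorphism can be cut down to a unital one. -/
theorem exists_unital_compression {A : Type*} [Ring A] [StarRing A] [Algebra ℂ A]
    {s : ∀ i, A →ₗ[ℂ] Mat (m i)}
    (hmul : ∀ a b, AsympEq l (fun i => s i (a * b)) (fun i => s i a * s i b))
    (hstar : ∀ a, AsympEq l (fun i => s i (star a)) (fun i => star (s i a)))
    (hbdd : ∀ a, EvBdd l (fun i => s i a)) :
    ∃ (r : I → ℕ) (s' : ∀ i, A →ₗ[ℂ] Mat (r i)), IsAsympHom l s' ∧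
      ∀ a, Tendsto (fun i => ‖s' i a‖) l (𝓝 0) → Tendsto (fun i => ‖s i a‖) l (𝓝 0) := by
  -- The image of the unit is only asymptotically self-adjoint; `star (s i 1) * s i 1` is exactly
  -- Hermitian and asymptotically equal to it.
  have hQ : ∀ i, (star (s i 1) * s i 1).IsHermitian := fun i =>
    Matrix.isHermitian_conjTranspose_mul_self _
  choose r V hV hVQ using fun i => exists_isometry_near (hQ i)
  have hQP : AsympEq l (fun i => star (s i 1) * s i 1) (fun i => s i 1) := by
    have h1 := ((hstar 1).mul (.refl _) (hbdd 1).conj (hbdd 1)).symm.trans (hmul (star 1) 1).symm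
    simpa using h1
  have hPP : AsympEq l (fun i => s i 1 * s i 1) (fun i => s i 1) := by
    simpa using (hmul 1 1).symm
  have hQbd := hQP.evBdd (hbdd 1)
  have hE : AsympEq l (fun i => V i * (V i).conjTranspose) (fun i => s i 1) := by
    refine AsympEq.trans ?_ hQP
    have h1 : AsympEq l (fun i => star (s i 1) * s i 1 * (star (s i 1) * s i 1))
        (fun i => star (s i 1) * s i 1) :=
      ((hQP.mul hQP (hbdd 1) hQbd).trans hPP).trans hQP.symm
    exact .of_le (by simpa using Tendsto.const_mul 2 h1) hVQ
  have hEb := hE.evBdd (hbdd 1)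
  refine ⟨r, fun i => compress (V i) ∘ₗ s i, ⟨?_, fun a b => ?_, fun a => ?_, fun a => ?_⟩,
    fun a ha => ?_⟩
  · refine (AsympEq.compress hV hE.symm).trans (.of_eq fun i => ?_)
    change (V i).conjTranspose * (V i * (V i).conjTranspose) * V i = 1
    rw [← Matrix.mul_assoc, hV, Matrix.one_mul, hV]
  -- Since `V Vᴴ` is asymptotically the image of the unit, it may be inserted between the two
  -- factors, which makes the compression multiplicative.
  · have h1 : AsympEq l (fun i => s i (a * b))
        (fun i => s i a * (V i * (V i).conjTranspose) * s i b) := by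
      refine (hmul a b).trans (.mul ?_ (.refl _) ((hbdd a).mul hEb) (hbdd b))
      have h2 := (hmul a 1).trans (AsympEq.mul (.refl _) hE.symm (hbdd a) (hbdd 1))
      simpa using h2
    refine (AsympEq.compress hV h1).trans (.of_eq fun i => ?_)
    simp [compress, Matrix.mul_assoc]
  · refine (AsympEq.compress hV (hstar a)).trans (.of_eq fun i => ?_)
    simp [compress, Matrix.mul_assoc, Matrix.star_eq_conjTranspose]
  · obtain ⟨C, hC⟩ := hbdd a
    exact ⟨C, hC.mono fun i hi => (norm_compress_le (hV i) _).trans hi⟩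
  -- From `a = 1 * a * 1`, the image of `a` is asymptotically `V (Vᴴ s(a) V) Vᴴ`, so the compression
  -- loses no norm in the limit.
  · have h1 : AsympEq l (fun i => s i a)
        (fun i => V i * (V i).conjTranspose * s i a * (V i * (V i).conjTranspose)) := by
      have h2 := (hmul (1 * a) 1).trans (((hmul 1 a).trans
        (hE.symm.mul (.refl _) hEb (hbdd a))).mul hE.symm (hEb.mul (hbdd a)) (hbdd 1))
      simpa using h2
    refine h1.tendsto_norm (squeeze_zero (fun _ => norm_nonneg _) (fun i => ?_) ha)
    have h3 := norm_expand_le (hV i) (compress (V i) (s i a))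
    simpa [compress, Matrix.mul_assoc] using h3

/-- An MF-algebra has an asymptotically norming unital asymptotic *-homomorphism. -/
theorem IsMF.exists_isAsympHom {A : Type*} [CStarAlgebra A] [Nontrivial A] (hA : IsMF A) :
    ∃ (r : ℕ → ℕ) (s : ∀ i, A →ₗ[ℂ] Mat (r i)), IsAsympHom atTop s ∧
      ∀ (a : A) (ρ : ℝ), ρ < ‖a‖ → ∃ᶠ i in atTop, ρ < ‖s i a‖ := by
  obtain ⟨m, -, -, Φ, hΦ⟩ := hA
  obtain ⟨σ, hσ, h1, h2⟩ := exists_asymp_of_hom Φ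
  obtain ⟨r, s, hs, hs'⟩ := exists_unital_compression (l := atTop)
    (s := fun k => boundedProd.entry m k ∘ₗ σ) h1 h2
    (fun a => (σ a).2.imp fun C hC => Eventually.of_forall hC)
  -- The lower bound holds only frequently: injectivity controls the limit superior of the norms,
  -- not the limit inferior.
  refine ⟨r, s, hs, fun a ρ hρ => hs.frequently_lt_norm (fun a ha => hΦ ?_) a hρ⟩
  rw [← hσ, map_zero]
  refine MatQuot.mk_eq_mk (b := 0) |>.2 ?_
  have := hs' a ha
  simpa [AsympEq] using! this

end Compression

open scoped Kronecker

/-! ### Direct sums and tensor products of matrix algebras -/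

section DirectSum

/-- Reindexing of square matrices as a *-isomorphism. -/
def reindexStar {m n : Type*} [Fintype m] [Fintype n] [DecidableEq m] [DecidableEq n] (e : m ≃ n) :
    Matrix m m ℂ ≃⋆ₐ[ℂ] Matrix n n ℂ :=
  StarAlgEquiv.ofAlgEquiv (Matrix.reindexAlgEquiv ℂ ℂ e) fun A => by ext i j; rfl

theorem trace_reindexStar {m n : Type*} [Fintype m] [Fintype n] [DecidableEq m] [DecidableEq n]
    (e : m ≃ n) (A : Matrix m m ℂ) : (reindexStar e A).trace = A.trace :=
  Equiv.sum_comp e.symm fun i => A i i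

/-- The Kronecker product of matrices as a *-homomorphism in the first factor. -/
def kronLeft (m n : ℕ) : Mat m →⋆ₐ[ℂ] Mat (m * n) :=
  ((reindexStar finProdFinEquiv : Matrix (Fin m × Fin n) (Fin m × Fin n) ℂ ≃⋆ₐ[ℂ] Mat (m * n)) :
      Matrix (Fin m × Fin n) (Fin m × Fin n) ℂ →⋆ₐ[ℂ] Mat (m * n)).comp
    { toFun := fun A => A ⊗ₖ (1 : Mat n)
      map_one' := Matrix.one_kronecker_one
      map_mul' := fun A B => by
        have := Matrix.mul_kronecker_mul A B (1 : Mat n) (1 : Mat n)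
        rwa [one_mul] at this
      map_zero' := Matrix.zero_kronecker _
      map_add' := fun A B => Matrix.add_kronecker _ _ _
      commutes' := fun r => by
        rw [Algebra.algebraMap_eq_smul_one, Matrix.smul_kronecker, Matrix.one_kronecker_one,
          Algebra.algebraMap_eq_smul_one]
      map_star' := fun A => by
        simp [Matrix.star_eq_conjTranspose, Matrix.conjTranspose_kronecker] }

/-- The Kronecker product of matrices as a *-homomorphism in the second factor. -/
def kronRight (m n : ℕ) : Mat n →⋆ₐ[ℂ] Mat (m * n) :=
  ((reindexStar finProdFinEquiv : Matrix (Fin m × Fin n) (Fin m × Fin n) ℂ ≃⋆ₐ[ℂ] Mat (m * n)) :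
      Matrix (Fin m × Fin n) (Fin m × Fin n) ℂ →⋆ₐ[ℂ] Mat (m * n)).comp
    { toFun := fun A => (1 : Mat m) ⊗ₖ A
      map_one' := Matrix.one_kronecker_one
      map_mul' := fun A B => by
        have := Matrix.mul_kronecker_mul (1 : Mat m) (1 : Mat m) A B
        rwa [one_mul] at this
      map_zero' := Matrix.kronecker_zero _
      map_add' := fun A B => Matrix.kronecker_add _ _ _
      commutes' := fun r => by
        rw [Algebra.algebraMap_eq_smul_one, Matrix.kronecker_smul, Matrix.one_kronecker_one,
          Algebra.algebraMap_eq_smul_one]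
      map_star' := fun A => by
        simp [Matrix.star_eq_conjTranspose, Matrix.conjTranspose_kronecker] }

theorem kron_mul_eq (m n : ℕ) (A : Mat m) (B : Mat n) :
    kronLeft m n A * kronRight m n B = reindexStar finProdFinEquiv (A ⊗ₖ B) := by
  change reindexStar finProdFinEquiv (A ⊗ₖ (1 : Mat n)) *
    reindexStar finProdFinEquiv ((1 : Mat m) ⊗ₖ B) = _
  rw [← map_mul]
  congr 1
  have := Matrix.mul_kronecker_mul A (1 : Mat m) (1 : Mat n) B
  rw [mul_one, one_mul] at this
  exact this.symm

theorem kron_commute (m n : ℕ) (A : Mat m) (B : Mat n) :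
    kronLeft m n A * kronRight m n B = kronRight m n B * kronLeft m n A := by
  rw [kron_mul_eq]
  change _ = reindexStar finProdFinEquiv ((1 : Mat m) ⊗ₖ B) *
    reindexStar finProdFinEquiv (A ⊗ₖ (1 : Mat n))
  rw [← map_mul]
  congr 1
  have := Matrix.mul_kronecker_mul (1 : Mat m) A B (1 : Mat n)
  rw [mul_one, one_mul] at this
  exact this

theorem normTrace_kron (m n : ℕ) (A : Mat m) (B : Mat n) :
    normTrace (m * n) (kronLeft m n A * kronRight m n B) = normTrace m A * normTrace n B := by
  rw [kron_mul_eq]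
  simp only [normTrace]
  rw [trace_reindexStar, Matrix.trace_kronecker]
  push_cast
  rw [mul_inv]
  ring

theorem norm_kron_le (m n : ℕ) (A : Mat m) (B : Mat n) :
    ‖kronLeft m n A * kronRight m n B‖ ≤ ‖A‖ * ‖B‖ :=
  (norm_mul_le _ _).trans (mul_le_mul (NonUnitalStarAlgHom.norm_apply_le _ _)
    (NonUnitalStarAlgHom.norm_apply_le _ _) (norm_nonneg _) (norm_nonneg _))

theorem normTrace_kronLeft {m n : ℕ} (hn : 0 < n) (A : Mat m) :
    normTrace (m * n) (kronLeft m n A) = normTrace m A := by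
  have := normTrace_kron m n A 1
  rwa [map_one, mul_one, normTrace_one hn, mul_one] at this

theorem norm_kronLeft {m n : ℕ} (hn : 0 < n) (A : Mat m) : ‖kronLeft m n A‖ = ‖A‖ := by
  refine NonUnitalStarAlgHom.norm_map (kronLeft m n) ((injective_iff_map_eq_zero _).2 ?_) A
  intro B hB
  have h1 : (B ⊗ₖ (1 : Mat n)) = 0 := by
    have : reindexStar finProdFinEquiv (B ⊗ₖ (1 : Mat n)) = 0 := hB
    simpa using this
  ext i j
  have h2 := congrFun (congrFun h1 (i, ⟨0, hn⟩)) (j, ⟨0, hn⟩)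
  simpa [Matrix.kroneckerMap_apply] using h2

/-- The direct sum of matrices. -/
def directSum (m n : ℕ) : Mat m × Mat n →⋆ₐ[ℂ] Mat (m + n) :=
  ((reindexStar finSumFinEquiv : Matrix (Fin m ⊕ Fin n) (Fin m ⊕ Fin n) ℂ ≃⋆ₐ[ℂ] Mat (m + n)) :
      Matrix (Fin m ⊕ Fin n) (Fin m ⊕ Fin n) ℂ →⋆ₐ[ℂ] Mat (m + n)).comp
    { toFun := fun A => Matrix.fromBlocks A.1 0 0 A.2
      map_one' := Matrix.fromBlocks_one
      map_mul' := fun A B => by simp [Matrix.fromBlocks_multiply]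
      map_zero' := Matrix.fromBlocks_zero
      map_add' := fun A B => by simp [Matrix.fromBlocks_add]
      commutes' := fun r => by
        simp [Algebra.algebraMap_eq_smul_one, ← Matrix.fromBlocks_one, Matrix.fromBlocks_smul]
      map_star' := fun A => by
        simp [Matrix.star_eq_conjTranspose, Matrix.fromBlocks_conjTranspose] }

theorem norm_directSum (m n : ℕ) (A : Mat m × Mat n) : ‖directSum m n A‖ = ‖A‖ := by
  refine NonUnitalStarAlgHom.norm_map (directSum m n) ((injective_iff_map_eq_zero _).2 ?_) A
  intro B hB
  have h1 : Matrix.fromBlocks B.1 0 0 B.2 = 0 := by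
    have : reindexStar finSumFinEquiv (Matrix.fromBlocks B.1 0 0 B.2) = 0 := hB
    simpa using this
  rw [← Matrix.fromBlocks_zero, Matrix.fromBlocks_inj] at h1
  exact Prod.ext h1.1 h1.2.2.2

theorem normTrace_directSum (m n : ℕ) (A : Mat m × Mat n) :
    ((m : ℂ) + n) * normTrace (m + n) (directSum m n A) =
      m * normTrace m A.1 + n * normTrace n A.2 := by
  have h : (directSum m n A).trace = A.1.trace + A.2.trace := by
    change (reindexStar finSumFinEquiv (Matrix.fromBlocks A.1 0 0 A.2)).trace = _
    rw [trace_reindexStar]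
    simp [Matrix.trace]
  have key : ∀ (k : ℕ) (X : Mat k), (k : ℂ) * normTrace k X = X.trace := by
    intro k X
    rcases Nat.eq_zero_or_pos k with rfl | hk
    · simp
    · rw [normTrace, mul_inv_cancel_left₀ (by exact_mod_cast hk.ne')]
  rw [key, key, ← h, ← key (m + n)]
  push_cast
  rfl

theorem starEval_prod {A B : Type*} [Semiring A] [Algebra ℂ A] [Star A] [Semiring B] [Algebra ℂ B]
    [Star B] {ι : Type*} (x : ι → A) (y : ι → B) (p : FreeAlgebra ℂ (ι ⊕ ι)) :
    starEval (fun i => (x i, y i)) p = (starEval x p, starEval y p) := by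
  induction p using FreeAlgebra.induction with
  | grade0 r => simp [Algebra.algebraMap_eq_smul_one, Prod.ext_iff]
  | grade1 j => rcases j with j | j <;> simp [Prod.ext_iff]
  | mul p q hp hq => simp [hp, hq]
  | add p q hp hq => simp [hp, hq]

end DirectSum

/-! ### From tuples of matrices to asymptotic homomorphisms -/

section Extension

variable {I : Type*} {l : Filter I} {m : I → ℕ} {A : Type u} [NormedRing A] [StarRing A]
  [CStarRing A] [NormedAlgebra ℂ A] [StarModule ℂ A] {ι : Type*}

/-- The pairs `(a, c)` which are simultaneously approximated by values of *-polynomials at the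
tuples `x` and `T`. -/
def approxPairs (l : Filter I) (x : ι → A) (T : ∀ i, ι → Mat (m i)) :
    Submodule ℂ (A × ∀ i, Mat (m i)) where
  carrier := {z | ∀ ε : ℝ, 0 < ε → ∃ p, ‖z.1 - starEval x p‖ ≤ ε ∧
    ∀ᶠ i in l, ‖z.2 i - starEval (T i) p‖ ≤ ε}
  zero_mem' ε hε := ⟨0, by simpa using hε.le, by simpa using Eventually.of_forall fun _ => hε.le⟩
  add_mem' := by
    intro z w hz hw ε hε
    obtain ⟨p, hp, hp'⟩ := hz (ε / 2) (by positivity)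
    obtain ⟨q, hq, hq'⟩ := hw (ε / 2) (by positivity)
    refine ⟨p + q, ?_, ?_⟩
    · rw [starEval_add, Prod.fst_add, add_sub_add_comm]
      exact (norm_add_le _ _).trans (by linarith)
    · filter_upwards [hp', hq'] with i h1 h2
      rw [starEval_add, Prod.snd_add, Pi.add_apply, add_sub_add_comm]
      exact (norm_add_le _ _).trans (by linarith)
  smul_mem' := by
    intro r z hz ε hε
    obtain ⟨p, hp, hp'⟩ := hz (ε / (‖r‖ + 1)) (by positivity)
    have key : ‖r‖ * (ε / (‖r‖ + 1)) ≤ ε := by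
      rw [mul_div_assoc', div_le_iff₀ (by positivity)]
      nlinarith [norm_nonneg r]
    refine ⟨r • p, ?_, ?_⟩
    · rw [starEval_smul, Prod.smul_fst, ← smul_sub, norm_smul]
      exact (mul_le_mul_of_nonneg_left hp (norm_nonneg _)).trans key
    · filter_upwards [hp'] with i h1
      rw [starEval_smul, Prod.smul_snd, Pi.smul_apply, ← smul_sub, norm_smul]
      exact (mul_le_mul_of_nonneg_left h1 (norm_nonneg _)).trans key

variable {x : ι → A} {T : ∀ i, ι → Mat (m i)}

/-- Comparing `p` with a polynomial `q` that approximates the pair, `hT` applied to `q - p` carries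
the distance in `A` over to the matrices. With `p = 0` this bounds `c`; applied to differences it
shows that `a` determines `c` up to asymptotic equality. -/
theorem approxPairs_eventually_le (hT : ∀ p, ∀ ε : ℝ, 0 < ε →
      ∀ᶠ i in l, ‖starEval (T i) p‖ ≤ ‖starEval x p‖ + ε)
    {a : A} {c : ∀ i, Mat (m i)} (h : (a, c) ∈ approxPairs l x T) (p) {ε : ℝ}
    (hε : 0 < ε) : ∀ᶠ i in l, ‖c i - starEval (T i) p‖ ≤ ‖a - starEval x p‖ + ε := by
  obtain ⟨q, hq, hq'⟩ := h (ε / 4) (by positivity)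
  filter_upwards [hq', hT (q - p) (ε / 4) (by positivity)] with i h1 h2
  simp only [starEval_sub] at h2
  have h3 := norm_sub_le_norm_sub_add_norm_sub (c i) (starEval (T i) q) (starEval (T i) p)
  have h4 := norm_sub_le_norm_sub_add_norm_sub (starEval x q) a (starEval x p)
  rw [norm_sub_rev (starEval x q) a] at h4
  simp only at hq
  linarith

theorem norm_mul_sub_mul_le {M : Type*} [NormedRing M] {a b p q : M} {δ α β : ℝ} (hδ : 0 ≤ δ)
    (hδ1 : δ ≤ 1) (ha : ‖a‖ ≤ α) (hb : ‖b‖ ≤ β) (hp : ‖a - p‖ ≤ δ) (hq : ‖b - q‖ ≤ δ) :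
    ‖a * b - p * q‖ ≤ δ * (α + β + 1) := by
  have e : a * b - p * q = (a - p) * b + p * (b - q) := by noncomm_ring
  have hpn : ‖p‖ ≤ α + 1 := by
    have := norm_sub_le a (a - p)
    rw [sub_sub_cancel] at this
    linarith
  rw [e]
  calc _ ≤ ‖a - p‖ * ‖b‖ + ‖p‖ * ‖b - q‖ :=
        (norm_add_le _ _).trans (add_le_add (norm_mul_le _ _) (norm_mul_le _ _))
    _ ≤ δ * β + (α + 1) * δ := by
        gcongr
        linarith [norm_nonneg p]
    _ = _ := by ring

theorem approxPairs_mul_mem (hT : ∀ p, ∀ ε : ℝ, 0 < ε →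
      ∀ᶠ i in l, ‖starEval (T i) p‖ ≤ ‖starEval x p‖ + ε)
    {a b : A} {c d : ∀ i, Mat (m i)} (h : (a, c) ∈ approxPairs l x T)
    (h' : (b, d) ∈ approxPairs l x T) :
    (a * b, fun i => c i * d i) ∈ approxPairs l x T := by
  intro ε hε
  -- The 3 is made of the extra 1 in each of the eventual bounds `‖a‖ + 1`, `‖b‖ + 1` on the
  -- matrices, and the 1 in `norm_mul_sub_mul_le`.
  obtain ⟨δ, hδ0, hδ1, hδ⟩ : ∃ δ : ℝ, 0 < δ ∧ δ ≤ 1 ∧ δ * (‖a‖ + ‖b‖ + 3) ≤ ε := by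
    refine ⟨min 1 (ε / (‖a‖ + ‖b‖ + 3)), by positivity, min_le_left _ _, ?_⟩
    rw [← le_div_iff₀ (by positivity)]
    exact min_le_right _ _
  obtain ⟨p, hp, hp'⟩ := h δ hδ0
  obtain ⟨q, hq, hq'⟩ := h' δ hδ0
  simp only at hp hq hp' hq'
  refine ⟨p * q, ?_, ?_⟩
  · rw [starEval_mul]
    refine (norm_mul_sub_mul_le hδ0.le hδ1 le_rfl le_rfl hp hq).trans (le_trans ?_ hδ)
    gcongr; norm_num
  · filter_upwards [hp', hq', approxPairs_eventually_le hT h 0 one_pos,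
      approxPairs_eventually_le hT h' 0 one_pos] with i h1 h2 h3 h4
    simp only [starEval_zero, sub_zero] at h3 h4
    rw [starEval_mul]
    refine (norm_mul_sub_mul_le hδ0.le hδ1 h3 h4 h1 h2).trans (le_trans (le_of_eq ?_) hδ)
    ring

theorem approxPairs_star_mem {a : A} {c : ∀ i, Mat (m i)} (h : (a, c) ∈ approxPairs l x T) :
    (star a, fun i => star (c i)) ∈ approxPairs l x T := by
  intro ε hε
  obtain ⟨p, hp, hp'⟩ := h ε hε
  obtain ⟨q, hq, hq'⟩ := exists_starEval_eq_star.{u, 0} p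
  refine ⟨q, ?_, ?_⟩
  · rw [hq, ← star_sub, norm_star]
    exact hp
  · filter_upwards [hp'] with i h1
    rw [hq', ← star_sub, norm_star]
    exact h1

/-- Write `a` as the limit of polynomials `p j` with geometrically small increments. The increments
are small at the matrices only eventually, at a stage depending on `j`, so each is replaced by `0`
at the indices where its bound fails. The series then converges at every index, and no diagonal
choice is needed for a general filter. -/
theorem exists_approxPair (hx : Generates x) (hT : ∀ p, ∀ ε : ℝ, 0 < ε →
      ∀ᶠ i in l, ‖starEval (T i) p‖ ≤ ‖starEval x p‖ + ε) (a : A) :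
    ∃ c, (a, c) ∈ approxPairs l x T := by
  choose p hp using fun j : ℕ => hx.exists_starEval_near a (ε := (1 / 2) ^ (j + 2)) (by positivity)
  let e := fun j => p (j + 1) - p j
  have he : ∀ j, ∀ᶠ i in l, ‖starEval (T i) (e j)‖ ≤ (1 / 2) ^ (j + 1) := by
    intro j
    have h1 : ‖starEval x (e j)‖ ≤ (1 / 2) ^ (j + 2) + (1 / 2) ^ (j + 3) := by
      have := norm_sub_le_norm_sub_add_norm_sub (starEval x (p (j + 1))) a (starEval x (p j))
      rw [← starEval_sub, norm_sub_rev _ a] at this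
      have h2 := hp j
      have h3 := hp (j + 1)
      linarith
    filter_upwards [hT (e j) ((1 / 2) ^ (j + 3)) (by positivity)] with i hi
    refine hi.trans ((add_le_add_left h1 _).trans (le_of_eq ?_))
    ring
  classical
  let d : ℕ → ∀ i, Mat (m i) := fun j i =>
    if ‖starEval (T i) (e j)‖ ≤ (1 / 2) ^ (j + 1) then starEval (T i) (e j) else 0
  have hd : ∀ j i, ‖d j i‖ ≤ (1 / 2) ^ (j + 1) := by
    intro j i
    simp only [d]
    split_ifs with h
    · exact h
    · rw [norm_zero]; positivity
  have hgeo : Summable fun j : ℕ => (1 / 2 : ℝ) ^ (j + 1) :=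
    (summable_nat_add_iff 1).2 summable_geometric_two
  have hsum : ∀ i, Summable fun j => d j i := fun i =>
    Summable.of_norm_bounded hgeo fun j => hd j i
  refine ⟨fun i => starEval (T i) (p 0) + ∑' j, d j i, fun ε hε => ?_⟩
  obtain ⟨J, hJ⟩ := exists_pow_lt_of_lt_one hε (show (1 / 2 : ℝ) < 1 by norm_num)
  refine ⟨p J, ?_, ?_⟩
  · refine (hp J).le.trans (le_trans ?_ hJ.le)
    exact pow_le_pow_of_le_one (by norm_num) (by norm_num) (by omega)
  -- Eventually none of the first `J` increments is truncated, so they telescope to `p J`, and the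
  -- tail is at most `(1/2) ^ J`.
  · have hall : ∀ᶠ i in l, ∀ j ∈ Finset.range J, ‖starEval (T i) (e j)‖ ≤ (1 / 2) ^ (j + 1) :=
      (Filter.eventually_all_finset _).2 fun j _ => he j
    filter_upwards [hall] with i hi
    have h1 : ∑ j ∈ Finset.range J, d j i = starEval (T i) (p J) - starEval (T i) (p 0) := by
      rw [← Finset.sum_range_sub (fun j => starEval (T i) (p j))]
      refine Finset.sum_congr rfl fun j hj => ?_
      simp only [d, if_pos (hi j hj)]
      exact starEval_sub _ _ _
    have h2 : starEval (T i) (p 0) + ∑' j, d j i - starEval (T i) (p J) = ∑' j, d (j + J) i := by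
      rw [← (hsum i).sum_add_tsum_nat_add J, h1]
      abel
    rw [h2]
    have h3 : HasSum (fun j : ℕ => (1 / 2 : ℝ) ^ (j + J + 1)) ((1 / 2) ^ J) := by
      have := (hasSum_geometric_two).mul_left ((1 / 2 : ℝ) ^ (J + 1))
      convert! this using 1
      · funext j; ring
      · ring
    refine (tsum_of_norm_bounded h3 fun j => hd (j + J) i).trans hJ.le

/-- The approximable pairs form a subspace that projects onto `A`, and a linear section of this
projection chooses all the matrices at once. -/
theorem exists_linear_approxPair (hx : Generates x) (hT : ∀ p, ∀ ε : ℝ, 0 < ε →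
      ∀ᶠ i in l, ‖starEval (T i) p‖ ≤ ‖starEval x p‖ + ε) :
    ∃ s : ∀ i, A →ₗ[ℂ] Mat (m i), ∀ a, (a, fun i => s i a) ∈ approxPairs l x T := by
  let π : approxPairs l x T →ₗ[ℂ] A := LinearMap.fst ℂ _ _ ∘ₗ (approxPairs l x T).subtype
  have hπ : Function.Surjective π := fun a => by
    obtain ⟨c, hc⟩ := exists_approxPair hx hT a
    exact ⟨⟨(a, c), hc⟩, rfl⟩
  obtain ⟨g, hg⟩ := π.exists_rightInverse_of_surjective (LinearMap.range_eq_top.2 hπ)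
  let s : ∀ i, A →ₗ[ℂ] Mat (m i) := fun i =>
    { toFun := fun a => (g a).1.2 i
      map_add' := fun a b => by rw [map_add]; rfl
      map_smul' := fun r a => by rw [map_smul]; rfl }
  refine ⟨s, fun a => ?_⟩
  have h1 : (g a).1 = (a, fun i => s i a) := Prod.ext (LinearMap.congr_fun hg a) rfl
  rw [← h1]
  exact (g a).2

theorem approxPairs_asympEq (hT : ∀ p, ∀ ε : ℝ, 0 < ε →
      ∀ᶠ i in l, ‖starEval (T i) p‖ ≤ ‖starEval x p‖ + ε) {c d : ∀ i, Mat (m i)} {a : A}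
    (hc : (a, c) ∈ approxPairs l x T) (hd : (a, d) ∈ approxPairs l x T) : AsympEq l c d := by
  have h1 := (approxPairs l x T).sub_mem hc hd
  refine asympEq_of_eventually_le fun ε hε => ?_
  have h2 := approxPairs_eventually_le (a := a - a) (c := c - d) hT h1 0 hε
  simpa using h2

/-- An asymptotically contractive family of tuples of matrices defines an asymptotic
*-homomorphism. -/
theorem exists_isAsympHom_of_tuple (hx : Generates x) (hT : ∀ p, ∀ ε : ℝ, 0 < ε →
      ∀ᶠ i in l, ‖starEval (T i) p‖ ≤ ‖starEval x p‖ + ε) :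
    ∃ s : ∀ i, A →ₗ[ℂ] Mat (m i), IsAsympHom l s ∧ Contractive l s ∧
      ∀ a p ε, 0 < ε → ∀ᶠ i in l, ‖s i a - starEval (T i) p‖ ≤ ‖a - starEval x p‖ + ε := by
  obtain ⟨s, hs⟩ := exists_linear_approxPair hx hT
  have hcon : Contractive l s := fun a ε hε => by
    simpa using approxPairs_eventually_le hT (hs a) 0 hε
  refine ⟨s, ⟨?_, fun a b => ?_, fun a => ?_, fun a => ?_⟩,
    hcon, fun a p ε hε => approxPairs_eventually_le hT (hs a) p hε⟩
  · refine approxPairs_asympEq (a := 1) hT (hs 1) fun ε hε => ⟨1, by simpa using hε.le, ?_⟩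
    simpa using Eventually.of_forall fun _ => hε.le
  · exact approxPairs_asympEq hT (hs (a * b)) (approxPairs_mul_mem hT (hs a) (hs b))
  · exact approxPairs_asympEq hT (hs (star a)) (approxPairs_star_mem (hs a))
  · exact ⟨_, hcon a 1 one_pos⟩

end Extension

/-! ### Local approximation of traces -/

section Local

/-- Finitely many *-polynomials can be evaluated at a tuple of matrices with almost no larger norms
and with almost the right normalized traces. -/
def UpperApprox {A : Type*} [NormedRing A] [StarRing A] [NormedAlgebra ℂ A] {ι : Type*} (x : ι → A)
    (τ : A → ℂ) : Prop :=
  ∀ (F : Finset (FreeAlgebra ℂ (ι ⊕ ι))) (ε : ℝ), 0 < ε → ∃ m, 0 < m ∧ ∃ T : ι → Mat m, ∀ p ∈ F,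
    ‖starEval T p‖ ≤ ‖starEval x p‖ + ε ∧ ‖normTrace m (starEval T p) - τ (starEval x p)‖ ≤ ε

/-- Finitely many *-polynomials can be evaluated at a tuple of matrices with almost the right norms
and normalized traces. -/
def LocalApprox {A : Type*} [NormedRing A] [StarRing A] [NormedAlgebra ℂ A] {ι : Type*} (x : ι → A)
    (τ : A → ℂ) : Prop :=
  ∀ (F : Finset (FreeAlgebra ℂ (ι ⊕ ι))) (ε : ℝ), 0 < ε → ∃ m, 0 < m ∧ ∃ T : ι → Mat m, ∀ p ∈ F,
    |‖starEval T p‖ - ‖starEval x p‖| ≤ ε ∧ ‖normTrace m (starEval T p) - τ (starEval x p)‖ ≤ ε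

theorem normTrace_of_eq_zero {k : ℕ} (hk : k = 0) (X : Mat k) : normTrace k X = 0 := by
  subst hk
  simp [normTrace]

/-- A finite set of polynomials imposes finitely many eventual conditions, so one index satisfies
them all. The filter is arbitrary, which admits ultrafilters and iterated limits. The size is
eventually positive since the normalized traces of the image of `1` tend to `1`, while on `0 × 0`
matrices they vanish. -/
theorem IsAsympHom.upperApprox {I : Type*} {l : Filter I} [l.NeBot] {m : I → ℕ} {A : Type*}
    [NormedRing A] [StarRing A] [NormedAlgebra ℂ A] {s : ∀ i, A →ₗ[ℂ] Mat (m i)}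
    (h : IsAsympHom l s) (hc : Contractive l s) {τ : A → ℂ} (h1 : τ 1 = 1)
    (hτ : ∀ a, Tendsto (fun i => normTrace (m i) (s i a)) l (𝓝 (τ a))) {ι : Type*} (x : ι → A) :
    UpperApprox x τ := by
  intro F ε hε
  have hm : ∀ᶠ i in l, 0 < m i := by
    have h2 := hτ 1
    rw [h1] at h2
    filter_upwards [h2.eventually_ne one_ne_zero] with i hi
    by_contra! h0
    refine hi ?_
    have : m i = 0 := by omega
    exact normTrace_of_eq_zero this _
  have hall : ∀ᶠ i in l, ∀ p ∈ F,
      ‖starEval (fun j => s i (x j)) p‖ ≤ ‖starEval x p‖ + ε ∧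
      ‖normTrace (m i) (starEval (fun j => s i (x j)) p) - τ (starEval x p)‖ ≤ ε := by
    refine (Filter.eventually_all_finset _).2 fun p _ => ?_
    have h2 := h.asympEq_starEval x p
    have h3 := (h2.tendsto_normTrace (hτ (starEval x p)))
    have h4 := (tendsto_iff_norm_sub_tendsto_zero.1 h3).eventually (gt_mem_nhds hε)
    filter_upwards [h2.eventually_le (half_pos hε), hc (starEval x p) (ε / 2) (half_pos hε), h4]
      with i h5 h6 h7
    refine ⟨?_, h7.le⟩
    have := norm_le_norm_add_norm_sub (s i (starEval x p)) (starEval (fun j => s i (x j)) p)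
    rw [norm_sub_rev] at this
    linarith
  obtain ⟨i, hi, hi'⟩ := (hm.and hall).exists
  exact ⟨m i, hi, fun j => s i (x j), hi'⟩

theorem norm_mat_zero {k : ℕ} (hk : k = 0) (X : Mat k) : ‖X‖ = 0 := by
  subst hk
  rw [Subsingleton.elim X 0, norm_zero]

/-- Lower bounds for different polynomials may be attained at different indices, while the upper
bounds hold at all late ones. A direct sum of one tuple for each polynomial has as norms the maxima,
so it satisfies all the bounds. -/
theorem IsMF.exists_norm_approx {A : Type*} [CStarAlgebra A] [Nontrivial A] (hA : IsMF A)
    {ι : Type*} (x : ι → A) (F : Finset (FreeAlgebra ℂ (ι ⊕ ι))) {ε : ℝ} (hε : 0 < ε) :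
    ∃ m, 0 < m ∧ ∃ T : ι → Mat m, ∀ p ∈ F, |‖starEval T p‖ - ‖starEval x p‖| ≤ ε := by
  obtain ⟨r, s, hs, hlow⟩ := hA.exists_isAsympHom
  have hall : ∀ᶠ i in atTop, ∀ p ∈ F, ‖starEval (fun j => s i (x j)) p‖ ≤ ‖starEval x p‖ + ε := by
    refine (Filter.eventually_all_finset _).2 fun p _ => ?_
    filter_upwards [(hs.asympEq_starEval x p).eventually_le (half_pos hε),
      hs.contractive (starEval x p) (ε / 2) (half_pos hε)] with i h5 h6
    have := norm_le_norm_add_norm_sub (s i (starEval x p)) (starEval (fun j => s i (x j)) p)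
    rw [norm_sub_rev] at this
    linarith
  have single : ∀ p, ∃ m, 0 < m ∧ ∃ T : ι → Mat m,
      (∀ q ∈ F, ‖starEval T q‖ ≤ ‖starEval x q‖ + ε) ∧ ‖starEval x p‖ - ε ≤ ‖starEval T p‖ := by
    intro p
    -- For small norm the lower bound is trivial and the index has only to give matrices of positive
    -- size; the element `1` finds one.
    rcases le_or_gt ‖starEval x p‖ (ε / 2) with hp | hp
    · have h1 := hlow 1 0 (by rw [norm_one]; exact one_pos)
      obtain ⟨i, hi, hi'⟩ := (h1.and_eventually hall).exists
      refine ⟨r i, Nat.pos_of_ne_zero fun h0 => ?_, _, hi', ?_⟩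
      · rw [norm_mat_zero h0] at hi
        exact lt_irrefl _ hi
      · have := norm_nonneg (starEval (fun j => s i (x j)) p)
        linarith
    · have h1 := hlow (starEval x p) (‖starEval x p‖ - ε / 2) (by linarith)
      obtain ⟨i, hi, hi', hi''⟩ := (h1.and_eventually (hall.and
        ((hs.asympEq_starEval x p).eventually_le (half_pos hε)))).exists
      refine ⟨r i, Nat.pos_of_ne_zero fun h0 => ?_, _, hi', ?_⟩
      · rw [norm_mat_zero h0] at hi
        linarith
      · have := norm_le_norm_add_norm_sub (starEval (fun j => s i (x j)) p) (s i (starEval x p))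
        linarith
  have key : ∀ G : Finset (FreeAlgebra ℂ (ι ⊕ ι)), ∃ m, 0 < m ∧ ∃ T : ι → Mat m,
      (∀ q ∈ F, ‖starEval T q‖ ≤ ‖starEval x q‖ + ε) ∧
      ∀ p ∈ G, ‖starEval x p‖ - ε ≤ ‖starEval T p‖ := by
    classical
    intro G
    induction G using Finset.induction_on with
    | empty =>
      obtain ⟨m, hm, T, hT, -⟩ := single 0
      exact ⟨m, hm, T, hT, by simp⟩
    | insert p G _ ih =>
      obtain ⟨m, hm, T, hT, hT'⟩ := ih
      obtain ⟨n, hn, S, hS, hS'⟩ := single p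
      have e : ∀ q, ‖starEval (fun j => directSum m n (T j, S j)) q‖
          = max ‖starEval T q‖ ‖starEval S q‖ := by
        intro q
        rw [← map_starEval, norm_directSum, starEval_prod, Prod.norm_mk]
      refine ⟨m + n, by omega, fun j => directSum m n (T j, S j), fun q hq => ?_, fun q hq => ?_⟩
      · rw [e]
        exact max_le (hT q hq) (hS q hq)
      · rw [e]
        rcases Finset.mem_insert.1 hq with rfl | hq
        · exact hS'.trans (le_max_right _ _)
        · exact (hT' q hq).trans (le_max_left _ _)
  obtain ⟨m, hm, T, hT, hT'⟩ := key F
  refine ⟨m, hm, T, fun p hp => abs_le.2 ⟨?_, ?_⟩⟩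
  · linarith [hT' p hp]
  · linarith [hT p hp]

theorem exists_weights {t δ : ℝ} (ht0 : 0 ≤ t) (ht1 : t ≤ 1) (hδ : 0 < δ) :
    ∃ a b : ℕ, 0 < a ∧ 0 < b ∧ |(a : ℝ) / (a + b) - t| ≤ δ := by
  obtain ⟨K, hK⟩ := exists_nat_gt (2 / δ)
  have hK0 : (0 : ℝ) < K := lt_trans (by positivity) hK
  have hKδ : 2 < K * δ := by rwa [div_lt_iff₀ hδ] at hK
  -- The added ones keep both multiplicities positive even for `t = 0` or `t = 1`, so that both
  -- summands contribute to the norm.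
  refine ⟨⌊t * K⌋₊ + 1, ⌊(1 - t) * K⌋₊ + 1, Nat.succ_pos _, Nat.succ_pos _, ?_⟩
  have ha1 := Nat.lt_floor_add_one (t * K)
  have ha2 := Nat.floor_le (show 0 ≤ t * K by positivity)
  have hb1 := Nat.lt_floor_add_one ((1 - t) * K)
  have hb2 := Nat.floor_le (show 0 ≤ (1 - t) * K by
    exact mul_nonneg (by linarith) hK0.le)
  push_cast
  set a : ℝ := (⌊t * K⌋₊ : ℝ) + 1
  set b : ℝ := (⌊(1 - t) * K⌋₊ : ℝ) + 1
  have hab : 0 < a + b := by positivity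
  have e : a / (a + b) - t = (a * (1 - t) - b * t) / (a + b) := by
    field_simp
    ring
  rw [e, abs_div, abs_of_pos hab, div_le_iff₀ hab, abs_le]
  have h1 : a ≤ t * K + 1 := by simp only [a]; linarith
  have h2 : b ≤ (1 - t) * K + 1 := by simp only [b]; linarith
  constructor <;> nlinarith

/-- Direct sums realize convex combinations of normalized traces approximately. -/
theorem exists_convex_combination {ι : Type*} {m n : ℕ} (hm : 0 < m) (hn : 0 < n) (T : ι → Mat m)
    (S : ι → Mat n) {t δ : ℝ} (ht0 : 0 ≤ t) (ht1 : t ≤ 1) (hδ : 0 < δ) :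
    ∃ k, 0 < k ∧ ∃ U : ι → Mat k, ∀ p, ‖starEval U p‖ = max ‖starEval T p‖ ‖starEval S p‖ ∧
      ‖normTrace k (starEval U p) - ((t : ℂ) * normTrace m (starEval T p) +
        (1 - t) * normTrace n (starEval S p))‖ ≤ δ * (‖starEval T p‖ + ‖starEval S p‖) := by
  obtain ⟨a, b, ha, hb, hab⟩ := exists_weights ht0 ht1 hδ
  have hna : 0 < n * a := by positivity
  have hmb : 0 < m * b := by positivity
  -- With `n * a` copies of `T` and `m * b` copies of `S` the summands have dimensions `mn·a` and
  -- `mn·b`, hence trace weights `a / (a + b)` and `b / (a + b)`.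
  refine ⟨m * (n * a) + n * (m * b), by positivity, fun j => directSum (m * (n * a)) (n * (m * b))
    (kronLeft m (n * a) (T j), kronLeft n (m * b) (S j)), fun p => ?_⟩
  rw [← map_starEval, starEval_prod, ← map_starEval, ← map_starEval, norm_directSum, Prod.norm_mk,
    norm_kronLeft hna, norm_kronLeft hmb]
  refine ⟨rfl, ?_⟩
  have h := normTrace_directSum (m * (n * a)) (n * (m * b))
    (kronLeft m (n * a) (starEval T p), kronLeft n (m * b) (starEval S p))
  simp only [normTrace_kronLeft hna, normTrace_kronLeft hmb] at h
  set z := normTrace (m * (n * a) + n * (m * b)) _ with hz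
  set u := normTrace m (starEval T p) with hu
  set v := normTrace n (starEval S p) with hv
  have hm' : (m : ℂ) ≠ 0 := by exact_mod_cast hm.ne'
  have hn' : (n : ℂ) ≠ 0 := by exact_mod_cast hn.ne'
  have hab0 : ((a : ℂ) + b) ≠ 0 := by exact_mod_cast (by omega : a + b ≠ 0)
  have h2 : z = ((a : ℂ) / (a + b)) * u + (1 - (a : ℂ) / (a + b)) * v := by
    push_cast at h
    have h3 : ((a : ℂ) + b) * z = a * u + b * v := by
      refine mul_left_cancel₀ (mul_ne_zero hm' hn') ?_
      linear_combination h
    field_simp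
    linear_combination h3
  have h4 : z - ((t : ℂ) * u + (1 - t) * v) = (((a : ℝ) / (a + b) - t : ℝ) : ℂ) * (u - v) := by
    rw [h2]; push_cast; ring
  rw [h4, norm_mul, Complex.norm_real, Real.norm_eq_abs]
  refine mul_le_mul hab ((norm_sub_le _ _).trans ?_) (norm_nonneg _) hδ.le
  exact add_le_add (norm_normTrace_le _ _) (norm_normTrace_le _ _)

/-- A norming tuple is added as a direct summand of small relative dimension: it raises the norms to
nearly their correct values, and its contribution to the normalized trace is negligible. -/
theorem UpperApprox.localApprox {A : Type*} [CStarAlgebra A] [Nontrivial A] (hA : IsMF A)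
    {ι : Type*} {x : ι → A} {τ : A → ℂ} (h : UpperApprox x τ) : LocalApprox x τ := by
  intro F ε hε
  obtain ⟨M, hM, hM0⟩ : ∃ M : ℝ, (∀ p ∈ F, ‖starEval x p‖ ≤ M) ∧ 0 ≤ M :=
    ⟨∑ p ∈ F, ‖starEval x p‖, fun p hp => Finset.single_le_sum
      (f := fun p => ‖starEval x p‖) (fun _ _ => norm_nonneg _) hp,
      Finset.sum_nonneg fun _ _ => norm_nonneg _⟩
  obtain ⟨m, hm, T, hT⟩ := h F (ε / 2) (by positivity)
  obtain ⟨n, hn, S, hS⟩ := hA.exists_norm_approx x F (half_pos hε)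
  -- The target weight of `T` is `1`. The tolerance is divided by `2 * M + ε`, a bound for the sum
  -- of the norms at `T` and `S`.
  obtain ⟨k, hk, U, hU⟩ := exists_convex_combination hm hn T S zero_le_one le_rfl
    (show 0 < (ε / 2) / (2 * M + ε) by positivity)
  refine ⟨k, hk, U, fun p hp => ?_⟩
  obtain ⟨h1, h2⟩ := hU p
  obtain ⟨h3, h4⟩ := hT p hp
  have h5 := abs_le.1 (hS p hp)
  have h6 := hM p hp
  constructor
  · rw [h1, abs_le]
    constructor
    · linarith [le_max_right ‖starEval T p‖ ‖starEval S p‖]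
    · have : max ‖starEval T p‖ ‖starEval S p‖ ≤ ‖starEval x p‖ + ε :=
        max_le (by linarith) (by linarith)
      linarith
  · have h7 : (ε / 2) / (2 * M + ε) * (‖starEval T p‖ + ‖starEval S p‖) ≤ ε / 2 := by
      rw [div_mul_eq_mul_div, div_le_iff₀ (by positivity)]
      exact mul_le_mul_of_nonneg_left (by linarith) (by positivity)
    have h8 := h2.trans h7
    simp only [Complex.ofReal_one, one_mul, sub_self, zero_mul, add_zero] at h8
    have := norm_sub_le_norm_sub_add_norm_sub (normTrace k (starEval U p))
      (normTrace m (starEval T p)) (τ (starEval x p))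
    linarith

end Local

/-! ### From local approximation to sequences -/

section Sequence

theorem exists_starEval_bound {ι : Type*} (R : ℝ) (p : FreeAlgebra ℂ (ι ⊕ ι)) :
    ∃ C : ℝ, 0 ≤ C ∧ ∀ (M : Type u) [CStarAlgebra M] (T : ι → M), (∀ i, ‖T i‖ ≤ R) →
      ‖starEval T p‖ ≤ C := by
  have hone : ∀ (M : Type u) [CStarAlgebra M], ‖(1 : M)‖ ≤ 1 := by
    intro M _
    rcases subsingleton_or_nontrivial M with h | h
    · rw [Subsingleton.elim (1 : M) 0, norm_zero]; exact zero_le_one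
    · exact (CStarRing.norm_one (E := M)).le
  induction p using FreeAlgebra.induction with
  | grade0 r =>
    refine ⟨‖r‖, norm_nonneg _, fun M _ T _ => ?_⟩
    rw [starEval_algebraMap, norm_algebraMap]
    exact mul_le_of_le_one_right (norm_nonneg _) (hone M)
  | grade1 j =>
    refine ⟨|R|, abs_nonneg _, fun M _ T hT => ?_⟩
    rcases j with j | j
    · simpa using (hT j).trans (le_abs_self R)
    · simpa using (hT j).trans (le_abs_self R)
  | mul p q hp hq =>
    obtain ⟨C, hC0, hC⟩ := hp
    obtain ⟨D, hD0, hD⟩ := hq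
    refine ⟨C * D, by positivity, fun M _ T hT => ?_⟩
    rw [starEval_mul]
    exact (norm_mul_le _ _).trans (mul_le_mul (hC M T hT) (hD M T hT) (norm_nonneg _) hC0)
  | add p q hp hq =>
    obtain ⟨C, hC0, hC⟩ := hp
    obtain ⟨D, hD0, hD⟩ := hq
    refine ⟨C + D, by positivity, fun M _ T hT => ?_⟩
    rw [starEval_add]
    exact (norm_add_le _ _).trans (add_le_add (hC M T hT) (hD M T hT))

/-- A countable set of *-polynomials which is dense for the evaluations at bounded tuples. -/
theorem exists_countable_dense_poly (ι : Type*) [Countable ι] :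
    ∃ f : ℕ → FreeAlgebra ℂ (ι ⊕ ι), ∀ (p : FreeAlgebra ℂ (ι ⊕ ι)) (R ε : ℝ), 0 < ε →
      ∃ n, ∀ (M : Type u) [CStarAlgebra M] (T : ι → M), (∀ i, ‖T i‖ ≤ R) →
        ‖starEval T p - starEval T (f n)‖ ≤ ε := by
  have hone : ∀ (M : Type u) [CStarAlgebra M], ‖(1 : M)‖ ≤ 1 := by
    intro M _
    rcases subsingleton_or_nontrivial M with h | h
    · rw [Subsingleton.elim (1 : M) 0, norm_zero]; exact zero_le_one
    · exact (CStarRing.norm_one (E := M)).le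
  -- Coefficients are taken from a dense sequence, and generating over `ℕ` instead of `ℂ` keeps the
  -- algebra countable.
  let S : Set (FreeAlgebra ℂ (ι ⊕ ι)) :=
    Set.range (FreeAlgebra.ι ℂ) ∪ Set.range fun n => algebraMap ℂ _ (TopologicalSpace.denseSeq ℂ n)
  have hS : S.Countable := (Set.countable_range _).union (Set.countable_range _)
  have : Countable (Algebra.adjoin ℕ S) := by
    rw [← Cardinal.mk_le_aleph0_iff, ← Cardinal.lift_le_aleph0.{_, 0}]
    refine (Algebra.lift_cardinalMk_adjoin_le ℕ S).trans ?_
    have := hS.le_aleph0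
    simp [this]
  obtain ⟨g, hg⟩ := exists_surjective_nat (Algebra.adjoin ℕ S)
  refine ⟨fun n => (g n).1, fun p R => ?_⟩
  suffices h : ∀ ε : ℝ, 0 < ε → ∃ q ∈ Algebra.adjoin ℕ S,
      ∀ (M : Type u) [CStarAlgebra M] (T : ι → M), (∀ i, ‖T i‖ ≤ R) →
        ‖starEval T p - starEval T q‖ ≤ ε by
    intro ε hε
    obtain ⟨q, hq, h⟩ := h ε hε
    obtain ⟨n, hn⟩ := hg ⟨q, hq⟩
    refine ⟨n, ?_⟩
    simpa only [hn] using h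
  induction p using FreeAlgebra.induction with
  | grade0 r =>
    intro ε hε
    obtain ⟨_, ⟨n, rfl⟩, hn⟩ := Metric.mem_closure_iff.1
      (TopologicalSpace.denseRange_denseSeq ℂ r) ε hε
    refine ⟨_, Algebra.subset_adjoin (Or.inr ⟨n, rfl⟩), fun M _ T _ => ?_⟩
    rw [starEval_algebraMap, starEval_algebraMap, ← map_sub, norm_algebraMap]
    rw [dist_eq_norm] at hn
    exact (mul_le_of_le_one_right (norm_nonneg _) (hone M)).trans hn.le
  | grade1 j =>
    intro ε hε
    exact ⟨_, Algebra.subset_adjoin (Or.inl ⟨j, rfl⟩), fun M _ T _ => by simpa using hε.le⟩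
  | mul p q hp hq =>
    intro ε hε
    obtain ⟨C, hC0, hC⟩ := exists_starEval_bound.{u} R p
    obtain ⟨D, hD0, hD⟩ := exists_starEval_bound.{u} R q
    have hδ1 : min 1 (ε / (C + D + 1)) ≤ 1 := min_le_left _ _
    have hδ0 : 0 < min 1 (ε / (C + D + 1)) := by positivity
    obtain ⟨p', hp', h1⟩ := hp _ hδ0
    obtain ⟨q', hq', h2⟩ := hq _ hδ0
    refine ⟨p' * q', mul_mem hp' hq', fun M _ T hT => ?_⟩
    rw [starEval_mul, starEval_mul]
    refine (norm_mul_sub_mul_le hδ0.le hδ1 (hC M T hT) (hD M T hT) (h1 M T hT) (h2 M T hT)).trans ?_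
    rw [← le_div_iff₀ (by positivity)]
    exact min_le_right _ _
  | add p q hp hq =>
    intro ε hε
    obtain ⟨p', hp', h1⟩ := hp (ε / 2) (half_pos hε)
    obtain ⟨q', hq', h2⟩ := hq (ε / 2) (half_pos hε)
    refine ⟨p' + q', add_mem hp' hq', fun M _ T hT => ?_⟩
    rw [starEval_add, starEval_add, add_sub_add_comm]
    exact (norm_add_le _ _).trans (by linarith [h1 M T hT, h2 M T hT])

/-- A diagonal argument: the `N`-th tuple handles the dense polynomials with index up to `N` with
error `1 / (N + 1)`. The finitely many variables are included in every stage, which bounds the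
tuples uniformly and lets density reach all polynomials. -/
theorem mem_MFTraces_of_localApprox {A : Type u} [CStarAlgebra A] {ι : Type*} [Finite ι]
    {x : ι → A} {τ : WeakDual ℂ A} (hτ : IsTracialState τ) (h : LocalApprox x τ) :
    τ ∈ MFTraces x := by
  classical
  have := Fintype.ofFinite ι
  obtain ⟨f, hf⟩ := exists_countable_dense_poly.{u} ι
  let F : ℕ → Finset (FreeAlgebra ℂ (ι ⊕ ι)) := fun N =>
    (Finset.range (N + 1)).image f ∪ Finset.univ.image fun i => FreeAlgebra.ι ℂ (Sum.inl i)
  choose m hm T hT using fun N : ℕ => h (F N) (1 / (N + 1)) (by positivity)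
  obtain ⟨R, hR⟩ : ∃ R : ℝ, ∀ i, ‖x i‖ + 1 ≤ R := by
    refine ⟨∑ i, (‖x i‖ + 1), fun i => Finset.single_le_sum (f := fun i => ‖x i‖ + 1)
      (fun _ _ => by positivity) (Finset.mem_univ i)⟩
  have hxR : ∀ i, ‖x i‖ ≤ R := fun i => by linarith [hR i]
  have hTR : ∀ N i, ‖T N i‖ ≤ R := by
    intro N i
    have h1 := (hT N (FreeAlgebra.ι ℂ (Sum.inl i)) (Finset.mem_union_right _
      (Finset.mem_image_of_mem _ (Finset.mem_univ i)))).1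
    have h2 : (1 : ℝ) / (N + 1) ≤ 1 := by
      rw [div_le_one (by positivity)]
      have : (0 : ℝ) ≤ N := by positivity
      linarith
    simp only [starEval_inl] at h1
    linarith [(abs_le.1 h1).2, hR i]
  have happrox : ∀ p, ∀ ε : ℝ, 0 < ε → ∀ᶠ N : ℕ in atTop,
      |‖starEval (T N) p‖ - ‖starEval x p‖| ≤ ε ∧
      ‖normTrace (m N) (starEval (T N) p) - τ (starEval x p)‖ ≤ ε := by
    intro p ε hε
    have hcont : ∃ K : ℝ, 0 < K ∧ ∀ a, ‖τ a‖ ≤ K * ‖a‖ := by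
      refine ⟨‖WeakDual.toStrongDual τ‖ + 1, by positivity, fun a => ?_⟩
      refine ((WeakDual.toStrongDual τ).le_opNorm a).trans ?_
      gcongr
      linarith
    obtain ⟨K, hK0, hK⟩ := hcont
    obtain ⟨n, hn⟩ := hf p R (ε / (3 + K)) (by positivity)
    have hδ : (1 + 1 + K) * (ε / (3 + K)) + ε / (3 + K) = ε := by field_simp; ring
    have hδ0 : 0 < ε / (3 + K) := by positivity
    have hKδ : 0 < K * (ε / (3 + K)) := by positivity
    have hx1 := hn A x hxR
    have h1 : ∀ᶠ N : ℕ in atTop, (1 : ℝ) / (N + 1) < ε / (3 + K) :=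
      tendsto_one_div_add_atTop_nhds_zero_nat.eventually (gt_mem_nhds hδ0)
    filter_upwards [h1, eventually_ge_atTop n] with N hN hnN
    obtain ⟨h2, h3⟩ := hT N (f n) (Finset.mem_union_left _
      (Finset.mem_image_of_mem _ (Finset.mem_range.2 (by omega))))
    have hT1 : ‖starEval (T N) p - starEval (T N) (f n)‖ ≤ ε / (3 + K) := by
      -- The density statement concerns algebras in the universe of `A`; pairing with `0 : A` moves
      -- the matrices there.
      have h4 := hn (A × Mat (m N)) (fun i => (0, T N i)) fun i => by
        rw [Prod.norm_mk, norm_zero]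
        exact max_le ((norm_nonneg _).trans (hTR N i)) (hTR N i)
      rw [starEval_prod, starEval_prod, Prod.mk_sub_mk, Prod.norm_mk] at h4
      exact (le_max_right _ _).trans h4
    constructor
    · have h5 := abs_le.1 ((abs_norm_sub_norm_le _ _).trans hT1)
      have h6 := abs_le.1 ((abs_norm_sub_norm_le _ _).trans hx1)
      have h7 := abs_le.1 h2
      rw [abs_le]
      constructor <;> nlinarith
    · have h5 : ‖τ (starEval x (f n)) - τ (starEval x p)‖ ≤ K * (ε / (3 + K)) := by
        rw [← map_sub, ← norm_neg, ← map_neg, neg_sub]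
        exact (hK _).trans (mul_le_mul_of_nonneg_left hx1 hK0.le)
      have h6 : ‖normTrace (m N) (starEval (T N) p) - normTrace (m N) (starEval (T N) (f n))‖
          ≤ ε / (3 + K) := by
        rw [← normTrace_sub]
        exact (norm_normTrace_le _ _).trans hT1
      have h7 := norm_sub_le_norm_sub_add_norm_sub (normTrace (m N) (starEval (T N) p))
        (normTrace (m N) (starEval (T N) (f n))) (τ (starEval x p))
      have h8 := norm_sub_le_norm_sub_add_norm_sub (normTrace (m N) (starEval (T N) (f n)))
        (τ (starEval x (f n))) (τ (starEval x p))
      nlinarith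
  refine ⟨hτ, m, hm, fun i N => T N i, fun p => ⟨?_, ?_⟩⟩
  · rw [Metric.tendsto_nhds]
    intro ε hε
    filter_upwards [happrox p (ε / 2) (half_pos hε)] with N hN
    rw [Real.dist_eq]
    exact lt_of_le_of_lt hN.1 (half_lt_self hε)
  · rw [Metric.tendsto_nhds]
    intro ε hε
    filter_upwards [happrox p (ε / 2) (half_pos hε)] with N hN
    rw [dist_eq_norm]
    exact lt_of_le_of_lt hN.2 (half_lt_self hε)

/-- This criterion underlies nonemptiness, convexity, closedness, and the statements on quotients,
ultraproducts, finite-dimensional traces and tensor products: in each of these only upper norm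
bounds have to be produced. -/
theorem mem_MFTraces_of_upperApprox {A : Type u} [CStarAlgebra A] (hA : IsMF A) {ι : Type*}
    [Finite ι] {x : ι → A} {τ : WeakDual ℂ A} (hτ : IsTracialState τ) (h : UpperApprox x τ) :
    τ ∈ MFTraces x := by
  have : Nontrivial A := ⟨1, 0, fun h0 => by
    have := hτ.2.1
    rw [h0, map_zero] at this
    exact zero_ne_one this⟩
  exact mem_MFTraces_of_localApprox hτ (h.localApprox hA)

end Sequence

/-! ### MF-traces and asymptotic *-homomorphisms -/

section Correspondence

variable {A : Type u} [NormedRing A] [StarRing A] [CStarRing A] [NormedAlgebra ℂ A] [StarModule ℂ A]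

/-- Values of polynomials are dense, and norms, normalized traces and `τ` are Lipschitz, so
convergence on polynomials extends to every element. The result is free of the generators. -/
theorem exists_isAsympHom_of_mem_MFTraces {ι : Type*} {x : ι → A}
    (hx : Generates x) {τ : WeakDual ℂ A} (hτ : τ ∈ MFTraces x) :
    ∃ m : ℕ → ℕ, (∀ k, 0 < m k) ∧ ∃ s : ∀ k, A →ₗ[ℂ] Mat (m k), IsAsympHom atTop s ∧
      ∀ a, Tendsto (fun k => ‖s k a‖) atTop (𝓝 ‖a‖) ∧
        Tendsto (fun k => normTrace (m k) (s k a)) atTop (𝓝 (τ a)) := by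
  obtain ⟨-, m, hm, T, hT⟩ := hτ
  obtain ⟨s, hs, -, hsT⟩ := exists_isAsympHom_of_tuple (l := atTop) (T := fun k i => T i k) hx
    fun p ε hε => by
      filter_upwards [(hT p).1.eventually (gt_mem_nhds (lt_add_of_pos_right _ hε))] with k hk
      exact hk.le
  refine ⟨m, hm, s, hs, fun a => ⟨?_, ?_⟩⟩
  · rw [Metric.tendsto_nhds]
    intro ε hε
    obtain ⟨p, hp⟩ := hx.exists_starEval_near a (ε := ε / 4) (by positivity)
    filter_upwards [hsT a p (ε / 4) (by positivity), (Metric.tendsto_nhds.1 (hT p).1) (ε / 4)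
      (by positivity)] with k h1 h2
    rw [Real.dist_eq] at h2 ⊢
    have h3 := abs_norm_sub_norm_le (s k a) (starEval (fun i => T i k) p)
    have h4 := abs_norm_sub_norm_le a (starEval x p)
    rw [abs_le] at h3 h4
    rw [abs_lt] at h2 ⊢
    constructor <;> linarith
  · rw [Metric.tendsto_nhds]
    intro ε hε
    set K := ‖WeakDual.toStrongDual τ‖ with hK
    obtain ⟨p, hp⟩ := hx.exists_starEval_near a (ε := ε / (4 + K)) (by positivity)
    have hK0 : 0 ≤ K := norm_nonneg _
    have hδ : (4 + K) * (ε / (4 + K)) = ε := mul_div_cancel₀ _ (by positivity)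
    have hδ0 : 0 < ε / (4 + K) := by positivity
    filter_upwards [hsT a p (ε / (4 + K)) (by positivity), (Metric.tendsto_nhds.1 (hT p).2)
      (ε / (4 + K)) (by positivity)] with k h1 h2
    rw [dist_eq_norm] at h2 ⊢
    have h3 : ‖normTrace (m k) (s k a) - normTrace (m k) (starEval (fun i => T i k) p)‖
        ≤ ‖s k a - starEval (fun i => T i k) p‖ := by
      rw [← normTrace_sub]
      exact norm_normTrace_le _ _
    have h4 : ‖τ (starEval x p) - τ a‖ ≤ K * (ε / (4 + K)) := by
      rw [← map_sub, ← norm_neg, ← map_neg, neg_sub]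
      exact ((WeakDual.toStrongDual τ).le_opNorm _).trans
        (mul_le_mul_of_nonneg_left hp.le (norm_nonneg _))
    have h5 := norm_sub_le_norm_sub_add_norm_sub (normTrace (m k) (s k a))
      (normTrace (m k) (starEval (fun i => T i k) p)) (τ a)
    have h6 := norm_sub_le_norm_sub_add_norm_sub (normTrace (m k) (starEval (fun i => T i k) p))
      (τ (starEval x p)) (τ a)
    nlinarith

theorem mem_MFTraces_of_isAsympHom {ι : Type*} (x : ι → A)
    {τ : WeakDual ℂ A} (hτ : IsTracialState τ) {m : ℕ → ℕ} (hm : ∀ k, 0 < m k)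
    {s : ∀ k, A →ₗ[ℂ] Mat (m k)} (hs : IsAsympHom atTop s)
    (hsn : ∀ a, Tendsto (fun k => ‖s k a‖) atTop (𝓝 ‖a‖))
    (hst : ∀ a, Tendsto (fun k => normTrace (m k) (s k a)) atTop (𝓝 (τ a))) :
    τ ∈ MFTraces x :=
  ⟨hτ, m, hm, fun i k => s k (x i), fun p =>
    ⟨(hs.asympEq_starEval x p).tendsto_norm (hsn _),
      (hs.asympEq_starEval x p).tendsto_normTrace (hst _)⟩⟩

/-- MF-traces do not depend on the generating family. -/
theorem mem_MFTraces_of_generates {ι κ : Type*} {x : ι → A}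
    (hx : Generates x) {τ : WeakDual ℂ A} (hτ : τ ∈ MFTraces x) (z : κ → A) : τ ∈ MFTraces z := by
  obtain ⟨m, hm, s, hs, h⟩ := exists_isAsympHom_of_mem_MFTraces hx hτ
  exact mem_MFTraces_of_isAsympHom z hτ.1 hm hs (fun a => (h a).1) fun a => (h a).2

end Correspondence

/-! ### States -/

section States

variable {A : Type*} [CStarAlgebra A]

/-- The values at `(b + 1)* (b + 1)`, `b* b` and `1` are real, so `f (b*) + f b` is real; this is
applied to `a` and to `i a`. -/
theorem map_star_of_nonneg {f : A →ₗ[ℂ] ℂ} (hf : ∀ a, 0 ≤ f (star a * a)) (a : A) :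
    f (star a) = star (f a) := by
  have im_eq : ∀ b : A, (f (star b)).im + (f b).im = 0 := by
    intro b
    have h1 := (Complex.nonneg_iff.1 (hf (b + 1))).2
    have h2 := (Complex.nonneg_iff.1 (hf b)).2
    have h3 := (Complex.nonneg_iff.1 (hf 1)).2
    have e : star (b + 1) * (b + 1) = star b * b + star b + b + star 1 * 1 := by
      simp only [star_add, star_one]; noncomm_ring
    rw [e] at h1
    simp only [map_add, Complex.add_im] at h1
    linarith
  have h1 := im_eq a
  have h2 := im_eq (Complex.I • a)
  rw [star_smul, map_smul, map_smul] at h2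
  simp at h2
  apply Complex.ext
  · simp; linarith
  · simp; linarith

theorem re_star_mul_self_le {f : A →ₗ[ℂ] ℂ} (hf : ∀ a, 0 ≤ f (star a * a)) (a : A) :
    (f (star a * a)).re ≤ (f 1).re * ‖a‖ ^ 2 := by
  obtain ⟨b, hb⟩ := exists_star_mul_self_eq_sub a
  have h1 := congrArg f hb
  rw [map_smul, map_add] at h1
  have h2 := (Complex.nonneg_iff.1 (hf b)).1
  have h3 := congrArg Complex.re h1
  simp only [smul_eq_mul, Complex.re_ofReal_mul, Complex.add_re] at h3
  linarith

/-- A positive functional is bounded by its value at the unit. -/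
theorem norm_le_of_nonneg {f : A →ₗ[ℂ] ℂ} (hf : ∀ a, 0 ≤ f (star a * a)) (a : A) :
    ‖f a‖ ≤ (f 1).re * ‖a‖ := by
  have h1 : (f 1).im = 0 := by
    have := (Complex.nonneg_iff.1 (hf 1)).2
    simpa using this.symm
  have h1' : 0 ≤ (f 1).re := by
    have := (Complex.nonneg_iff.1 (hf 1)).1
    simpa using this
  have h2 := re_star_mul_self_le hf a
  -- This is Cauchy–Schwarz, written as positivity of `f` on the square of `a - s (f a) 1`; the
  -- optimal `s` is `1 / f 1`, and `s = 1` serves if `f 1 = 0`.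
  have key : ∀ s : ℝ, 0 ≤ (f (star a * a)).re - 2 * s * ‖f a‖ ^ 2 + s ^ 2 * ‖f a‖ ^ 2 * (f 1).re := by
    intro s
    have h3 := (Complex.nonneg_iff.1 (hf (a - ((s : ℂ) * f a) • 1))).1
    have e : star (a - ((s : ℂ) * f a) • (1 : A)) * (a - ((s : ℂ) * f a) • (1 : A)) =
        star a * a - ((s : ℂ) * f a) • star a - star ((s : ℂ) * f a) • a +
          (star ((s : ℂ) * f a) * ((s : ℂ) * f a)) • 1 := by
      rw [star_sub, star_smul, star_one, sub_mul, mul_sub, mul_sub, mul_smul_comm, smul_mul_assoc,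
        smul_mul_smul_comm]
      simp only [mul_one, one_mul]
      abel
    rw [e] at h3
    simp only [map_add, map_sub, map_smul, map_star_of_nonneg hf, smul_eq_mul, star_mul'] at h3
    have h4 : star (f a) * f a = ((‖f a‖ ^ 2 : ℝ) : ℂ) := by
      rw [← Complex.normSq_eq_norm_sq, Complex.normSq_eq_conj_mul_self]; rfl
    have h5 : star (s : ℂ) = s := Complex.conj_ofReal s
    have h6 : f 1 = ((f 1).re : ℂ) := Complex.ext (by simp) (by simp [h1])
    have e2 : f (star a * a) - (s : ℂ) * f a * star (f a) - star (s : ℂ) * star (f a) * f a +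
        star (s : ℂ) * star (f a) * ((s : ℂ) * f a) * f 1 =
        f (star a * a) + ((- 2 * s * ‖f a‖ ^ 2 + s ^ 2 * ‖f a‖ ^ 2 * (f 1).re : ℝ) : ℂ) := by
      rw [h5]
      push_cast
      push_cast at h4
      rw [← h6]
      linear_combination (-2 * (s : ℂ) + s ^ 2 * f 1) * h4
    rw [e2, Complex.add_re, Complex.ofReal_re] at h3
    linarith
  have hsq : ‖f a‖ ^ 2 ≤ ((f 1).re * ‖a‖) ^ 2 := by
    rcases h1'.eq_or_lt with h0 | h0
    · have := key 1
      rw [← h0] at this h2 ⊢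
      simp only [zero_mul] at h2 this ⊢
      nlinarith [sq_nonneg ‖f a‖]
    · have h3 := key (1 / (f 1).re)
      have h4 : 2 * (1 / (f 1).re) * ‖f a‖ ^ 2 = 2 * (‖f a‖ ^ 2 / (f 1).re) := by ring
      have h5 : (1 / (f 1).re) ^ 2 * ‖f a‖ ^ 2 * (f 1).re = ‖f a‖ ^ 2 / (f 1).re := by
        field_simp
      rw [h4, h5] at h3
      have h6 : ‖f a‖ ^ 2 / (f 1).re ≤ (f 1).re * ‖a‖ ^ 2 := by linarith
      rw [div_le_iff₀ h0] at h6
      calc _ ≤ _ := h6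
        _ = _ := by ring
  exact abs_le_of_sq_le_sq' hsq (by positivity) |>.2

/-- States, described as the functionals of norm at most one and value one at the unit. -/
def IsState (f : WeakDual ℂ A) : Prop := (∀ a, ‖f a‖ ≤ ‖a‖) ∧ f 1 = 1

theorem isState_of_nonneg {f : WeakDual ℂ A} (hf : ∀ a, 0 ≤ f (star a * a)) (h1 : f 1 = 1) :
    IsState f := by
  refine ⟨fun a => ?_, h1⟩
  have := norm_le_of_nonneg (f := (WeakDual.toStrongDual f).toLinearMap) hf a
  have h2 : (WeakDual.toStrongDual f).toLinearMap 1 = 1 := h1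
  rw [h2, Complex.one_re, one_mul] at this
  exact this

theorem IsTracialState.isState {τ : WeakDual ℂ A} (hτ : IsTracialState τ) : IsState τ :=
  isState_of_nonneg hτ.1 hτ.2.1

/-- For real `s`, `‖h + i s‖² ≤ ‖h‖² + s²`, whereas the value of `f` there has imaginary part `Im
f(h) + s`. The term linear in `s` would be unbounded if `Im f(h) ≠ 0`. -/
theorem IsState.im_eq_zero {f : WeakDual ℂ A} (hf : IsState f) {h : A} (hh : IsSelfAdjoint h) :
    (f h).im = 0 := by
  have key : ∀ s : ℝ, (f h).im ^ 2 + 2 * (f h).im * s ≤ ‖h‖ ^ 2 := by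
    intro s
    have h1 : ‖h + ((s : ℂ) * Complex.I) • 1‖ ^ 2 ≤ ‖h‖ ^ 2 + s ^ 2 := by
      rw [sq, ← CStarRing.norm_star_mul_self]
      have e : star (h + ((s : ℂ) * Complex.I) • (1 : A)) * (h + ((s : ℂ) * Complex.I) • (1 : A))
          = star h * h + ((s ^ 2 : ℝ) : ℂ) • 1 := by
        rw [star_add, star_smul, star_one, hh.star_eq, add_mul, mul_add, mul_add, mul_smul_comm,
          smul_mul_assoc, smul_mul_smul_comm]
        have e1 : star ((s : ℂ) * Complex.I) = -((s : ℂ) * Complex.I) := by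
          simp
        have e2 : -((s : ℂ) * Complex.I) * ((s : ℂ) * Complex.I) = ((s ^ 2 : ℝ) : ℂ) := by
          push_cast
          linear_combination (-(s : ℂ) ^ 2) * Complex.I_mul_I
        rw [e1, e2]
        simp only [mul_one, one_mul, neg_smul]
        abel
      rw [e]
      refine (norm_add_le _ _).trans (add_le_add ?_ ?_)
      · rw [CStarRing.norm_star_mul_self, sq]
      · rw [norm_smul, Complex.norm_real, Real.norm_of_nonneg (by positivity)]
        refine mul_le_of_le_one_right (by positivity) ?_
        rcases subsingleton_or_nontrivial A with h | h
        · rw [Subsingleton.elim (1 : A) 0, norm_zero]; exact zero_le_one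
        · exact (CStarRing.norm_one (E := A)).le
    have h2 := hf.1 (h + ((s : ℂ) * Complex.I) • 1)
    have h3 : ((f h).im + s) ^ 2 ≤ ‖f (h + ((s : ℂ) * Complex.I) • 1)‖ ^ 2 := by
      have h4 := Complex.abs_im_le_norm (f (h + ((s : ℂ) * Complex.I) • 1))
      have h5 : (f (h + ((s : ℂ) * Complex.I) • 1)).im = (f h).im + s := by
        rw [map_add, map_smul, hf.2]; simp
      rw [h5] at h4
      rw [← sq_abs]
      gcongr
    have h4 : ‖f (h + ((s : ℂ) * Complex.I) • 1)‖ ^ 2 ≤ ‖h + ((s : ℂ) * Complex.I) • 1‖ ^ 2 := by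
      gcongr
    nlinarith
  by_contra hne
  have h1 := key ((‖h‖ ^ 2 + 1) / (2 * (f h).im))
  have h2 : 2 * (f h).im * ((‖h‖ ^ 2 + 1) / (2 * (f h).im)) = ‖h‖ ^ 2 + 1 := by
    field_simp
  nlinarith [sq_nonneg (f h).im]

/-- The element `‖a‖² - a*a` is positive of norm at most `‖a‖²`, so `‖a‖² - f (a*a) ≤ ‖a‖²`. Thus
functionals obtained from Hahn–Banach, known only through norms, are positive. -/
theorem IsState.nonneg {f : WeakDual ℂ A} (hf : IsState f) (a : A) : 0 ≤ f (star a * a) := by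
  rw [Complex.nonneg_iff]
  refine ⟨?_, (hf.im_eq_zero (.star_mul_self a)).symm⟩
  let _ := CStarAlgebra.spectralOrder A
  have := CStarAlgebra.spectralOrderedRing A
  obtain ⟨b, hb⟩ := exists_star_mul_self_eq_sub a
  have h1 : ‖star b * b‖ ≤ ‖a‖ ^ 2 := by
    have h2 : star b * b ≤ ((‖a‖ ^ 2 : ℝ) : ℂ) • 1 := by
      rw [hb]; exact le_add_of_nonneg_left (star_mul_self_nonneg a)
    have h3 := CStarAlgebra.norm_le_norm_of_nonneg_of_le (star_mul_self_nonneg b) h2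
    refine h3.trans ?_
    rw [norm_smul, Complex.norm_real, Real.norm_of_nonneg (by positivity)]
    refine mul_le_of_le_one_right (by positivity) ?_
    rcases subsingleton_or_nontrivial A with h | h
    · rw [Subsingleton.elim (1 : A) 0, norm_zero]; exact zero_le_one
    · exact (CStarRing.norm_one (E := A)).le
  have h2 := (Complex.re_le_norm _).trans ((hf.1 (star b * b)).trans h1)
  have h3 : star b * b = ((‖a‖ ^ 2 : ℝ) : ℂ) • 1 - star a * a := by rw [hb]; abel
  rw [h3, map_sub, map_smul, hf.2] at h2
  simp only [smul_eq_mul, mul_one, Complex.sub_re, Complex.ofReal_re] at h2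
  linarith

theorem isClosed_isState : IsClosed {f : WeakDual ℂ A | IsState f} := by
  have : {f : WeakDual ℂ A | IsState f} = (⋂ a, {f | ‖f a‖ ≤ ‖a‖}) ∩ {f | f 1 = 1} := by
    ext f; simp [IsState]
  rw [this]
  exact (isClosed_iInter fun a => isClosed_le (WeakDual.eval_continuous a).norm
    continuous_const).inter (isClosed_eq (WeakDual.eval_continuous 1) continuous_const)

theorem isCompact_of_isState {S : Set (WeakDual ℂ A)} (hS : IsClosed S) (h : ∀ f ∈ S, IsState f) :
    IsCompact S := by
  refine (WeakDual.isCompact_closedBall (0 : StrongDual ℂ A) 1).of_isClosed_subset hS fun f hf => ?_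
  simp only [Set.mem_preimage, Metric.mem_closedBall, dist_zero_right]
  exact ContinuousLinearMap.opNorm_le_bound _ zero_le_one fun a => by
    rw [one_mul]; exact (h f hf).1 a

theorem isClosed_isTracialState : IsClosed {f : WeakDual ℂ A | IsTracialState f} := by
  have : {f : WeakDual ℂ A | IsTracialState f} = (⋂ a, {f | 0 ≤ f (star a * a)}) ∩
      ({f | f 1 = 1} ∩ ⋂ a, ⋂ b, {f | f (a * b) = f (b * a)}) := by
    ext f; simp [IsTracialState]
  rw [this]
  exact (isClosed_iInter fun a => isClosed_le continuous_const (WeakDual.eval_continuous _)).inter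
    ((isClosed_eq (WeakDual.eval_continuous 1) continuous_const).inter
      (isClosed_iInter fun a => isClosed_iInter fun b => isClosed_eq (WeakDual.eval_continuous _)
        (WeakDual.eval_continuous _)))

theorem weakDual_combo_apply (s t : ℝ) (f g : WeakDual ℂ A) (a : A) :
    (s • f + t • g) a = (s : ℂ) * f a + (t : ℂ) * g a := by
  change s • f a + t • g a = _
  rw [Complex.real_smul, Complex.real_smul]

theorem convex_isTracialState : Convex ℝ {f : WeakDual ℂ A | IsTracialState f} := by
  intro f hf g hg s t hs ht hst
  refine ⟨fun a => ?_, ?_, fun a b => ?_⟩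
  · rw [weakDual_combo_apply]
    exact add_nonneg (mul_nonneg (by exact_mod_cast hs) (hf.1 a))
      (mul_nonneg (by exact_mod_cast ht) (hg.1 a))
  · rw [weakDual_combo_apply, hf.2.1, hg.2.1]
    simp only [mul_one]
    exact_mod_cast hst
  · simp only [weakDual_combo_apply, hf.2.2 a b, hg.2.2 a b]

theorem convex_isState : Convex ℝ {f : WeakDual ℂ A | IsState f} := by
  intro f hf g hg s t hs ht hst
  refine ⟨fun a => ?_, ?_⟩
  · rw [weakDual_combo_apply]
    refine (norm_add_le _ _).trans ?_
    rw [norm_mul, norm_mul, Complex.norm_real, Complex.norm_real, Real.norm_of_nonneg hs,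
      Real.norm_of_nonneg ht]
    calc s * ‖f a‖ + t * ‖g a‖ ≤ s * ‖a‖ + t * ‖a‖ := by
          gcongr
          · exact hf.1 a
          · exact hg.1 a
      _ = ‖a‖ := by rw [← add_mul, hst, one_mul]
  · rw [weakDual_combo_apply, hf.2, hg.2]
    simp only [mul_one]
    exact_mod_cast hst

end States

/-! ### The set of MF-traces -/

section MFTraceSet

theorem isTracialState_of_tendsto {A : Type*} [NormedRing A] [StarRing A] [NormedAlgebra ℂ A]
    {I : Type*} {l : Filter I} [l.NeBot] {m : I → ℕ} {s : ∀ i, A →ₗ[ℂ] Mat (m i)}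
    (hs : IsAsympHom l s) (hm : ∀ᶠ i in l, 0 < m i) {τ : WeakDual ℂ A}
    (hτ : ∀ a, Tendsto (fun i => normTrace (m i) (s i a)) l (𝓝 (τ a))) : IsTracialState τ := by
  refine ⟨fun a => ?_, ?_, fun a b => ?_⟩
  · have h1 := ((hs.asymp_mul (star a) a).trans
      ((hs.asymp_star a).mul (.refl _) (hs.bdd a).conj (hs.bdd a))).symm.tendsto_normTrace (hτ _)
    exact ge_of_tendsto h1 (Eventually.of_forall fun i => normTrace_star_mul_self_nonneg _ _)
  · have h1 := hs.asymp_one.symm.tendsto_normTrace (hτ 1)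
    refine tendsto_nhds_unique h1 (tendsto_const_nhds.congr' ?_)
    filter_upwards [hm] with i hi
    rw [normTrace_one hi]
  · have h1 := (hs.asymp_mul a b).symm.tendsto_normTrace (hτ _)
    have h2 := (hs.asymp_mul b a).symm.tendsto_normTrace (hτ _)
    simp only [normTrace_mul_comm _ (s _ b)] at h2
    exact tendsto_nhds_unique h1 h2

theorem upperApprox_of_mem_MFTraces {A : Type u} [NormedRing A] [StarRing A] [NormedAlgebra ℂ A]
    {ι : Type*} {x : ι → A}
    {τ : WeakDual ℂ A} (hτ : τ ∈ MFTraces x) : UpperApprox x τ := by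
  obtain ⟨-, m, hm, T, hT⟩ := hτ
  intro F ε hε
  have hall : ∀ᶠ k in atTop, ∀ p ∈ F,
      ‖starEval (fun j => T j k) p‖ ≤ ‖starEval x p‖ + ε ∧
      ‖normTrace (m k) (starEval (fun j => T j k) p) - τ (starEval x p)‖ ≤ ε := by
    refine (Filter.eventually_all_finset _).2 fun p _ => ?_
    filter_upwards [(hT p).1.eventually (gt_mem_nhds (lt_add_of_pos_right _ hε)),
      Metric.tendsto_nhds.1 (hT p).2 ε hε] with k h1 h2
    rw [dist_eq_norm] at h2
    exact ⟨h1.le, h2.le⟩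
  obtain ⟨k, hk⟩ := hall.exists
  exact ⟨m k, hm k, _, hk⟩

variable {A : Type u} [CStarAlgebra A]

/-- Normalized traces of an asymptotic homomorphism converge along an ultrafilter. The ultrafilter
need not detect norms, since the criterion asks for upper bounds only. -/
theorem MFTraces_nonempty [Nontrivial A] (hA : IsMF A) {ι : Type*} [Finite ι] (x : ι → A) :
    (MFTraces x).Nonempty := by
  obtain ⟨r, s, hs, hlow⟩ := hA.exists_isAsympHom
  have hfreq : ∃ᶠ i in atTop, 0 < r i := by
    refine (hlow 1 0 (by rw [norm_one]; exact one_pos)).mono fun i hi => ?_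
    refine Nat.pos_of_ne_zero fun h0 => ?_
    rw [norm_mat_zero h0] at hi
    exact lt_irrefl _ hi
  -- Compressed matrices may have size `0` at some indices, so the ultrafilter is made to live on
  -- the indices of positive size.
  have hne : (atTop ⊓ 𝓟 {i | 0 < r i}).NeBot := inf_principal_neBot_iff.2 fun U hU =>
    (hfreq.and_eventually hU).exists.imp fun i hi => ⟨hi.2, hi.1⟩
  obtain ⟨U, hU⟩ := Ultrafilter.exists_le (atTop ⊓ 𝓟 {i | 0 < r i})
  have hs' : IsAsympHom (U : Filter ℕ) s := hs.mono (hU.trans inf_le_left)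
  have hr : ∀ᶠ i in (U : Filter ℕ), 0 < r i := (hU.trans inf_le_right) (mem_principal_self _)
  have hlim : ∀ a, ∃ z : ℂ, ‖z‖ ≤ ‖a‖ + 1 ∧
      Tendsto (fun i => normTrace (r i) (s i a)) U (𝓝 z) := by
    intro a
    obtain ⟨z, hz, hz'⟩ := (isCompact_closedBall (0 : ℂ) (‖a‖ + 1)).ultrafilter_le_nhds
      (U.map (fun i => normTrace (r i) (s i a))) (by
        rw [le_principal_iff]
        refine Filter.mem_map.2 ?_
        filter_upwards [hs'.contractive a 1 one_pos] with i hi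
        simpa using (norm_normTrace_le _ _).trans hi)
    exact ⟨z, by simpa using hz, hz'⟩
  choose f hfb hf using hlim
  have hfn : ∀ a, ‖f a‖ ≤ 1 * ‖a‖ := fun a => by
    rw [one_mul]
    refine le_of_forall_pos_le_add fun ε hε => ?_
    refine le_of_tendsto (hf a).norm ?_
    filter_upwards [hs'.contractive a ε hε] with i hi using (norm_normTrace_le _ _).trans hi
  let g : A →ₗ[ℂ] ℂ :=
    { toFun := f
      map_add' := fun a b => tendsto_nhds_unique (hf (a + b)) (by
        simpa only [map_add, normTrace_add] using (hf a).add (hf b))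
      map_smul' := fun c a => tendsto_nhds_unique (hf (c • a)) (by
        simpa only [map_smul, normTrace_smul, RingHom.id_apply, smul_eq_mul] using (hf a).const_mul c) }
  let τ : WeakDual ℂ A := StrongDual.toWeakDual (g.mkContinuous 1 hfn)
  have hτ : ∀ a, Tendsto (fun i => normTrace (r i) (s i a)) U (𝓝 (τ a)) := hf
  have htr : IsTracialState τ := isTracialState_of_tendsto hs' hr hτ
  exact ⟨τ, mem_MFTraces_of_upperApprox hA htr (hs'.upperApprox hs'.contractive htr.2.1 hτ x)⟩

/-- Multiples of matrix models for the two traces are added directly, with relative dimensions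
approximating the coefficients; the norms become maxima and keep their upper bounds. -/
theorem convex_MFTraces (hA : IsMF A) {ι : Type*} [Finite ι] (x : ι → A) :
    Convex ℝ (MFTraces x) := by
  intro τ hτ σ hσ t t' ht ht' htt
  refine mem_MFTraces_of_upperApprox hA (convex_isTracialState hτ.1 hσ.1 ht ht' htt) ?_
  intro F ε hε
  obtain ⟨M, hM, hM0⟩ : ∃ M : ℝ, (∀ p ∈ F, ‖starEval x p‖ ≤ M) ∧ 0 ≤ M :=
    ⟨∑ p ∈ F, ‖starEval x p‖, fun p hp => Finset.single_le_sum
      (f := fun p => ‖starEval x p‖) (fun _ _ => norm_nonneg _) hp,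
      Finset.sum_nonneg fun _ _ => norm_nonneg _⟩
  obtain ⟨m, hm, T, hT⟩ := upperApprox_of_mem_MFTraces hτ F (ε / 2) (by positivity)
  obtain ⟨n, hn, S, hS⟩ := upperApprox_of_mem_MFTraces hσ F (ε / 2) (by positivity)
  obtain ⟨k, hk, U, hU⟩ := exists_convex_combination hm hn T S ht (by linarith)
    (show 0 < (ε / 2) / (2 * M + ε) by positivity)
  refine ⟨k, hk, U, fun p hp => ?_⟩
  obtain ⟨h1, h2⟩ := hU p
  obtain ⟨h3, h4⟩ := hT p hp
  obtain ⟨h5, h6⟩ := hS p hp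
  have h7 := hM p hp
  refine ⟨?_, ?_⟩
  · rw [h1]
    exact max_le (by linarith) (by linarith)
  · have h8 : (ε / 2) / (2 * M + ε) * (‖starEval T p‖ + ‖starEval S p‖) ≤ ε / 2 := by
      rw [div_mul_eq_mul_div, div_le_iff₀ (by positivity)]
      exact mul_le_mul_of_nonneg_left (by linarith) (by positivity)
    have e : normTrace k (starEval U p) - (t • τ + t' • σ) (starEval x p) =
        (normTrace k (starEval U p) - ((t : ℂ) * normTrace m (starEval T p) +
        (1 - t) * normTrace n (starEval S p))) +
        ((t : ℂ) * (normTrace m (starEval T p) - τ (starEval x p)) +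
        (t' : ℂ) * (normTrace n (starEval S p) - σ (starEval x p))) := by
      rw [weakDual_combo_apply]
      have : (t' : ℂ) = 1 - t := by
        rw [eq_sub_iff_add_eq']; exact_mod_cast htt
      rw [this]; ring
    rw [e]
    have h9 : ‖(t : ℂ) * (normTrace m (starEval T p) - τ (starEval x p)) +
        (t' : ℂ) * (normTrace n (starEval S p) - σ (starEval x p))‖ ≤ ε / 2 := by
      refine (norm_add_le _ _).trans ?_
      rw [norm_mul, norm_mul, Complex.norm_real, Complex.norm_real, Real.norm_of_nonneg ht,
        Real.norm_of_nonneg ht']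
      calc _ ≤ t * (ε / 2) + t' * (ε / 2) := by gcongr
        _ = ε / 2 := by rw [← add_mul, htt, one_mul]
    exact (norm_add_le _ _).trans (by linarith)

/-- The local criterion involves finitely many values of the trace, and these are nearly shared by
some MF-trace in a weak* neighbourhood. -/
theorem isClosed_MFTraces (hA : IsMF A) {ι : Type*} [Finite ι] (x : ι → A) :
    IsClosed (MFTraces x) := by
  refine isClosed_of_closure_subset fun τ hτ => ?_
  have htr : IsTracialState τ :=
    closure_minimal (fun σ hσ => hσ.1) isClosed_isTracialState hτ
  refine mem_MFTraces_of_upperApprox hA htr fun F ε hε => ?_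
  have hU : {σ : WeakDual ℂ A | ∀ p ∈ F, ‖σ (starEval x p) - τ (starEval x p)‖ < ε / 2} ∈ 𝓝 τ := by
    refine (Filter.eventually_all_finset _).2 fun p _ => ?_
    have h1 := (WeakDual.eval_continuous (𝕜 := ℂ) (starEval x p)).tendsto τ
    filter_upwards [Metric.tendsto_nhds.1 h1 (ε / 2) (half_pos hε)] with σ hσ
    rwa [dist_eq_norm] at hσ
  obtain ⟨σ, hσU, hσ⟩ := mem_closure_iff_nhds.1 hτ _ hU
  obtain ⟨m, hm, T, hT⟩ := upperApprox_of_mem_MFTraces hσ F (ε / 2) (half_pos hε)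
  refine ⟨m, hm, T, fun p hp => ⟨(hT p hp).1.trans (by linarith), ?_⟩⟩
  have h1 := norm_sub_le_norm_sub_add_norm_sub (normTrace m (starEval T p)) (σ (starEval x p))
    (τ (starEval x p))
  have h2 := hσU p hp
  linarith [(hT p hp).2]

theorem isCompact_MFTraces (hA : IsMF A) {ι : Type*} [Finite ι] (x : ι → A) :
    IsCompact (MFTraces x) :=
  isCompact_of_isState (isClosed_MFTraces hA x) fun _ h => h.1.isState

end MFTraceSet

/-! ### Traces on quotients, subalgebras, and ultraproducts -/

section Functoriality

variable {A : Type u} [CStarAlgebra A]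

theorem isTracialState_compRange {C : Type v} [CStarAlgebra C] (π : A →⋆ₐ[ℂ] C)
    {φ : WeakDual ℂ π.range} (hφ : IsTracialState φ) : IsTracialState (compRange π φ) := by
  have e : ∀ a, compRange π φ a = φ (π.rangeRestrict a) := fun _ => rfl
  refine ⟨fun a => ?_, ?_, fun a b => ?_⟩
  · rw [e, map_mul π.rangeRestrict, map_star]
    exact hφ.1 _
  · rw [e, map_one]
    exact hφ.2.1
  · rw [e, e, map_mul π.rangeRestrict, map_mul π.rangeRestrict]
    exact hφ.2.2 _ _

/-- Since `π` is contractive, a matrix model for the elements `π (x i)` satisfies the upper norm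
bounds required for `x`. Independence of generators permits this family in place of `y`. -/
theorem compRange_mem_MFTraces (hA : IsMF A) {ι : Type*} [Finite ι] (x : ι → A) {C : Type v}
    [CStarAlgebra C] (π : A →⋆ₐ[ℂ] C) {κ : Type*} {y : κ → π.range} (hy : Generates y)
    {φ : WeakDual ℂ π.range} (hφ : φ ∈ MFTraces y) : compRange π φ ∈ MFTraces x := by
  have h1 := upperApprox_of_mem_MFTraces (mem_MFTraces_of_generates hy hφ
    fun i => π.rangeRestrict (x i))
  refine mem_MFTraces_of_upperApprox hA (isTracialState_compRange π hφ.1) fun F ε hε => ?_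
  obtain ⟨m, hm, T, hT⟩ := h1 F ε hε
  refine ⟨m, hm, T, fun p hp => ⟨(hT p hp).1.trans ?_, ?_⟩⟩
  · rw [← map_starEval]
    gcongr
    exact NonUnitalStarAlgHom.norm_apply_le π _
  · have := (hT p hp).2
    rwa [← map_starEval] at this

/-- A matrix model of `φ` for the family `y`, viewed in `A`, is already one for the restriction,
because norms and values of *-polynomials in `y` are the same in `B`. -/
theorem restrictTo_mem_MFTraces {ι : Type*} {x : ι → A} (hx : Generates x)
    (B : StarSubalgebra ℂ A) {κ : Type*} (y : κ → B) {φ : WeakDual ℂ A} (hφ : φ ∈ MFTraces x) :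
    restrictTo B φ ∈ MFTraces y := by
  have h1 := mem_MFTraces_of_generates hx hφ fun k => (y k : A)
  obtain ⟨htr, m, hm, T, hT⟩ := h1
  have e : ∀ b : B, restrictTo B φ b = φ b := fun _ => rfl
  refine ⟨⟨fun a => ?_, ?_, fun a b => ?_⟩, m, hm, T, fun p => ?_⟩
  · rw [e]; exact htr.1 _
  · rw [e]; exact htr.2.1
  · rw [e, e]; exact htr.2.2 _ _
  · have h2 : starEval (fun k => (y k : A)) p = (starEval y p : B) :=
      (map_starEval B.subtype y p).symm
    have h3 := hT p
    rw [h2] at h3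
    exact h3

end Functoriality

/-! ### Traces from ultraproducts -/

section Ultraproduct

theorem tendsto_ultraTrace (α : Ultrafilter ℕ) (a : boundedProd (fun k => k + 1)) :
    Tendsto (fun k => normTrace (k + 1) (a.1 k)) α
      (𝓝 (ultraTrace α (MatQuot.mk _ (α : Filter ℕ) a))) := by
  obtain ⟨C, hC⟩ := a.2
  obtain ⟨z, -, hz⟩ := (isCompact_closedBall (0 : ℂ) C).ultrafilter_le_nhds
    (α.map (fun k => normTrace (k + 1) (a.1 k))) (by
      rw [le_principal_iff]
      refine Filter.mem_map.2 (Filter.univ_mem' fun k => ?_)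
      simpa using (norm_normTrace_le (k + 1) (a.1 k)).trans (hC k))
  exact tendsto_nhds_limUnder ⟨z, hz⟩

variable {A : Type u} [CStarAlgebra A]

theorem mem_MFTraces_of_ultraproduct (hA : IsMF A) {ι : Type*} [Finite ι] (x : ι → A)
    {ψ : WeakDual ℂ A} (hψ : IsTracialState ψ) (α : Ultrafilter ℕ)
    (π : A →⋆ₐ[ℂ] MatUltraproduct α) (h : ∀ a, ψ a = ultraTrace α (π a)) : ψ ∈ MFTraces x := by
  obtain ⟨σ, hσ, hs⟩ := exists_isAsympHom_of_hom π
  refine mem_MFTraces_of_upperApprox hA hψ (hs.upperApprox hs.contractive hψ.2.1 (fun a => ?_) x)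
  have := tendsto_ultraTrace α (σ a)
  rw [hσ, ← h] at this
  exact this

/-- Matrices of size `m` embed into matrices of any larger size divisible by `m`. -/
theorem exists_amplification {m n : ℕ} (hn : 0 < n) (h : m ∣ n) :
    ∃ f : Mat m →⋆ₐ[ℂ] Mat n, (∀ a, ‖f a‖ = ‖a‖) ∧ ∀ a, normTrace n (f a) = normTrace m a := by
  obtain ⟨N, rfl⟩ := h
  have hN : 0 < N := Nat.pos_of_mul_pos_left hn
  exact ⟨kronLeft m N, norm_kronLeft hN, normTrace_kronLeft hN⟩

/-- A dependent function can be prescribed along an injective map. -/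
theorem exists_extend_injective {β : ℕ → Type*} (e : ℕ → ℕ) (he : Function.Injective e)
    (f : ∀ k, β (e k)) (g : ∀ j, β j) : ∃ F : ∀ j, β j, (∀ k, F (e k) = f k) ∧
      ∀ j, (∀ k, e k ≠ j) → F j = g j := by
  classical
  refine ⟨fun j => if h : ∃ k, e k = j then h.choose_spec ▸ f h.choose else g j, fun k => ?_,
    fun j hj => ?_⟩
  · have key : ∀ k' (h : e k' = e k), (h ▸ f k' : β (e k)) = f k := by
      intro k' h
      obtain rfl := he h
      rfl
    have h : ∃ k', e k' = e k := ⟨k, rfl⟩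
    simp only [dif_pos h]
    exact key _ h.choose_spec
  · have : ¬ ∃ k, e k = j := fun ⟨k, hk⟩ => hj k hk
    simp only [dif_neg this]

/-- The sizes of a matrix model may repeat, while the ultraproduct has one algebra of each size.
Amplification preserves norms and normalized traces, so the model can be moved to strictly
increasing sizes; at the remaining indices the maps are zero, and the ultrafilter ignores those. -/
theorem exists_ultraproduct_of_mem_MFTraces {ι : Type*} {x : ι → A} (hx : Generates x)
    {ψ : WeakDual ℂ A} (hψ : ψ ∈ MFTraces x) :
    ∃ α : Ultrafilter ℕ, (α : Filter ℕ) ≤ Filter.cofinite ∧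
      ∃ π : A →⋆ₐ[ℂ] MatUltraproduct α, ∀ a, ψ a = ultraTrace α (π a) := by
  obtain ⟨m, hm, s, hs, hsl⟩ := exists_isAsympHom_of_mem_MFTraces hx hψ
  -- The product makes `M k` a multiple of `m k`; the factor `k + 1` makes `M` strictly increasing.
  let M : ℕ → ℕ := fun k => (k + 1) * ∏ j ∈ Finset.range (k + 1), m j
  have hprod : ∀ k, 0 < ∏ j ∈ Finset.range (k + 1), m j := fun k =>
    Finset.prod_pos fun j _ => hm j
  have hM : StrictMono M := by
    refine strictMono_nat_of_lt_succ fun k => ?_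
    simp only [M]
    rw [Finset.prod_range_succ _ (k + 1)]
    have h1 := hprod k
    have h2 := hm (k + 1)
    calc (k + 1) * ∏ j ∈ Finset.range (k + 1), m j
        < (k + 1 + 1) * ∏ j ∈ Finset.range (k + 1), m j := by gcongr; omega
      _ ≤ _ := by
        gcongr
        exact Nat.le_mul_of_pos_right _ h2
  have hM0 : ∀ k, 0 < M k := fun k => Nat.mul_pos k.succ_pos (hprod k)
  -- The algebra with index `j` consists of matrices of size `j + 1`.
  let e : ℕ → ℕ := fun k => M k - 1
  have heM : ∀ k, e k + 1 = M k := fun k => Nat.sub_add_cancel (hM0 k)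
  have he : Function.Injective e := fun i j hij => hM.injective (by rw [← heM, ← heM, hij])
  have hdvd : ∀ k, m k ∣ e k + 1 := fun k => by
    rw [heM]
    exact (Finset.dvd_prod_of_mem m (Finset.self_mem_range_succ k)).mul_left _
  choose f hfn hft using fun k => exists_amplification (Nat.succ_pos (e k)) (hdvd k)
  obtain ⟨u, hu, hu0⟩ := exists_extend_injective (β := fun j => A →ₗ[ℂ] Mat (j + 1)) e he
    (fun k => (f k : Mat (m k) →ₗ[ℂ] Mat (e k + 1)) ∘ₗ s k) (fun j => 0)
  have hu' : ∀ k a, u (e k) a = f k (s k a) := fun k a => by rw [hu]; rfl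
  have hbd : ∀ a, ∃ C : ℝ, ∀ j, ‖u j a‖ ≤ C := by
    intro a
    obtain ⟨C, hC⟩ := (hsl a).1.bddAbove_range
    refine ⟨max C 0, fun j => ?_⟩
    by_cases hj : ∃ k, e k = j
    · obtain ⟨k, rfl⟩ := hj
      rw [hu', hfn]
      exact (hC ⟨k, rfl⟩).trans (le_max_left _ _)
    · push Not at hj
      rw [hu0 j hj]
      simp
  -- The image ultrafilter is concentrated on the range of `e`, and it is free because `e` is
  -- injective.
  let α : Ultrafilter ℕ := (Filter.hyperfilter ℕ).map e
  have hyp : (Filter.hyperfilter ℕ : Filter ℕ) ≤ atTop := Nat.hyperfilter_le_atTop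
  have hα : (α : Filter ℕ) ≤ Filter.cofinite := by
    have h1 : Tendsto e (Filter.hyperfilter ℕ) Filter.cofinite :=
      he.tendsto_cofinite.mono_left Filter.hyperfilter_le_cofinite
    exact h1
  have lift : ∀ c d : ∀ j, Mat (j + 1), AsympEq atTop (fun k => c (e k)) (fun k => d (e k)) →
      AsympEq (α : Filter ℕ) c d := fun c d h => Filter.tendsto_map'_iff.2 (h.mono_left hyp)
  have transfer : ∀ c d : ∀ k, Mat (m k), AsympEq atTop c d →
      AsympEq atTop (fun k => f k (c k)) (fun k => f k (d k)) := fun c d h =>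
    .of_le h fun k => by rw [← map_sub, hfn]
  let b : A → boundedProd (fun k => k + 1) := fun a => ⟨fun j => u j a, hbd a⟩
  have hone : MatQuot.mk _ (α : Filter ℕ) (b 1) = 1 := by
    refine MatQuot.mk_eq_mk (b := 1) |>.2 (lift _ _ ?_)
    refine AsympEq.trans (.of_eq fun k => hu' k 1) ((transfer _ _ hs.asymp_one).trans
      (.of_eq fun k => map_one _))
  let π : A →⋆ₐ[ℂ] MatUltraproduct α :=
    { toFun := fun a => MatQuot.mk _ (α : Filter ℕ) (b a)
      map_one' := hone
      map_mul' := fun a a' => MatQuot.mk_eq_mk (b := b a * b a') |>.2 (lift _ _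
        (AsympEq.trans (.of_eq fun k => hu' k _) ((transfer _ _ (hs.asymp_mul a a')).trans
          (.of_eq fun k => by
            rw [map_mul, ← hu', ← hu']
            rfl))))
      map_zero' := congrArg (MatQuot.mk _ (α : Filter ℕ))
        (Subtype.ext (funext fun j => map_zero (u j)))
      map_add' := fun a a' => congrArg (MatQuot.mk _ (α : Filter ℕ))
        (Subtype.ext (funext fun j => map_add (u j) a a'))
      commutes' := fun r => by
        rw [Algebra.algebraMap_eq_smul_one, Algebra.algebraMap_eq_smul_one, ← hone]
        exact congrArg (MatQuot.mk _ (α : Filter ℕ))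
          (Subtype.ext (funext fun j => map_smul (u j) r 1))
      map_star' := fun a => MatQuot.mk_eq_mk (b := star (b a)) |>.2 (lift _ _
        (AsympEq.trans (.of_eq fun k => hu' k _) ((transfer _ _ (hs.asymp_star a)).trans
          (.of_eq fun k => by
            rw [map_star, ← hu']
            rfl)))) }
  refine ⟨α, hα, π, fun a => ?_⟩
  have h1 := tendsto_ultraTrace α (b a)
  have h2 : Tendsto (fun j => normTrace (j + 1) ((b a).1 j)) α (𝓝 (ψ a)) := by
    refine Filter.tendsto_map'_iff.2 (((hsl a).2.mono_left hyp).congr fun k => ?_)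
    change _ = normTrace (e k + 1) (u (e k) a)
    rw [hu', hft]
  exact tendsto_nhds_unique h2 h1

end Ultraproduct

/-! ### Finite-dimensional traces -/

section FiniteDimensionalTraces

/-- The Gelfand–Naimark–Segal representation of a state. -/
theorem IsState.exists_gns {A : Type u} [CStarAlgebra A] {φ : WeakDual ℂ A} (hφ : IsState φ) :
    ∃ (H : Type u) (_ : NormedAddCommGroup H) (_ : InnerProductSpace ℂ H) (_ : CompleteSpace H)
      (π : A →⋆ₐ[ℂ] (H →L[ℂ] H)) (j : A →ₗ[ℂ] H), DenseRange j ∧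
      (∀ a b, inner ℂ (j a) (j b) = φ (star a * b)) ∧ ∀ a b, π a (j b) = j (a * b) := by
  let _ := CStarAlgebra.spectralOrder A
  have := CStarAlgebra.spectralOrderedRing A
  let f : A →ₚ[ℂ] ℂ := PositiveLinearMap.mk₀ (WeakDual.toStrongDual φ).toLinearMap fun a ha => by
    obtain ⟨b, rfl⟩ := CStarAlgebra.nonneg_iff_eq_star_mul_self.1 ha
    exact hφ.nonneg b
  refine ⟨f.GNS, inferInstance, inferInstance, inferInstance, f.gnsStarAlgHom,
    (UniformSpace.Completion.toComplL (𝕜 := ℂ) (E := f.PreGNS)).toLinearMap ∘ₗ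
      f.toPreGNS.toLinearMap, ?_, fun a b => ?_, fun a b => ?_⟩
  · exact UniformSpace.Completion.denseRange_coe.comp f.toPreGNS.surjective.denseRange
      (UniformSpace.Completion.continuous_coe _)
  · exact UniformSpace.Completion.inner_coe (f.toPreGNS a) (f.toPreGNS b)
  · exact f.gnsNonUnitalStarAlgHom_apply_coe

theorem isTracialState_normTrace_comp {D : Type*} [CStarAlgebra D] {n : ℕ} (hn : 0 < n)
    (L : D →⋆ₐ[ℂ] Mat n) {σ : WeakDual ℂ D} (hσ : ∀ d, σ d = normTrace n (L d)) :
    IsTracialState σ := by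
  refine ⟨fun a => ?_, ?_, fun a b => ?_⟩
  · rw [hσ, map_mul, map_star]
    exact normTrace_star_mul_self_nonneg _ _
  · rw [hσ, map_one, normTrace_one hn]
  · rw [hσ, hσ, map_mul, map_mul, normTrace_mul_comm]

/-- The Krein–Milman theorem in the weak* topology. -/
theorem subset_of_extremePoints_subset {E : Type*} [NormedRing E] [NormedAlgebra ℂ E]
    {K S : Set (WeakDual ℂ E)} (hK : IsCompact K) (hKc : Convex ℝ K) (hS : IsClosed S)
    (hSc : Convex ℝ S) (h : K.extremePoints ℝ ⊆ S) : K ⊆ S := by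
  have hlc : LocallyConvexSpace ℝ (WeakDual ℂ E) :=
    WeakBilin.locallyConvexSpace (B := topDualPairing ℂ E)
  have hKM := @closure_convexHull_extremePoints (WeakDual ℂ E) _ (WeakDual.instModule' ℝ) _ _ _
    ⟨WeakDual.continuous_of_continuous_eval fun a =>
      continuous_fst.smul ((WeakDual.eval_continuous a).comp continuous_snd)⟩ hlc K hK hKc
  rw [← hKM]
  exact closure_minimal (convexHull_min h hSc) hS

/-- On a finite-dimensional C*-algebra, every extreme tracial state is the normalized trace in a
matrix representation. -/
theorem exists_normTrace_eq_of_extreme {D : Type v} [CStarAlgebra D] [FiniteDimensional ℂ D]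
    {ρ : WeakDual ℂ D}
    (hρ : ρ ∈ ({f : WeakDual ℂ D | IsTracialState f}).extremePoints ℝ) :
    ∃ n, 0 < n ∧ ∃ L : D →⋆ₐ[ℂ] Mat n, ∀ d, ρ d = normTrace n (L d) := by
  have htr : IsTracialState ρ := hρ.1
  obtain ⟨H, _, _, _, π, j, hj, hin, hπ⟩ := htr.isState.exists_gns
  -- The dense range of `j` is finite-dimensional, hence closed, so every vector of the GNS space
  -- comes from an element of `D`.
  have hjs : Function.Surjective j := by
    rw [← LinearMap.range_eq_top]
    have h1 : IsClosed (LinearMap.range j : Set H) := Submodule.closed_of_finiteDimensional _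
    have h2 : Dense (LinearMap.range j : Set H) := hj
    exact SetLike.coe_injective (h1.closure_eq.symm.trans h2.closure_eq)
  have : FiniteDimensional ℂ H := Module.Finite.of_surjective j hjs
  have : Nontrivial H := by
    refine ⟨j 1, 0, fun h => ?_⟩
    have h1 := hin 1 1
    rw [h, inner_zero_left, star_one, one_mul, htr.2.1] at h1
    exact zero_ne_one h1
  set n := Module.finrank ℂ H
  have hn : 0 < n := Module.finrank_pos
  let e : OrthonormalBasis (Fin n) ℂ H := stdOrthonormalBasis ℂ H
  have hent : ∀ (T : H →L[ℂ] H) p q,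
      LinearMap.toMatrixOrthonormal e T.toLinearMap p q = inner ℂ (e p) (T (e q)) :=
    fun T p q => LinearMap.toMatrixOrthonormal_apply_apply e _ p q
  let L : D →⋆ₐ[ℂ] Mat n :=
    { toFun := fun d => LinearMap.toMatrixOrthonormal e (π d).toLinearMap
      map_one' := by
        rw [map_one]; exact map_one (LinearMap.toMatrixOrthonormal e)
      map_mul' := fun a b => by
        rw [map_mul]; exact map_mul (LinearMap.toMatrixOrthonormal e) _ _
      map_zero' := by
        rw [map_zero]; exact map_zero (LinearMap.toMatrixOrthonormal e)
      map_add' := fun a b => by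
        rw [map_add]; exact map_add (LinearMap.toMatrixOrthonormal e) _ _
      commutes' := fun r => by
        rw [Algebra.algebraMap_eq_smul_one, map_smul, map_one, Algebra.algebraMap_eq_smul_one]
        ext p q
        rw [hent, Matrix.smul_apply, _root_.smul_apply, inner_smul_right,
          one_apply_eq_self, e.inner_eq_ite, Matrix.one_apply, smul_eq_mul]
      map_star' := fun a => by
        ext p q
        rw [Matrix.star_apply, hent, hent, map_star, ContinuousLinearMap.star_eq_adjoint,
          ContinuousLinearMap.adjoint_inner_right, ← inner_conj_symm]
        rfl }
  have hLent : ∀ d p q, L d p q = inner ℂ (e p) (π d (e q)) := fun d p q => hent (π d) p q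
  let σl : D →ₗ[ℂ] ℂ :=
    { toFun := fun d => normTrace n (L d)
      map_add' := fun a b => by rw [map_add, normTrace_add]
      map_smul' := fun r a => by rw [map_smul, normTrace_smul]; rfl }
  let σ : WeakDual ℂ D := StrongDual.toWeakDual (LinearMap.toContinuousLinearMap σl)
  have hσ : ∀ d, σ d = normTrace n (L d) := fun _ => rfl
  have hσt := isTracialState_normTrace_comp hn L hσ
  choose d hd using fun i => hjs (e i)
  -- The trace `σ` is dominated by a multiple of `ρ`: if `e i = j (d i)`, the `i`-th diagonal entry
  -- at `a* a` is `ρ (dᵢ* a* a dᵢ) = ρ (a dᵢ dᵢ* a*) ≤ ‖dᵢ‖² ρ (a* a)`. The added ones ensure `C >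
  -- 1`.
  obtain ⟨C, hC1, hC⟩ : ∃ C : ℝ, 1 < C ∧ ∀ a, σ (star a * a) ≤ (C : ℂ) * ρ (star a * a) := by
    refine ⟨1 + (n : ℝ)⁻¹ * ∑ i, ‖d i‖ ^ 2 + 1, ?_, fun a => ?_⟩
    · have : 0 ≤ (n : ℝ)⁻¹ * ∑ i, ‖d i‖ ^ 2 := by positivity
      linarith
    have hterm : ∀ i, L (star a * a) i i ≤ ((‖d i‖ ^ 2 : ℝ) : ℂ) * ρ (star a * a) := by
      intro i
      rw [hLent, ← hd, hπ, hin]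
      obtain ⟨b, hb⟩ := exists_star_mul_self_eq_sub (star (d i))
      have h1 : ρ (star (d i) * (star a * a * d i)) = ρ (a * (d i * star (d i)) * star a) := by
        rw [show star (d i) * (star a * a * d i) = (star (d i) * star a) * (a * d i) by
          noncomm_ring, htr.2.2]
        congr 1; noncomm_ring
      have h2 : ρ (a * star a) = ρ (star a * a) := htr.2.2 _ _
      have h3 := htr.1 (b * star a)
      have h4 : star (b * star a) * (b * star a) =
          ((‖d i‖ ^ 2 : ℝ) : ℂ) • (a * star a) - a * (d i * star (d i)) * star a := by
        rw [norm_star, star_star] at hb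
        have : star b * b = ((‖d i‖ ^ 2 : ℝ) : ℂ) • (1 : D) - d i * star (d i) := by
          rw [hb]; abel
        rw [star_mul, star_star, show a * star b * (b * star a) = a * (star b * b) * star a by
          noncomm_ring, this, mul_sub, sub_mul, mul_smul_comm, mul_one, smul_mul_assoc]
      rw [h4, map_sub, map_smul, h2, smul_eq_mul, sub_nonneg] at h3
      rw [h1]
      exact h3
    have h5 : σ (star a * a) ≤ (((n : ℝ)⁻¹ * ∑ i, ‖d i‖ ^ 2 : ℝ) : ℂ) * ρ (star a * a) := by
      rw [hσ]
      calc (n : ℂ)⁻¹ * ∑ i, L (star a * a) i i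
          ≤ (n : ℂ)⁻¹ * ∑ i, ((‖d i‖ ^ 2 : ℝ) : ℂ) * ρ (star a * a) := by
            refine mul_le_mul_of_nonneg_left (Finset.sum_le_sum fun i _ => hterm i) ?_
            simp
        _ = _ := by
            rw [← Finset.sum_mul]; push_cast; ring
    refine h5.trans (mul_le_mul_of_nonneg_right ?_ (htr.1 a))
    exact_mod_cast (by linarith :
      (n : ℝ)⁻¹ * ∑ i, ‖d i‖ ^ 2 ≤ 1 + (n : ℝ)⁻¹ * ∑ i, ‖d i‖ ^ 2 + 1)
  have hC0 : (C : ℂ) - 1 ≠ 0 := by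
    exact_mod_cast (by linarith : (0 : ℝ) < C - 1).ne'
  have hCne : (C : ℂ) ≠ 0 := by exact_mod_cast (by linarith : (0 : ℝ) < C).ne'
  -- This is the tracial state that completes `σ`, with weight `C⁻¹`, to the convex combination `ρ`.
  let θ : WeakDual ℂ D := ((C : ℂ) - 1)⁻¹ • ((C : ℂ) • ρ - σ)
  have hθ : ∀ a, θ a = ((C : ℂ) - 1)⁻¹ * (C * ρ a - σ a) := fun _ => rfl
  have hθt : IsTracialState θ := by
    refine ⟨fun a => ?_, ?_, fun a b => ?_⟩
    · rw [hθ]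
      refine mul_nonneg ?_ (sub_nonneg.2 (hC a))
      have : (0 : ℂ) ≤ (((C - 1)⁻¹ : ℝ) : ℂ) := by
        exact_mod_cast (inv_nonneg.2 (by linarith : (0 : ℝ) ≤ C - 1))
      simpa using this
    · rw [hθ, htr.2.1, hσt.2.1, mul_one, inv_mul_cancel₀ hC0]
    · rw [hθ, hθ, htr.2.2, hσt.2.2]
  have hseg : ρ ∈ openSegment ℝ σ θ := by
    refine ⟨C⁻¹, 1 - C⁻¹, by positivity, ?_, by ring, ?_⟩
    · rw [sub_pos]; exact inv_lt_one_of_one_lt₀ hC1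
    · refine DFunLike.ext _ _ fun a => ?_
      rw [weakDual_combo_apply, hθ]
      push_cast
      field_simp
      ring
  have hext : σ = ρ := hρ.2 hσt hθt hseg
  exact ⟨n, hn, L, fun a => by rw [← hext, hσ]⟩

/-- Pulling back along `π` is affine and weak* continuous, so the traces of `D` whose pullbacks are
MF-traces form a closed convex set. By Krein–Milman only extreme traces matter; for them one matrix
representation, used for all polynomials and all ε, satisfies the criterion. -/
theorem mem_MFTraces_of_isFiniteDimensionalTrace {A : Type u} [CStarAlgebra A] (hA : IsMF A)
    {ι : Type*} [Finite ι] (x : ι → A) {τ : WeakDual ℂ A}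
    (h : IsFiniteDimensionalTrace.{v} τ) : τ ∈ MFTraces x := by
  obtain ⟨D, _, _, ρ, π, hρ, hτ⟩ := h
  let P : WeakDual ℂ D → WeakDual ℂ A := fun ρ => StrongDual.toWeakDual
    ((WeakDual.toStrongDual ρ).comp ⟨π.toAlgHom.toLinearMap,
      AddMonoidHomClass.continuous_of_bound π 1 fun a => by
        simpa using NonUnitalStarAlgHom.norm_apply_le π a⟩)
  have hP : ∀ ρ a, P ρ a = ρ (π a) := fun _ _ => rfl
  have hPc : Continuous P := WeakDual.continuous_of_continuous_eval fun a =>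
    WeakDual.eval_continuous (π a)
  have hcl : IsClosed (P ⁻¹' MFTraces x) := (isClosed_MFTraces hA x).preimage hPc
  have hco : Convex ℝ (P ⁻¹' MFTraces x) := by
    intro f hf g hg s t hs ht hst
    have : P (s • f + t • g) = s • P f + t • P g := by
      refine DFunLike.ext _ _ fun a => ?_
      rw [hP, weakDual_combo_apply, weakDual_combo_apply, hP, hP]
    rw [Set.mem_preimage, this]
    exact convex_MFTraces hA x hf hg hs ht hst
  have hτ' : τ = P ρ := DFunLike.ext _ _ hτ
  rw [hτ']
  refine subset_of_extremePoints_subset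
    (isCompact_of_isState (isClosed_isTracialState (A := D)) fun _ h => h.isState)
    convex_isTracialState hcl hco (fun f hf => ?_) hρ
  obtain ⟨n, hn, L, hL⟩ := exists_normTrace_eq_of_extreme hf
  have htr : IsTracialState (P f) :=
    isTracialState_normTrace_comp hn (L.comp π) fun a => hL (π a)
  refine mem_MFTraces_of_upperApprox hA htr fun F ε hε =>
    ⟨n, hn, fun i => L (π (x i)), fun p _ => ?_⟩
  have hp : starEval (fun i => L (π (x i))) p = (L.comp π) (starEval x p) :=
    (map_starEval (L.comp π) x p).symm
  rw [hp]
  constructor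
  · exact (NonUnitalStarAlgHom.norm_apply_le (L.comp π) _).trans (by linarith)
  · rw [hP, hL]
    simpa using hε.le

end FiniteDimensionalTraces

/-! ### Tensor products of asymptotic homomorphisms -/

section KronMap

variable {A C : Type*} [AddCommGroup A] [Module ℂ A] [AddCommGroup C] [Module ℂ C]

/-- The linear map `a ⊗ c ↦ f a ⊗ g c`. -/
def kronMap {m n : ℕ} (f : A →ₗ[ℂ] Mat m) (g : C →ₗ[ℂ] Mat n) : A ⊗[ℂ] C →ₗ[ℂ] Mat (m * n) :=
  TensorProduct.lift (((LinearMap.mul ℂ (Mat (m * n))).compl₁₂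
    ((kronLeft m n).toAlgHom.toLinearMap ∘ₗ f)) ((kronRight m n).toAlgHom.toLinearMap ∘ₗ g))

@[simp]
theorem kronMap_tmul {m n : ℕ} (f : A →ₗ[ℂ] Mat m) (g : C →ₗ[ℂ] Mat n) (a : A) (c : C) :
    kronMap f g (a ⊗ₜ c) = kronLeft m n (f a) * kronRight m n (g c) := rfl

theorem kronMap_map {D : Type*} [AddCommGroup D] [Module ℂ D] {m n : ℕ} (f : A →ₗ[ℂ] Mat m)
    (g : D →ₗ[ℂ] Mat n) (h : C →ₗ[ℂ] D) (z : A ⊗[ℂ] C) :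
    kronMap f g (TensorProduct.map LinearMap.id h z) = kronMap f (g ∘ₗ h) z := by
  induction z with
  | zero => simp
  | tmul a c => simp
  | add x y hx hy => simp only [map_add, hx, hy]

end KronMap

theorem kron_mul_kron (m n : ℕ) (a b : Mat m) (c d : Mat n) :
    kronLeft m n a * kronLeft m n b * (kronRight m n c * kronRight m n d) =
      kronLeft m n a * kronRight m n c * (kronLeft m n b * kronRight m n d) := by
  rw [mul_assoc, ← mul_assoc (kronLeft m n b), kron_commute m n b c]
  simp only [mul_assoc]

section Kron

variable {A C : Type*} [CStarAlgebra A] [CStarAlgebra C] {I : Type*} {l : Filter I} {m n : I → ℕ}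
  {s : ∀ i, A →ₗ[ℂ] Mat (m i)} {t : ∀ i, C →ₗ[ℂ] Mat (n i)}

theorem EvBdd.kron {c : ∀ i, Mat (m i)} {d : ∀ i, Mat (n i)} (hc : EvBdd l c) (hd : EvBdd l d) :
    EvBdd l fun i => kronLeft (m i) (n i) (c i) * kronRight (m i) (n i) (d i) := by
  obtain ⟨C, hC⟩ := hc
  obtain ⟨D, hD⟩ := hd
  refine ⟨C * D, ?_⟩
  filter_upwards [hC, hD] with i h1 h2
  exact (norm_kron_le _ _ _ _).trans (mul_le_mul h1 h2 (norm_nonneg _) ((norm_nonneg _).trans h1))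

theorem AsympEq.kron {c c' : ∀ i, Mat (m i)} {d d' : ∀ i, Mat (n i)} (h : AsympEq l c c')
    (h' : AsympEq l d d') (hc : EvBdd l c') (hd : EvBdd l d) :
    AsympEq l (fun i => kronLeft (m i) (n i) (c i) * kronRight (m i) (n i) (d i))
      (fun i => kronLeft (m i) (n i) (c' i) * kronRight (m i) (n i) (d' i)) := by
  obtain ⟨C, hC⟩ := hc
  obtain ⟨D, hD⟩ := hd
  have key : Tendsto (fun i => ‖c i - c' i‖ * D + C * ‖d i - d' i‖) l (𝓝 0) := by
    simpa using (Tendsto.mul_const D h).add (Tendsto.const_mul C h')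
  refine squeeze_zero' (Eventually.of_forall fun i => norm_nonneg _) ?_ key
  filter_upwards [hC, hD] with i h1 h2
  have e : kronLeft (m i) (n i) (c i) * kronRight (m i) (n i) (d i) -
      kronLeft (m i) (n i) (c' i) * kronRight (m i) (n i) (d' i) =
      kronLeft (m i) (n i) (c i - c' i) * kronRight (m i) (n i) (d i) +
        kronLeft (m i) (n i) (c' i) * kronRight (m i) (n i) (d i - d' i) := by
    rw [map_sub, map_sub]; noncomm_ring
  rw [e]
  refine (norm_add_le _ _).trans (add_le_add ?_ ?_)
  · exact (norm_kron_le _ _ _ _).trans (mul_le_mul_of_nonneg_left h2 (norm_nonneg _))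
  · exact (norm_kron_le _ _ _ _).trans (mul_le_mul_of_nonneg_right h1 (norm_nonneg _))

theorem evBdd_kronMap (hs : ∀ a, EvBdd l fun i => s i a) (ht : ∀ c, EvBdd l fun i => t i c)
    (z : A ⊗[ℂ] C) : EvBdd l fun i => kronMap (s i) (t i) z := by
  induction z with
  | zero => exact ⟨0, by simp⟩
  | tmul a c => exact (hs a).kron (ht c)
  | add x y hx hy => simpa only [map_add] using hx.add hy

/-- Only the algebraic tensor product is involved, so all properties reduce to elementary tensors.
Contractivity for a C*-norm on it is a separate matter, where exactness enters. -/
theorem IsAsympHom.kron (hs : IsAsympHom l s) (ht : IsAsympHom l t) :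
    IsAsympHom l fun i => kronMap (s i) (t i) where
  asymp_one := by
    refine AsympEq.trans (hs.asymp_one.kron ht.asymp_one evBdd_one (ht.bdd 1)) (.of_eq fun i => ?_)
    rw [map_one, map_one, one_mul]
  asymp_mul z w := by
    induction z with
    | zero => exact .of_eq fun i => by simp
    | add x y hx hy => simpa only [map_add, add_mul] using hx.add hy
    | tmul a c =>
      induction w with
      | zero => exact .of_eq fun i => by simp
      | add x y hx hy => simpa only [map_add, mul_add] using hx.add hy
      | tmul b d =>
        have h1 := (hs.asymp_mul a b).kron (ht.asymp_mul c d) ((hs.bdd a).mul (hs.bdd b))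
          (ht.bdd _)
        simp only [Algebra.TensorProduct.tmul_mul_tmul, kronMap_tmul]
        refine h1.trans (.of_eq fun i => ?_)
        simp only [map_mul]
        exact kron_mul_kron _ _ _ _ _ _
  asymp_star z := by
    induction z with
    | zero => exact .of_eq fun i => by simp
    | add x y hx hy => simpa only [map_add, star_add] using hx.add hy
    | tmul a c =>
      have h1 := (hs.asymp_star a).kron (ht.asymp_star c) (hs.bdd a).conj (ht.bdd _)
      simp only [TensorProduct.star_tmul, kronMap_tmul]
      refine h1.trans (.of_eq fun i => ?_)
      rw [kron_commute, star_mul, map_star, map_star]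
  bdd z := evBdd_kronMap hs.bdd ht.bdd z

end Kron

/-! ### States that attain norms -/

section Norming

variable {A : Type*} [CStarAlgebra A]

/-- On the spectrum, contained in `[0, 1]`, `|x + w (1 - x)| ≤ x + (1 - x)`. This forces a norming
functional of `P` to take the right value at the unit. -/
theorem norm_add_smul_one_sub_le [PartialOrder A] [StarOrderedRing A] {P : A} (h0 : 0 ≤ P)
    (h1 : ‖P‖ ≤ 1) {w : ℂ} (hw : ‖w‖ ≤ 1) : ‖P + w • (1 - P)‖ ≤ 1 := by
  have hsa : IsSelfAdjoint P := .of_nonneg h0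
  have hn : IsStarNormal P := hsa.isStarNormal
  have e : P + w • (1 - P) = cfc (fun z : ℂ => z + w * (1 - z)) P := by
    rw [cfc_add (a := P) (fun z : ℂ => z) (fun z => w * (1 - z)), cfc_const_mul w (fun z : ℂ => 1 - z),
      cfc_sub (a := P) (fun _ : ℂ => 1) (fun z => z), cfc_id' ℂ P, cfc_const_one ℂ P]
  rw [e]
  refine norm_cfc_le zero_le_one fun z hz => ?_
  have hz1 := hsa.mem_spectrum_eq_re hz
  have hz0 : 0 ≤ z := spectrum_nonneg_of_nonneg h0 hz
  have hzn : ‖z‖ ≤ 1 := by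
    rcases subsingleton_or_nontrivial A with h | h
    · exact absurd hz (by simp [spectrum.of_subsingleton])
    · exact (spectrum.norm_le_norm_of_mem hz).trans h1
  obtain ⟨x, hx0, rfl⟩ : ∃ x : ℝ, 0 ≤ x ∧ (x : ℂ) = z :=
    ⟨z.re, (Complex.nonneg_iff.1 hz0).1, hz1.symm⟩
  have hx1 : x ≤ 1 := by
    rwa [Complex.norm_real, Real.norm_of_nonneg hx0] at hzn
  calc ‖(x : ℂ) + w * (1 - x)‖ ≤ ‖(x : ℂ)‖ + ‖w‖ * ‖((1 - x : ℝ) : ℂ)‖ := by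
        push_cast
        exact (norm_add_le _ _).trans_eq (by rw [norm_mul])
    _ ≤ x + 1 * (1 - x) := by
        rw [Complex.norm_real, Complex.norm_real, Real.norm_of_nonneg hx0,
          Real.norm_of_nonneg (by linarith)]
        gcongr
    _ = 1 := by ring

/-- Every positive element of norm one has the value one in some state. -/
theorem exists_isState_eq_one {p : A} (hp : ‖star p * p‖ = 1) :
    ∃ φ : WeakDual ℂ A, IsState φ ∧ φ (star p * p) = 1 := by
  let _ := CStarAlgebra.spectralOrder A
  have := CStarAlgebra.spectralOrderedRing A
  obtain ⟨g, hg, hgp⟩ := exists_dual_vector'' ℂ (star p * p)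
  have hgb : ∀ a, ‖g a‖ ≤ ‖a‖ := fun a => g.le_of_opNorm_le hg a |>.trans_eq (one_mul _)
  have hgp' : g (star p * p) = 1 := by rw [hgp, hp]; simp
  set c := g (1 - star p * p)
  -- Otherwise let `w` be the phase with `w c = |c|`: the contractive functional `g` would take the
  -- value `1 + |c|` at an element of norm at most one.
  have hc : c = 0 := by
    by_contra hc
    have hcn : ‖c‖ ≠ 0 := norm_ne_zero_iff.2 hc
    set w : ℂ := star c / ‖c‖
    have hw : ‖w‖ ≤ 1 := by
      rw [norm_div, norm_star, Complex.norm_real, norm_norm, div_self hcn]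
    have h1 := (hgb _).trans (norm_add_smul_one_sub_le (star_mul_self_nonneg p) hp.le hw)
    have h2 : g (star p * p + w • (1 - star p * p)) = ((1 + ‖c‖ : ℝ) : ℂ) := by
      rw [map_add, map_smul, hgp']
      have h3 : star c * c = ((‖c‖ * ‖c‖ : ℝ) : ℂ) := by
        rw [← sq, ← Complex.normSq_eq_norm_sq, Complex.normSq_eq_conj_mul_self]; rfl
      have h4 : (‖c‖ : ℂ) ≠ 0 := by exact_mod_cast hcn
      change 1 + w * c = _
      rw [div_mul_eq_mul_div, h3]
      push_cast
      field_simp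
    rw [h2, Complex.norm_real, Real.norm_of_nonneg (by positivity)] at h1
    have := norm_pos_iff.2 hc
    linarith
  refine ⟨StrongDual.toWeakDual g, ⟨hgb, ?_⟩, hgp'⟩
  have h5 : g 1 = c + g (star p * p) := by rw [← map_add, sub_add_cancel]
  change g 1 = 1
  rw [h5, hc, hgp', zero_add]

/-- A weak*-closed convex set of states that attains the norm of every positive element contains all
states. -/
theorem IsState.mem_of_norming {K : Set (WeakDual ℂ A)} (hKs : ∀ φ ∈ K, IsState φ)
    (hK : IsClosed K) (hKc : Convex ℝ K)
    (h : ∀ b : A, ‖star b * b‖ = 1 → ∃ φ ∈ K, φ (star b * b) = 1) {φ : WeakDual ℂ A}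
    (hφ : IsState φ) : φ ∈ K := by
  let _ := CStarAlgebra.spectralOrder A
  have := CStarAlgebra.spectralOrderedRing A
  by_contra hφK
  have hlc : LocallyConvexSpace ℝ (WeakDual ℂ A) :=
    WeakBilin.locallyConvexSpace (B := topDualPairing ℂ A)
  obtain ⟨f, u, hf1, hf2⟩ := @RCLike.geometric_hahn_banach_closed_point ℂ (WeakDual ℂ A) _ _
    (WeakDual.instModule' ℝ) _ _ _ _
    ⟨fun r c f => DFunLike.ext _ _ fun a => smul_assoc r c (f a)⟩ _ _ hlc hKc hK hφK
  obtain ⟨a, ha⟩ := LinearMap.dualEmbedding_surjective (topDualPairing ℂ A) f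
  have hfa : ∀ ψ : WeakDual ℂ A, f ψ = ψ a := fun ψ => by rw [← ha]; rfl
  -- Hahn–Banach separates `φ` from `K` by the real part of evaluation at `a`. On states this is
  -- evaluation at `a + a*` up to scale, and adding the scalar `c` makes that element positive, say
  -- `b* b`. Then every state in `K` is below `φ (b* b) ≤ ‖b‖²` there, although `K` attains this
  -- norm.
  set c : ℝ := ‖a + star a‖
  have hsa : IsSelfAdjoint (a + star a) := IsSelfAdjoint.add_star_self a
  have hpos : 0 ≤ (a + star a) + algebraMap ℝ A c := by
    have := hsa.neg_algebraMap_norm_le_self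
    exact neg_le_iff_add_nonneg.1 this
  obtain ⟨b, hb⟩ := CStarAlgebra.nonneg_iff_eq_star_mul_self.1 hpos
  have hval : ∀ ψ : WeakDual ℂ A, IsState ψ → (ψ (star b * b)).re = 2 * (ψ a).re + c := by
    intro ψ hψ
    have h1 : ψ (star a) = star (ψ a) :=
      map_star_of_nonneg (f := (WeakDual.toStrongDual ψ).toLinearMap) hψ.nonneg a
    rw [← hb, IsScalarTower.algebraMap_apply ℝ ℂ A, Algebra.algebraMap_eq_smul_one, map_add,
      map_add, map_smul, h1, hψ.2]
    simp
    ring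
  have hsep : ∀ ψ ∈ K, (ψ (star b * b)).re < (φ (star b * b)).re := by
    intro ψ hψ
    have h1 := hf1 ψ hψ
    rw [hfa] at h1 hf2
    rw [hval ψ (hKs ψ hψ), hval φ hφ]
    have h2 : (ψ a).re < u := h1
    have h3 : u < (φ a).re := hf2
    linarith
  have hnt : ‖(1 : A)‖ = 1 := by
    have : Nontrivial A := ⟨1, 0, fun h10 => by
      have := hφ.2; rw [h10, map_zero] at this; exact zero_ne_one this⟩
    exact norm_one
  -- Nonemptiness of `K` is needed for the degenerate case `b = 0`.
  obtain ⟨ψ₁, hψ₁, -⟩ := h 1 (by rw [star_one, mul_one, hnt])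
  rcases eq_or_ne ‖b‖ 0 with hb0 | hb0
  · have := hsep ψ₁ hψ₁
    rw [norm_eq_zero.1 hb0, mul_zero, map_zero, map_zero] at this
    exact lt_irrefl _ this
  · have hn : ‖((‖b‖⁻¹ : ℝ) : ℂ) • b‖ = 1 := by
      rw [norm_smul, Complex.norm_real, norm_inv, norm_norm, inv_mul_cancel₀ hb0]
    obtain ⟨ψ, hψ, hψb⟩ := h (((‖b‖⁻¹ : ℝ) : ℂ) • b)
      (by rw [CStarRing.norm_star_mul_self, hn, one_mul])
    have h1 : ψ (star b * b) = ((‖b‖ ^ 2 : ℝ) : ℂ) := by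
      rw [star_smul, smul_mul_smul_comm, map_smul, smul_eq_mul] at hψb
      have h2 : star ((‖b‖⁻¹ : ℝ) : ℂ) = ((‖b‖⁻¹ : ℝ) : ℂ) := Complex.conj_ofReal _
      have h3 : (‖b‖ : ℂ) ≠ 0 := by exact_mod_cast hb0
      rw [h2] at hψb
      push_cast at hψb ⊢
      field_simp at hψb
      exact hψb
    have h2 := hsep ψ hψ
    rw [h1, Complex.ofReal_re] at h2
    have h3 := (Complex.re_le_norm _).trans (hφ.1 (star b * b))
    rw [CStarRing.norm_star_mul_self] at h3
    nlinarith

end Norming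

/-! ### Product states on C*-tensor products -/

section ProductStates

variable {A : Type u} {B : Type v} [CStarAlgebra A] [CStarAlgebra B]

/-- The linear functional `a ⊗ b ↦ f a * g b`. -/
noncomputable def prodFun (f : A →ₗ[ℂ] ℂ) (g : B →ₗ[ℂ] ℂ) : A ⊗[ℂ] B →ₗ[ℂ] ℂ :=
  LinearMap.mul' ℂ ℂ ∘ₗ TensorProduct.map f g

@[simp]
theorem prodFun_tmul (f : A →ₗ[ℂ] ℂ) (g : B →ₗ[ℂ] ℂ) (a : A) (b : B) :
    prodFun f g (a ⊗ₜ b) = f a * g b := rfl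

/-- The linear map underlying an element of the weak dual. -/
noncomputable def toLin {E : Type*} [NormedRing E] [NormedAlgebra ℂ E] (φ : WeakDual ℂ E) : E →ₗ[ℂ] ℂ :=
  (WeakDual.toStrongDual φ).toLinearMap

@[simp]
theorem toLin_apply {E : Type*} [NormedRing E] [NormedAlgebra ℂ E] (φ : WeakDual ℂ E) (a : E) :
    toLin φ a = φ a := rfl

theorem tmul_ne_zero_of_ne_zero {a : A} {b : B} (ha : a ≠ 0) (hb : b ≠ 0) :
    a ⊗ₜ[ℂ] b ≠ 0 := by
  intro h
  obtain ⟨f, -, hf⟩ := exists_dual_vector ℂ a (norm_ne_zero_iff.2 ha)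
  obtain ⟨g, -, hg⟩ := exists_dual_vector ℂ b (norm_ne_zero_iff.2 hb)
  have h1 := prodFun_tmul f.toLinearMap g.toLinearMap a b
  rw [h, map_zero] at h1
  have h2 : f a * g b ≠ 0 := by
    rw [hf, hg]
    exact mul_ne_zero (by simpa using ha) (by simpa using hb)
  exact h2 h1.symm

namespace CStarTensorNorm

variable (ν : CStarTensorNorm A B)

/-- The inclusion of the algebraic tensor product into its completion. -/
noncomputable def incl : A ⊗[ℂ] B →⋆ₐ[ℂ] ν.Tensor where
  toFun z := (ν.ofTensor z : ν.Tensor)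
  map_one' := UniformSpace.Completion.coe_one _
  map_mul' z w := UniformSpace.Completion.coe_mul (ν.ofTensor z) (ν.ofTensor w)
  map_zero' := UniformSpace.Completion.coe_zero
  map_add' z w := UniformSpace.Completion.coe_add (ν.ofTensor z) (ν.ofTensor w)
  commutes' r := by
    rw [Algebra.algebraMap_eq_smul_one, Algebra.algebraMap_eq_smul_one]
    exact (UniformSpace.Completion.coe_smul r (1 : ν.Alg)).trans
      (congrArg (r • ·) (UniformSpace.Completion.coe_one ν.Alg))
  map_star' z := (star_coe (ν.ofTensor z)).symm

theorem norm_incl (z : A ⊗[ℂ] B) : ‖ν.incl z‖ = ‖ν.ofTensor z‖ :=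
  UniformSpace.Completion.norm_coe _

theorem incl_injective : Function.Injective ν.incl := fun _ _ h =>
  UniformSpace.Completion.coe_injective ν.Alg h

/-- The embedding `a ↦ a ⊗ 1`. -/
noncomputable def inl : A →⋆ₐ[ℂ] ν.Tensor where
  __ := ν.incl.toAlgHom.comp Algebra.TensorProduct.includeLeft
  map_star' a := by
    change ν.incl (star a ⊗ₜ 1) = star (ν.incl (a ⊗ₜ 1))
    rw [← map_star, TensorProduct.star_tmul, star_one]

/-- The embedding `b ↦ 1 ⊗ b`. -/
noncomputable def inr : B →⋆ₐ[ℂ] ν.Tensor where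
  __ := ν.incl.toAlgHom.comp Algebra.TensorProduct.includeRight
  map_star' b := by
    change ν.incl (1 ⊗ₜ star b) = star (ν.incl (1 ⊗ₜ b))
    rw [← map_star, TensorProduct.star_tmul, star_one]

theorem inl_apply (a : A) : ν.inl a = ν.incl (a ⊗ₜ 1) := rfl

theorem inr_apply (b : B) : ν.inr b = ν.incl (1 ⊗ₜ b) := rfl

theorem inl_mul_inr (a : A) (b : B) : ν.inl a * ν.inr b = ν.incl (a ⊗ₜ b) := by
  rw [inl_apply, inr_apply, ← map_mul, Algebra.TensorProduct.tmul_mul_tmul, mul_one, one_mul]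

theorem norm_incl_tmul_le (a : A) (b : B) : ‖ν.incl (a ⊗ₜ b)‖ ≤ ‖a‖ * ‖b‖ := by
  rw [← inl_mul_inr]
  exact (norm_mul_le _ _).trans (mul_le_mul (NonUnitalStarAlgHom.norm_apply_le ν.inl a)
    (NonUnitalStarAlgHom.norm_apply_le ν.inr b) (norm_nonneg _) (norm_nonneg _))

/-- Bumps `e`, `f` at the top of the spectra satisfy `a*a e*e ≥ r e*e` and `b*b f*f ≥ r f*f`. Hence
the tensor of `a*a` and `b*b` times the nonzero element `w = e*e ⊗ f*f` dominates `r² w`, which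
gives norm at least `r²` for every `r < 1`. -/
theorem norm_incl_star_mul_tmul {a : A} {b : B} (ha : ‖star a * a‖ = 1) (hb : ‖star b * b‖ = 1) :
    ‖ν.incl ((star a * a) ⊗ₜ (star b * b))‖ = 1 := by
  let _ := CStarAlgebra.spectralOrder ν.Tensor
  have := CStarAlgebra.spectralOrderedRing ν.Tensor
  have : Nontrivial A := ⟨star a * a, 0, fun h => by rw [h, norm_zero] at ha; exact zero_ne_one ha⟩
  have : Nontrivial B := ⟨star b * b, 0, fun h => by rw [h, norm_zero] at hb; exact zero_ne_one hb⟩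
  refine le_antisymm ((ν.norm_incl_tmul_le _ _).trans_eq (by rw [ha, hb, one_mul])) ?_
  refine le_of_forall_lt_imp_le_of_dense fun q hq => ?_
  rcases le_or_gt q 0 with hq0 | hq0
  · exact hq0.trans (norm_nonneg _)
  set r := √q
  have hr0 : 0 ≤ r := Real.sqrt_nonneg q
  have hr1 : r < 1 := by rw [Real.sqrt_lt' one_pos]; simpa using hq
  have hrq : r * r = q := Real.mul_self_sqrt hq0.le
  obtain ⟨e, -, he0, he⟩ := exists_bump a (hr1.trans_eq ha.symm)
  obtain ⟨f, -, hf0, hf⟩ := exists_bump b (hr1.trans_eq hb.symm)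
  have pos : ∀ c d, 0 ≤ ν.incl ((star c * c) ⊗ₜ (star d * d)) := fun c d => by
    have : (star c * c) ⊗ₜ[ℂ] (star d * d) = star (c ⊗ₜ[ℂ] d) * (c ⊗ₜ[ℂ] d) := by
      rw [TensorProduct.star_tmul, Algebra.TensorProduct.tmul_mul_tmul]
    rw [this, map_mul, map_star]
    exact star_mul_self_nonneg _
  set w := ν.incl ((star e * e) ⊗ₜ (star f * f))
  have hw : w ≠ 0 := fun h => tmul_ne_zero_of_ne_zero
    ((CStarRing.star_mul_self_ne_zero_iff e).2 he0) ((CStarRing.star_mul_self_ne_zero_iff f).2 hf0)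
    (ν.incl_injective (h.trans (map_zero _).symm))
  have hw0 : 0 ≤ w := pos e f
  have ineq : ((q : ℝ) : ℂ) • w ≤ ν.incl ((star a * a) ⊗ₜ (star b * b)) * w := by
    rw [← map_mul, Algebra.TensorProduct.tmul_mul_tmul, he, hf, TensorProduct.add_tmul,
      TensorProduct.tmul_add, TensorProduct.tmul_add, map_add, map_add, map_add,
      TensorProduct.smul_tmul_smul, TensorProduct.tmul_smul, ← TensorProduct.smul_tmul',
      map_smul, map_smul, map_smul]
    have h1 : ((r : ℂ) * r) • w = ((q : ℝ) : ℂ) • w := by rw [← hrq]; push_cast; rfl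
    rw [← h1]
    have e1 : star e * e * (star e * e) = star (star e * e) * (star e * e) := by
      rw [star_mul, star_star]
    have f1 : star f * f * (star f * f) = star (star f * f) * (star f * f) := by
      rw [star_mul, star_star]
    have hrc : (0 : ℂ) ≤ r := by exact_mod_cast hr0
    refine le_add_of_nonneg_of_le (add_nonneg ?_ (smul_nonneg hrc ?_))
      (le_add_of_nonneg_of_le (smul_nonneg hrc ?_) le_rfl)
    · rw [e1, f1]; exact pos _ _
    · rw [e1]; exact pos _ _
    · rw [f1]; exact pos _ _
  have h2 := CStarAlgebra.norm_le_norm_of_nonneg_of_le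
    (smul_nonneg (by exact_mod_cast hq0.le) hw0) ineq
  rw [norm_smul, Complex.norm_real, Real.norm_of_nonneg hq0.le] at h2
  exact le_of_mul_le_mul_right (h2.trans (norm_mul_le _ _)) (norm_pos_iff.2 hw)

/-- The restriction of a functional to the first factor. -/
noncomputable def restrictLeft (θ : WeakDual ℂ ν.Tensor) : WeakDual ℂ A :=
  StrongDual.toWeakDual ((WeakDual.toStrongDual θ).comp ⟨ν.inl.toAlgHom.toLinearMap,
    AddMonoidHomClass.continuous_of_bound ν.inl 1 fun a => by
      simpa using NonUnitalStarAlgHom.norm_apply_le ν.inl a⟩)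

/-- The restriction of a functional to the second factor. -/
noncomputable def restrictRight (θ : WeakDual ℂ ν.Tensor) : WeakDual ℂ B :=
  StrongDual.toWeakDual ((WeakDual.toStrongDual θ).comp ⟨ν.inr.toAlgHom.toLinearMap,
    AddMonoidHomClass.continuous_of_bound ν.inr 1 fun a => by
      simpa using NonUnitalStarAlgHom.norm_apply_le ν.inr a⟩)

theorem restrictLeft_apply (θ : WeakDual ℂ ν.Tensor) (a : A) :
    ν.restrictLeft θ a = θ (ν.inl a) := rfl

theorem restrictRight_apply (θ : WeakDual ℂ ν.Tensor) (b : B) :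
    ν.restrictRight θ b = θ (ν.inr b) := rfl

theorem isState_restrictLeft {θ : WeakDual ℂ ν.Tensor} (hθ : IsState θ) :
    IsState (ν.restrictLeft θ) :=
  ⟨fun a => (hθ.1 _).trans (NonUnitalStarAlgHom.norm_apply_le ν.inl a), by
    rw [restrictLeft_apply, map_one, hθ.2]⟩

theorem isState_restrictRight {θ : WeakDual ℂ ν.Tensor} (hθ : IsState θ) :
    IsState (ν.restrictRight θ) :=
  ⟨fun a => (hθ.1 _).trans (NonUnitalStarAlgHom.norm_apply_le ν.inr a), by
    rw [restrictRight_apply, map_one, hθ.2]⟩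

theorem nonneg_incl {θ : WeakDual ℂ ν.Tensor} (hθ : IsState θ) (a : A) (b : B) :
    0 ≤ θ (ν.incl ((star a * a) ⊗ₜ (star b * b))) := by
  have : (star a * a) ⊗ₜ[ℂ] (star b * b) = star (a ⊗ₜ[ℂ] b) * (a ⊗ₜ[ℂ] b) := by
    rw [TensorProduct.star_tmul, Algebra.TensorProduct.tmul_mul_tmul]
  rw [this, map_mul, map_star]
  exact hθ.nonneg _

/-- Positive elements of norm one in the two factors have the value one in a common state. -/
theorem exists_isState_eq_one {a : A} {b : B} (ha : ‖star a * a‖ = 1) (hb : ‖star b * b‖ = 1) :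
    ∃ θ : WeakDual ℂ ν.Tensor, IsState θ ∧ θ (ν.inl (star a * a)) = 1 ∧
      θ (ν.inr (star b * b)) = 1 := by
  have e : (star a * a) ⊗ₜ[ℂ] (star b * b) = star (a ⊗ₜ[ℂ] b) * (a ⊗ₜ[ℂ] b) := by
    rw [TensorProduct.star_tmul, Algebra.TensorProduct.tmul_mul_tmul]
  have h1 := ν.norm_incl_star_mul_tmul ha hb
  rw [e, map_mul, map_star] at h1
  obtain ⟨θ, hθ, hθ1⟩ := MFAlg.exists_isState_eq_one h1
  rw [← map_star, ← map_mul, ← e] at hθ1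
  have an : ‖a‖ = 1 := by
    rw [CStarRing.norm_star_mul_self] at ha
    nlinarith [norm_nonneg a]
  have bn : ‖b‖ = 1 := by
    rw [CStarRing.norm_star_mul_self] at hb
    nlinarith [norm_nonneg b]
  -- As `1 - a*a` and `1 - b*b` are positive, `θ (a*a ⊗ 1)` and `θ (1 ⊗ b*b)` are at least `θ (a*a ⊗
  -- b*b) = 1`.
  obtain ⟨c, hc⟩ := exists_star_mul_self_eq_sub a
  obtain ⟨d, hd⟩ := exists_star_mul_self_eq_sub b
  rw [an] at hc
  rw [bn] at hd
  simp only [one_pow, Complex.ofReal_one, one_smul] at hc hd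
  have up : ∀ x : ℂ, ‖x‖ ≤ 1 → 0 ≤ x - 1 → x = 1 := by
    intro x hx hx1
    obtain ⟨h3, h4⟩ := Complex.nonneg_iff.1 hx1
    have h5 := (Complex.re_le_norm x).trans hx
    simp at h3 h4
    exact Complex.ext (by simp; linarith) (by simp [← h4])
  refine ⟨θ, hθ, up _ ?_ ?_, up _ ?_ ?_⟩
  · exact (hθ.1 _).trans ((NonUnitalStarAlgHom.norm_apply_le ν.inl _).trans_eq ha)
  · have h3 := ν.nonneg_incl hθ a d
    have h4 : ν.inl (star a * a) = ν.incl ((star a * a) ⊗ₜ (star b * b)) +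
        ν.incl ((star a * a) ⊗ₜ (star d * d)) := by
      rw [← map_add, ← TensorProduct.tmul_add, ← hd]; rfl
    rwa [h4, map_add, hθ1, add_sub_cancel_left]
  · exact (hθ.1 _).trans ((NonUnitalStarAlgHom.norm_apply_le ν.inr _).trans_eq hb)
  · have h3 := ν.nonneg_incl hθ c b
    have h4 : ν.inr (star b * b) = ν.incl ((star a * a) ⊗ₜ (star b * b)) +
        ν.incl ((star c * c) ⊗ₜ (star b * b)) := by
      rw [← map_add, ← TensorProduct.add_tmul, ← hc]; rfl
    rwa [h4, map_add, hθ1, add_sub_cancel_left]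

end CStarTensorNorm

end ProductStates

/-! ### Takesaki's theorem: product states are bounded for every C*-norm -/

section Takesaki

variable {A : Type u} {B : Type v} [CStarAlgebra A] [CStarAlgebra B]

theorem IsState.exists_real {E : Type*} [CStarAlgebra E] {φ : WeakDual ℂ E} (hφ : IsState φ)
    (a : E) : ∃ t : ℝ, 0 ≤ t ∧ φ (star a * a) = t := by
  obtain ⟨h1, h2⟩ := Complex.nonneg_iff.1 (hφ.nonneg a)
  exact ⟨_, h1, Complex.ext (by simp) (by simp [← h2])⟩

/-- Linear maps out of a C*-algebra that agree on the elements `d* d` are equal. -/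
theorem linearMap_ext_star_mul_self {E F : Type*} [CStarAlgebra E] [AddCommGroup F] [Module ℂ F]
    {f g : E →ₗ[ℂ] F} (h : ∀ d, f (star d * d) = g (star d * d)) : f = g := by
  let _ := CStarAlgebra.spectralOrder E
  have := CStarAlgebra.spectralOrderedRing E
  refine LinearMap.ext_on (CStarAlgebra.span_nonneg (A := E)) fun y hy => ?_
  obtain ⟨d, rfl⟩ := (CStarAlgebra.nonneg_iff_eq_star_mul_self (a := y)).1 hy
  exact h d

namespace CStarTensorNorm

variable (ν : CStarTensorNorm A B)

theorem continuous_restrictLeft : Continuous ν.restrictLeft :=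
  WeakDual.continuous_of_continuous_eval fun a => WeakDual.eval_continuous (ν.inl a)

/-- Every state of the first factor extends to a state of the tensor product that attains the norm
of a given positive element of the second factor. -/
theorem exists_restrictLeft_eq {φ : WeakDual ℂ A} (hφ : IsState φ) {b : B}
    (hb : ‖star b * b‖ = 1) :
    ∃ θ : WeakDual ℂ ν.Tensor, IsState θ ∧ ν.restrictLeft θ = φ ∧ θ (ν.inr (star b * b)) = 1 := by
  set S : Set (WeakDual ℂ ν.Tensor) := {θ | IsState θ} ∩ {θ | θ (ν.inr (star b * b)) = 1}
  have hS : IsCompact S := isCompact_of_isState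
    (isClosed_isState.inter (isClosed_eq (WeakDual.eval_continuous _) continuous_const))
    fun _ h => h.1
  have hSc : Convex ℝ S := by
    refine convex_isState.inter fun f hf g hg s t _ _ hst => ?_
    change (s • f + t • g) _ = 1
    have h1 : f (ν.inr (star b * b)) = 1 := hf
    have h2 : g (ν.inr (star b * b)) = 1 := hg
    rw [weakDual_combo_apply, h1, h2]
    exact_mod_cast (by linarith : s * 1 + t * 1 = 1)
  have hKc : Convex ℝ (ν.restrictLeft '' S) := by
    rintro _ ⟨f, hf, rfl⟩ _ ⟨g, hg, rfl⟩ s t hs ht hst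
    refine ⟨s • f + t • g, hSc hf hg hs ht hst, DFunLike.ext _ _ fun a => ?_⟩
    rw [restrictLeft_apply, weakDual_combo_apply, weakDual_combo_apply, restrictLeft_apply,
      restrictLeft_apply]
  -- The restrictions of states in `S` form a compact convex set that attains the norm of every
  -- positive element of `A`, so they are all the states of `A`.
  obtain ⟨θ, hθ, rfl⟩ := IsState.mem_of_norming (K := ν.restrictLeft '' S)
    (by rintro _ ⟨θ, hθ, rfl⟩; exact ν.isState_restrictLeft hθ.1)
    (hS.image ν.continuous_restrictLeft).isClosed hKc (fun a ha => by
      obtain ⟨θ, h1, h2, h3⟩ := ν.exists_isState_eq_one ha hb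
      exact ⟨_, ⟨θ, ⟨h1, h3⟩, rfl⟩, h2⟩) hφ
  exact ⟨θ, hθ.1, rfl, hθ.2⟩

/-- The functional `a ↦ θ (a ⊗ y)`. -/
noncomputable def sliceLeft (θ : WeakDual ℂ ν.Tensor) (y : B) : WeakDual ℂ A :=
  StrongDual.toWeakDual (((WeakDual.toStrongDual θ).comp
    ((ContinuousLinearMap.mul ℂ ν.Tensor).flip (ν.inr y))).comp ⟨ν.inl.toAlgHom.toLinearMap,
    AddMonoidHomClass.continuous_of_bound ν.inl 1 fun a => by
      simpa using NonUnitalStarAlgHom.norm_apply_le ν.inl a⟩)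

theorem sliceLeft_apply (θ : WeakDual ℂ ν.Tensor) (y : B) (a : A) :
    ν.sliceLeft θ y a = θ (ν.incl (a ⊗ₜ y)) := by
  rw [← inl_mul_inr]; rfl

/-- A state whose restriction to the first factor is pure is a product state. -/
theorem apply_incl_tmul_of_extreme {θ : WeakDual ℂ ν.Tensor} (hθ : IsState θ)
    (hφ : ν.restrictLeft θ ∈ ({f : WeakDual ℂ A | IsState f}).extremePoints ℝ) (a : A) (y : B) :
    θ (ν.incl (a ⊗ₜ y)) = ν.restrictLeft θ a * θ (ν.inr y) := by
  set φ := ν.restrictLeft θ with hφdef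
  have hφs : IsState φ := hφ.1
  have main : ∀ (d : B) (a : A),
      θ (ν.incl (a ⊗ₜ (star d * d))) = φ a * θ (ν.inr (star d * d)) := by
    intro d a
    obtain ⟨c, hc⟩ := exists_star_mul_self_eq_sub d
    set s : ℝ := ‖d‖ ^ 2
    have hs0 : 0 ≤ s := by positivity
    -- The slices of `θ` at `d* d` and `c* c` are positive and add up to `‖d‖² φ`; purity makes them
    -- multiples of `φ`. Adding `φ` before normalizing avoids a division by zero when a slice
    -- vanishes.
    have part : ∀ (e : B), ∃ t : ℝ, 0 ≤ t ∧ θ (ν.inr (star e * e)) = t ∧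
        IsState (((t : ℂ) + 1)⁻¹ • (ν.sliceLeft θ (star e * e) + φ)) := by
      intro e
      obtain ⟨t, ht0, ht⟩ := hθ.exists_real (ν.inr e)
      rw [← map_star, ← map_mul] at ht
      have hne : (t : ℂ) + 1 ≠ 0 := by exact_mod_cast (by linarith : (0 : ℝ) < t + 1).ne'
      refine ⟨t, ht0, ht, isState_of_nonneg (fun x => ?_) ?_⟩
      · change 0 ≤ ((t : ℂ) + 1)⁻¹ * (ν.sliceLeft θ (star e * e) (star x * x) + φ (star x * x))
        rw [sliceLeft_apply]
        have h1 := ν.nonneg_incl hθ x e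
        have h2 := hφs.nonneg x
        have h3 : (0 : ℂ) ≤ ((t : ℂ) + 1)⁻¹ := by
          have : (0 : ℂ) ≤ (((t + 1)⁻¹ : ℝ) : ℂ) := by
            exact_mod_cast (by positivity : (0 : ℝ) ≤ (t + 1)⁻¹)
          simpa using this
        exact mul_nonneg h3 (add_nonneg h1 h2)
      · change ((t : ℂ) + 1)⁻¹ * (ν.sliceLeft θ (star e * e) 1 + φ 1) = 1
        rw [sliceLeft_apply, ← inr_apply, ht, hφs.2, inv_mul_cancel₀ hne]
    obtain ⟨t, ht0, ht, hF⟩ := part d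
    obtain ⟨r, hr0, hr, hG⟩ := part c
    have hsum : (t : ℂ) + r = s := by
      rw [← ht, ← hr, ← map_add, ← map_add, ← hc, map_smul, map_one, map_smul, hθ.2, smul_eq_mul,
        mul_one]
    have hsumR : t + r = s := by exact_mod_cast hsum
    have htne : (t : ℂ) + 1 ≠ 0 := by exact_mod_cast (by linarith : (0 : ℝ) < t + 1).ne'
    have hrne : (r : ℂ) + 1 ≠ 0 := by exact_mod_cast (by linarith : (0 : ℝ) < r + 1).ne'
    have hsne : (s : ℂ) + 2 ≠ 0 := by exact_mod_cast (by linarith : (0 : ℝ) < s + 2).ne'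
    have hseg : φ ∈ openSegment ℝ (((t : ℂ) + 1)⁻¹ • (ν.sliceLeft θ (star d * d) + φ))
        (((r : ℂ) + 1)⁻¹ • (ν.sliceLeft θ (star c * c) + φ)) := by
      refine ⟨(t + 1) / (s + 2), (r + 1) / (s + 2), by positivity, by positivity, ?_, ?_⟩
      · rw [← add_div, div_eq_one_iff_eq (by positivity)]
        linarith
      · refine DFunLike.ext _ _ fun x => ?_
        rw [weakDual_combo_apply]
        change _ * (((t : ℂ) + 1)⁻¹ * (ν.sliceLeft θ (star d * d) x + φ x)) +
          _ * (((r : ℂ) + 1)⁻¹ * (ν.sliceLeft θ (star c * c) x + φ x)) = φ x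
        have h1 : ν.sliceLeft θ (star d * d) x + ν.sliceLeft θ (star c * c) x = s * φ x := by
          rw [sliceLeft_apply, sliceLeft_apply, ← map_add, ← map_add, ← TensorProduct.tmul_add,
            ← hc, TensorProduct.tmul_smul, map_smul, map_smul, ← inl_apply, smul_eq_mul]
          rfl
        push_cast
        field_simp
        linear_combination h1
    have h2 := DFunLike.congr_fun (hφ.2 hF hG hseg) a
    change ((t : ℂ) + 1)⁻¹ * (ν.sliceLeft θ (star d * d) a + φ a) = φ a at h2
    rw [sliceLeft_apply] at h2
    rw [ht]
    field_simp at h2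
    linear_combination h2
  have h3 : (toLin θ ∘ₗ ν.incl.toAlgHom.toLinearMap) ∘ₗ TensorProduct.mk ℂ A B a =
      φ a • (toLin θ ∘ₗ ν.inr.toAlgHom.toLinearMap) :=
    linearMap_ext_star_mul_self fun d => main d a
  exact LinearMap.congr_fun h3 y

/-- Product states are contractive for every C*-norm on the tensor product. -/
theorem norm_prodFun_le {φ : WeakDual ℂ A} (hφ : IsState φ) {ψ : WeakDual ℂ B} (hψ : IsState ψ)
    (z : A ⊗[ℂ] B) : ‖prodFun (toLin φ) (toLin ψ) z‖ ≤ ‖ν.incl z‖ := by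
  have contL : ∀ (ψ : WeakDual ℂ B) z,
      Continuous fun φ : WeakDual ℂ A => prodFun (toLin φ) (toLin ψ) z := by
    intro ψ z
    induction z with
    | zero => simpa using continuous_const
    | tmul a b => exact (WeakDual.eval_continuous a).mul continuous_const
    | add x y hx hy => simp only [map_add]; exact hx.add hy
  have contR : ∀ (φ : WeakDual ℂ A) z,
      Continuous fun ψ : WeakDual ℂ B => prodFun (toLin φ) (toLin ψ) z := by
    intro φ z
    induction z with
    | zero => simpa using continuous_const
    | tmul a b => exact continuous_const.mul (WeakDual.eval_continuous b)
    | add x y hx hy => simp only [map_add]; exact hx.add hy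
  have combL : ∀ (ψ : WeakDual ℂ B) z (s t : ℝ) (f g : WeakDual ℂ A),
      prodFun (toLin (s • f + t • g)) (toLin ψ) z =
        s * prodFun (toLin f) (toLin ψ) z + t * prodFun (toLin g) (toLin ψ) z := by
    intro ψ z s t f g
    induction z with
    | zero => simp
    | tmul a b =>
      simp only [prodFun_tmul, toLin_apply]
      rw [weakDual_combo_apply]; ring
    | add x y hx hy => rw [map_add, map_add, map_add, hx, hy]; ring
  have combR : ∀ (φ : WeakDual ℂ A) z (s t : ℝ) (f g : WeakDual ℂ B),
      prodFun (toLin φ) (toLin (s • f + t • g)) z =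
        s * prodFun (toLin φ) (toLin f) z + t * prodFun (toLin φ) (toLin g) z := by
    intro φ z s t f g
    induction z with
    | zero => simp
    | tmul a b =>
      simp only [prodFun_tmul, toLin_apply]
      rw [weakDual_combo_apply]; ring
    | add x y hx hy => rw [map_add, map_add, map_add, hx, hy]; ring
  have comb_le : ∀ (z : A ⊗[ℂ] B) (s t : ℝ) (p q : ℂ), 0 ≤ s → 0 ≤ t → s + t = 1 →
      ‖p‖ ≤ ‖ν.incl z‖ → ‖q‖ ≤ ‖ν.incl z‖ → ‖s * p + t * q‖ ≤ ‖ν.incl z‖ := by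
    intro z s t p q hs ht hst hp hq
    calc ‖(s : ℂ) * p + t * q‖ ≤ s * ‖p‖ + t * ‖q‖ := by
          refine (norm_add_le _ _).trans_eq ?_
          rw [norm_mul, norm_mul, Complex.norm_real, Complex.norm_real, Real.norm_of_nonneg hs,
            Real.norm_of_nonneg ht]
      _ ≤ s * ‖ν.incl z‖ + t * ‖ν.incl z‖ := by gcongr
      _ = ‖ν.incl z‖ := by rw [← add_mul, hst, one_mul]
  -- For pure `φ`, states of the tensor product restricting to `φ` are product states and so give
  -- second factors `ψ` with the bound. These attain all norms of positive elements of `B`, and the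
  -- bound is closed and convex in `ψ`, hence it holds for all states `ψ`.
  have step : ∀ φ ∈ ({f : WeakDual ℂ A | IsState f}).extremePoints ℝ, ∀ ψ : WeakDual ℂ B,
      IsState ψ → ∀ z, ‖prodFun (toLin φ) (toLin ψ) z‖ ≤ ‖ν.incl z‖ := by
    intro φ hφ ψ hψ
    have hmem : ψ ∈ {ψ : WeakDual ℂ B | IsState ψ} ∩
        {ψ | ∀ z, ‖prodFun (toLin φ) (toLin ψ) z‖ ≤ ‖ν.incl z‖} := by
      refine IsState.mem_of_norming (fun _ h => h.1) (isClosed_isState.inter ?_)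
        (convex_isState.inter ?_) (fun b hb => ?_) hψ
      · rw [Set.ofPred_forall]
        exact isClosed_iInter fun z => isClosed_le (contR φ z).norm continuous_const
      · intro f hf g hg s t hs ht hst z
        rw [combR]
        exact comb_le z s t _ _ hs ht hst (hf z) (hg z)
      · obtain ⟨θ, hθ, rfl, hθb⟩ := ν.exists_restrictLeft_eq hφ.1 hb
        refine ⟨ν.restrictRight θ, ⟨ν.isState_restrictRight hθ, fun z => ?_⟩, hθb⟩
        have : prodFun (toLin (ν.restrictLeft θ)) (toLin (ν.restrictRight θ)) z =
            θ (ν.incl z) := by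
          induction z with
          | zero => simp
          | tmul a b => exact (ν.apply_incl_tmul_of_extreme hθ hφ a b).symm
          | add x y hx hy => rw [map_add, hx, hy, map_add, map_add]
        rw [this]
        exact hθ.1 _
    exact hmem.2
  -- With `ψ` fixed the bound is closed and convex in `φ`, so Krein–Milman extends it from pure
  -- states to all states.
  have hsub := subset_of_extremePoints_subset
    (S := {φ : WeakDual ℂ A | ∀ z, ‖prodFun (toLin φ) (toLin ψ) z‖ ≤ ‖ν.incl z‖})
    (isCompact_of_isState (isClosed_isState (A := A)) fun _ h => h) convex_isState
    (by
      rw [Set.ofPred_forall]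
      exact isClosed_iInter fun z => isClosed_le (contL ψ z).norm continuous_const)
    (fun f hf g hg s t hs ht hst z => by
      rw [combL]
      exact comb_le z s t _ _ hs ht hst (hf z) (hg z))
    (fun φ hφ => step φ hφ ψ hψ)
  exact hsub hφ z

end CStarTensorNorm

end Takesaki

/-! ### The spatial norm is the least C*-norm -/

section Spatial

section Rep

variable {A C : Type*} [CStarAlgebra A] [CStarAlgebra C]
    {H : Type*} [NormedAddCommGroup H] [InnerProductSpace ℂ H] [CompleteSpace H]
    {K : Type*} [NormedAddCommGroup K] [InnerProductSpace ℂ K] [CompleteSpace K]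
    (π : A →⋆ₙₐ[ℂ] (H →L[ℂ] H)) (ρ : C →⋆ₙₐ[ℂ] (K →L[ℂ] K))

theorem tensorRep_tmul (a : A) (c : C) :
    tensorRep π ρ (a ⊗ₜ c) = TensorProduct.mapL (π a) (ρ c) := rfl

theorem tensorRep_tmul_apply (a : A) (c : C) (h : H) (k : K) :
    tensorRep π ρ (a ⊗ₜ c) (h ⊗ₜ k) = π a h ⊗ₜ ρ c k := by
  rw [tensorRep_tmul]; rfl

theorem tensorRep_mul (z w : A ⊗[ℂ] C) :
    tensorRep π ρ (z * w) = tensorRep π ρ z * tensorRep π ρ w := by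
  induction z with
  | zero => simp
  | add x y hx hy => rw [add_mul, map_add, hx, hy, map_add, add_mul]
  | tmul a c =>
    induction w with
    | zero => simp
    | add x y hx hy => rw [mul_add, map_add, hx, hy, map_add, mul_add]
    | tmul b d =>
      refine ContinuousLinearMap.ext fun ζ => ?_
      rw [Algebra.TensorProduct.tmul_mul_tmul]
      rw [ContinuousLinearMap.mul_def, ContinuousLinearMap.comp_apply]
      induction ζ with
      | zero => simp
      | add x y hx hy => rw [map_add, hx, hy, map_add, map_add]
      | tmul h k =>
        rw [tensorRep_tmul_apply, tensorRep_tmul_apply, tensorRep_tmul_apply, map_mul, map_mul]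
        rfl

theorem inner_tensorRep (z : A ⊗[ℂ] C) (ζ ζ' : H ⊗[ℂ] K) :
    inner ℂ (tensorRep π ρ z ζ) ζ' = inner ℂ ζ (tensorRep π ρ (star z) ζ') := by
  induction z with
  | zero => simp
  | add x y hx hy =>
    rw [map_add, star_add, map_add]
    change inner ℂ (tensorRep π ρ x ζ + tensorRep π ρ y ζ) ζ' =
      inner ℂ ζ (tensorRep π ρ (star x) ζ' + tensorRep π ρ (star y) ζ')
    rw [inner_add_left, inner_add_right, hx, hy]
  | tmul a c =>
    rw [TensorProduct.star_tmul]
    induction ζ with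
    | zero => simp
    | add x y hx hy => rw [map_add, inner_add_left, inner_add_left, hx, hy]
    | tmul h k =>
      induction ζ' with
      | zero => simp
      | add x y hx hy => rw [map_add, inner_add_right, inner_add_right, hx, hy]
      | tmul h' k' =>
        rw [tensorRep_tmul_apply, tensorRep_tmul_apply, TensorProduct.inner_tmul,
          TensorProduct.inner_tmul, map_star, map_star, ContinuousLinearMap.star_eq_adjoint,
          ContinuousLinearMap.star_eq_adjoint, ContinuousLinearMap.adjoint_inner_right,
          ContinuousLinearMap.adjoint_inner_right]

/-- The algebraic tensor product of Hilbert spaces need not be complete, so operators on it may lack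
adjoints. This Cauchy–Schwarz inequality stands in for the C*-identity. -/
theorem norm_sq_tensorRep (z : A ⊗[ℂ] C) (ζ : H ⊗[ℂ] K) :
    ‖tensorRep π ρ z ζ‖ ^ 2 ≤ ‖ζ‖ * ‖tensorRep π ρ (star z * z) ζ‖ := by
  have h1 := norm_inner_le_norm (𝕜 := ℂ) ζ (tensorRep π ρ (star z * z) ζ)
  rw [tensorRep_mul, ContinuousLinearMap.mul_def, ContinuousLinearMap.comp_apply,
    ← inner_tensorRep] at h1
  rw [norm_sq_eq_re_inner (𝕜 := ℂ), tensorRep_mul, ContinuousLinearMap.mul_def,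
    ContinuousLinearMap.comp_apply]
  exact (RCLike.re_le_norm _).trans h1

/-- The functional `a ↦ ⟨ξ, π a η⟩`. -/
noncomputable def vecFun (ξ η : H) : A →ₗ[ℂ] ℂ where
  toFun a := inner ℂ ξ (π a η)
  map_add' a b := by rw [map_add]; exact inner_add_right _ _ _
  map_smul' r a := by rw [map_smul]; exact inner_smul_right _ _ _

theorem vecFun_apply (ξ η : H) (a : A) : vecFun π ξ η a = inner ℂ ξ (π a η) := rfl

theorem vecFun_self_mem_span (ξ : H) :
    vecFun π ξ ξ ∈ Submodule.span ℂ (toLin '' {φ : WeakDual ℂ A | IsState φ}) := by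
  have hpos : ∀ a, 0 ≤ vecFun π ξ ξ (star a * a) := by
    intro a
    rw [vecFun_apply, map_mul, map_star]
    change 0 ≤ inner ℂ ξ (star (π a) (π a ξ))
    rw [ContinuousLinearMap.star_eq_adjoint, ContinuousLinearMap.adjoint_inner_right]
    rw [inner_self_eq_norm_sq_to_K]
    change 0 ≤ ((‖π a ξ‖ : ℝ) : ℂ) ^ 2
    exact_mod_cast sq_nonneg ‖π a ξ‖
  have hbd := norm_le_of_nonneg hpos
  rcases eq_or_ne (vecFun π ξ ξ 1) 0 with h0 | h0
  · have : vecFun π ξ ξ = 0 := LinearMap.ext fun a => by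
      have := hbd a
      rw [h0, Complex.zero_re, zero_mul] at this
      exact norm_le_zero_iff.1 this
    rw [this]
    exact zero_mem _
  · set t := vecFun π ξ ξ 1
    have ht : 0 ≤ t := by
      have := hpos 1
      rwa [star_one, mul_one] at this
    let f : WeakDual ℂ A := t⁻¹ • StrongDual.toWeakDual ((vecFun π ξ ξ).mkContinuous t.re hbd)
    have hf : IsState f := by
      refine isState_of_nonneg (fun a => ?_) (inv_mul_cancel₀ h0)
      change 0 ≤ t⁻¹ * vecFun π ξ ξ (star a * a)
      exact mul_nonneg (inv_nonneg.2 ht) (hpos a)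
    have : vecFun π ξ ξ = t • toLin f := LinearMap.ext fun a => by
      change _ = t * (t⁻¹ * vecFun π ξ ξ a)
      rw [mul_inv_cancel_left₀ h0]
    rw [this]
    exact Submodule.smul_mem _ _ (Submodule.subset_span ⟨f, hf, rfl⟩)

/-- Polarization reduces to the positive functionals with equal vectors. -/
theorem vecFun_mem_span (ξ η : H) :
    vecFun π ξ η ∈ Submodule.span ℂ (toLin '' {φ : WeakDual ℂ A | IsState φ}) := by
  have e : vecFun π ξ η = (2⁻¹ : ℂ) • ((vecFun π (ξ + η) (ξ + η) - vecFun π ξ ξ - vecFun π η η) -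
      Complex.I • (vecFun π (ξ + Complex.I • η) (ξ + Complex.I • η) - vecFun π ξ ξ -
        vecFun π η η)) := by
    ext a
    simp only [LinearMap.smul_apply, LinearMap.sub_apply, vecFun_apply, map_add, map_smul,
      inner_add_left, inner_add_right, inner_smul_left, inner_smul_right, smul_eq_mul,
      Complex.conj_I]
    linear_combination ((inner ℂ ξ (π a η) : ℂ) / 2 - inner ℂ η (π a ξ) / 2 -
      Complex.I * inner ℂ η (π a η) / 2) * Complex.I_mul_I
  rw [e]
  have m := vecFun_self_mem_span π
  exact Submodule.smul_mem _ _ (sub_mem (sub_mem (sub_mem (m _) (m _)) (m _))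
    (Submodule.smul_mem _ _ (sub_mem (sub_mem (m _) (m _)) (m _))))

end Rep

variable {A : Type u} {B : Type v} [CStarAlgebra A] [CStarAlgebra B]

namespace CStarTensorNorm

variable (ν : CStarTensorNorm A B)

theorem exists_norm_prodFun_le {f : A →ₗ[ℂ] ℂ} {g : B →ₗ[ℂ] ℂ}
    (hf : f ∈ Submodule.span ℂ (toLin '' {φ : WeakDual ℂ A | IsState φ}))
    (hg : g ∈ Submodule.span ℂ (toLin '' {φ : WeakDual ℂ B | IsState φ})) :
    ∃ C : ℝ, ∀ z, ‖prodFun f g z‖ ≤ C * ‖ν.incl z‖ := by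
  induction hf using Submodule.span_induction with
  | zero => exact ⟨0, fun z => by simp [prodFun]⟩
  | add f f' _ _ h h' =>
    obtain ⟨C, hC⟩ := h
    obtain ⟨D, hD⟩ := h'
    refine ⟨C + D, fun z => ?_⟩
    have : prodFun (f + f') g z = prodFun f g z + prodFun f' g z := by
      simp [prodFun, TensorProduct.map_add_left]
    rw [this, add_mul]
    exact (norm_add_le _ _).trans (add_le_add (hC z) (hD z))
  | smul r f _ h =>
    obtain ⟨C, hC⟩ := h
    refine ⟨‖r‖ * C, fun z => ?_⟩
    have : prodFun (r • f) g z = r * prodFun f g z := by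
      simp [prodFun, TensorProduct.map_smul_left]
    rw [this, norm_mul, mul_assoc]
    exact mul_le_mul_of_nonneg_left (hC z) (norm_nonneg _)
  | mem f hf =>
    obtain ⟨φ, hφ, rfl⟩ := hf
    induction hg using Submodule.span_induction with
    | zero => exact ⟨0, fun z => by simp [prodFun]⟩
    | add f f' _ _ h h' =>
      obtain ⟨C, hC⟩ := h
      obtain ⟨D, hD⟩ := h'
      refine ⟨C + D, fun z => ?_⟩
      have : prodFun (toLin φ) (f + f') z = prodFun (toLin φ) f z + prodFun (toLin φ) f' z := by
        simp [prodFun, TensorProduct.map_add_right]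
      rw [this, add_mul]
      exact (norm_add_le _ _).trans (add_le_add (hC z) (hD z))
    | smul r f _ h =>
      obtain ⟨C, hC⟩ := h
      refine ⟨‖r‖ * C, fun z => ?_⟩
      have : prodFun (toLin φ) (r • f) z = r * prodFun (toLin φ) f z := by
        simp [prodFun, TensorProduct.map_smul_right]
      rw [this, norm_mul, mul_assoc]
      exact mul_le_mul_of_nonneg_left (hC z) (norm_nonneg _)
    | mem g hg =>
      obtain ⟨ψ, hψ, rfl⟩ := hg
      exact ⟨1, fun z => by rw [one_mul]; exact ν.norm_prodFun_le hφ hψ z⟩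

variable {H : Type*} [NormedAddCommGroup H] [InnerProductSpace ℂ H] [CompleteSpace H]
    {K : Type*} [NormedAddCommGroup K] [InnerProductSpace ℂ K] [CompleteSpace K]
    (π : A →⋆ₙₐ[ℂ] (H →L[ℂ] H)) (ρ : B →⋆ₙₐ[ℂ] (K →L[ℂ] K))

/-- A matrix coefficient is a finite sum of products of vector functionals, and these are
combinations of product states. The constant depends on the two vectors. -/
theorem exists_norm_inner_tensorRep_le (ζ ζ' : H ⊗[ℂ] K) :
    ∃ C : ℝ, ∀ z, ‖(inner ℂ ζ (tensorRep π ρ z ζ') : ℂ)‖ ≤ C * ‖ν.incl z‖ := by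
  have add_case : ∀ F G : A ⊗[ℂ] B → ℂ, (∃ C : ℝ, ∀ z, ‖F z‖ ≤ C * ‖ν.incl z‖) →
      (∃ C : ℝ, ∀ z, ‖G z‖ ≤ C * ‖ν.incl z‖) → ∃ C : ℝ, ∀ z, ‖F z + G z‖ ≤ C * ‖ν.incl z‖ := by
    rintro F G ⟨C, hC⟩ ⟨D, hD⟩
    exact ⟨C + D, fun z => by
      rw [add_mul]; exact (norm_add_le _ _).trans (add_le_add (hC z) (hD z))⟩
  induction ζ with
  | zero => exact ⟨0, fun z => by simp⟩
  | add x y hx hy => simp only [inner_add_left]; exact add_case _ _ hx hy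
  | tmul h k =>
    induction ζ' with
    | zero => exact ⟨0, fun z => by simp⟩
    | add x y hx hy => simp only [map_add, inner_add_right]; exact add_case _ _ hx hy
    | tmul h' k' =>
      obtain ⟨C, hC⟩ := ν.exists_norm_prodFun_le (vecFun_mem_span π h h') (vecFun_mem_span ρ k k')
      refine ⟨C, fun z => ?_⟩
      have : (inner ℂ (h ⊗ₜ[ℂ] k) (tensorRep π ρ z (h' ⊗ₜ k')) : ℂ) =
          prodFun (vecFun π h h') (vecFun ρ k k') z := by
        induction z with
        | zero => simp
        | add x y hx hy =>
          rw [map_add, map_add, ← hx, ← hy]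
          exact inner_add_right _ _ _
        | tmul a b => rw [tensorRep_tmul_apply, TensorProduct.inner_tmul]; rfl
      rw [this]
      exact hC z

/-- Every C*-norm dominates the norms of the tensor products of representations. -/
theorem norm_tensorRep_le (z : A ⊗[ℂ] B) : ‖tensorRep π ρ z‖ ≤ ‖ν.incl z‖ := by
  refine ContinuousLinearMap.opNorm_le_of_unit_norm (norm_nonneg _) fun ζ hζ => ?_
  -- The bound for this one coefficient, applied to the powers `y ^ 2 ^ (k + 1)` of a self-adjoint
  -- `y`, loses its constant `C` when `2 ^ k`-th roots are taken.
  obtain ⟨C, hC⟩ := ν.exists_norm_inner_tensorRep_le π ρ ζ ζ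
  set y := star z * z
  have hy : star y = y := by rw [star_mul, star_star]
  have hpow : ∀ k : ℕ, ‖tensorRep π ρ y ζ‖ ^ 2 ^ k ≤ ‖tensorRep π ρ (y ^ 2 ^ k) ζ‖ := by
    intro k
    induction k with
    | zero => simp
    | succ k ih =>
      have h1 := norm_sq_tensorRep π ρ (y ^ 2 ^ k) ζ
      rw [star_pow, hy, ← pow_add, ← two_mul, ← pow_succ', hζ, one_mul] at h1
      rw [pow_succ, pow_mul]
      exact (pow_le_pow_left₀ (by positivity) ih 2).trans h1
  have hle : ‖tensorRep π ρ y ζ‖ ^ 2 ≤ ‖ν.incl y‖ ^ 2 := by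
    refine le_of_pow_two_pow_le (C := C) (by positivity) fun k => ?_
    have h1 : ‖tensorRep π ρ (y ^ 2 ^ k) ζ‖ ^ 2 ≤
        ‖(inner ℂ ζ (tensorRep π ρ (y ^ 2 ^ (k + 1)) ζ) : ℂ)‖ := by
      have h2 := inner_tensorRep π ρ (y ^ 2 ^ k) ζ (tensorRep π ρ (y ^ 2 ^ k) ζ)
      rw [star_pow, hy] at h2
      rw [pow_succ 2 k, pow_mul y, sq (y ^ 2 ^ k), tensorRep_mul, ContinuousLinearMap.mul_def,
        ContinuousLinearMap.comp_apply, ← h2, norm_sq_eq_re_inner (𝕜 := ℂ)]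
      exact RCLike.re_le_norm _
    calc (‖tensorRep π ρ y ζ‖ ^ 2) ^ 2 ^ k = (‖tensorRep π ρ y ζ‖ ^ 2 ^ k) ^ 2 := by
          rw [← pow_mul, ← pow_mul, mul_comm]
      _ ≤ ‖tensorRep π ρ (y ^ 2 ^ k) ζ‖ ^ 2 := pow_le_pow_left₀ (by positivity) (hpow k) 2
      _ ≤ C * ‖ν.incl (y ^ 2 ^ (k + 1))‖ := h1.trans (hC _)
      _ = C * (‖ν.incl y‖ ^ 2) ^ 2 ^ k := by
          have hself : IsSelfAdjoint (ν.incl y) := by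
            rw [IsSelfAdjoint, ← map_star, hy]
          rw [map_pow, hself.norm_pow_two_pow, ← pow_mul, pow_succ']
  have h3 := norm_sq_tensorRep π ρ z ζ
  rw [hζ, one_mul] at h3
  have h4 : ‖tensorRep π ρ y ζ‖ ≤ ‖ν.incl y‖ :=
    (abs_le_of_sq_le_sq' hle (norm_nonneg _)).2
  have h5 : ‖ν.incl y‖ = ‖ν.incl z‖ ^ 2 := by
    rw [map_mul, map_star, CStarRing.norm_star_mul_self, sq]
  exact (abs_le_of_sq_le_sq' ((h3.trans h4).trans_eq h5) (norm_nonneg _)).2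

end CStarTensorNorm

end Spatial

/-! ### The spatial norm and asymptotic homomorphisms -/

section MinNorm

variable {A : Type u} {C : Type v} [CStarAlgebra A] [CStarAlgebra C]

theorem norm_tensorRep_star_le {H : Type*} [NormedAddCommGroup H] [InnerProductSpace ℂ H]
    [CompleteSpace H] {K : Type*} [NormedAddCommGroup K] [InnerProductSpace ℂ K] [CompleteSpace K]
    (π : A →⋆ₙₐ[ℂ] (H →L[ℂ] H)) (ρ : C →⋆ₙₐ[ℂ] (K →L[ℂ] K)) (z : A ⊗[ℂ] C) :
    ‖tensorRep π ρ (star z)‖ ≤ ‖tensorRep π ρ z‖ := by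
  refine ContinuousLinearMap.opNorm_le_bound _ (ContinuousLinearMap.opNorm_nonneg _) fun ζ => ?_
  have h1 := norm_sq_tensorRep π ρ (star z) ζ
  rw [star_star, tensorRep_mul, ContinuousLinearMap.mul_def, ContinuousLinearMap.comp_apply] at h1
  have h2 := (tensorRep π ρ z).le_opNorm (tensorRep π ρ (star z) ζ)
  rcases (norm_nonneg (tensorRep π ρ (star z) ζ)).eq_or_lt with h0 | h0
  · rw [← h0]; positivity
  · refine le_of_mul_le_mul_right ?_ h0
    calc _ = ‖tensorRep π ρ (star z) ζ‖ ^ 2 := (sq _).symm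
      _ ≤ ‖ζ‖ * (‖tensorRep π ρ z‖ * ‖tensorRep π ρ (star z) ζ‖) :=
        h1.trans (mul_le_mul_of_nonneg_left h2 (norm_nonneg _))
      _ = _ := by ring

/-- Finiteness of the supremum in `minNorm` has to be checked, since an unbounded real supremum has
the default value `0`. -/
theorem exists_norm_tensorRep_le (z : A ⊗[ℂ] C) :
    ∃ R : ℝ, ∀ (H : Type u) [NormedAddCommGroup H] [InnerProductSpace ℂ H] [CompleteSpace H]
      (K : Type v) [NormedAddCommGroup K] [InnerProductSpace ℂ K] [CompleteSpace K]
      (π : A →⋆ₙₐ[ℂ] (H →L[ℂ] H)) (ρ : C →⋆ₙₐ[ℂ] (K →L[ℂ] K)), ‖tensorRep π ρ z‖ ≤ R := by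
  induction z with
  | zero => exact ⟨0, fun _ _ _ _ _ _ _ _ π ρ => by
    rw [map_zero, ContinuousLinearMap.opNorm_zero]⟩
  | add x y hx hy =>
    obtain ⟨R, hR⟩ := hx
    obtain ⟨S, hS⟩ := hy
    refine ⟨R + S, fun H _ _ _ K _ _ _ π ρ => ?_⟩
    rw [map_add]
    exact (ContinuousLinearMap.opNorm_add_le _ _).trans (add_le_add (hR H K π ρ) (hS H K π ρ))
  | tmul a c =>
    refine ⟨‖a‖ * ‖c‖, fun H _ _ _ K _ _ _ π ρ => (TensorProduct.norm_mapL_le _ _).trans ?_⟩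
    exact mul_le_mul (NonUnitalStarAlgHom.norm_apply_le π a)
      (NonUnitalStarAlgHom.norm_apply_le ρ c) (norm_nonneg _) (norm_nonneg _)

theorem norm_tensorRep_le_minNorm {H : Type u} [NormedAddCommGroup H] [InnerProductSpace ℂ H]
    [CompleteSpace H] {K : Type v} [NormedAddCommGroup K] [InnerProductSpace ℂ K] [CompleteSpace K]
    (π : A →⋆ₙₐ[ℂ] (H →L[ℂ] H)) (ρ : C →⋆ₙₐ[ℂ] (K →L[ℂ] K)) (z : A ⊗[ℂ] C) :
    ‖tensorRep π ρ z‖ ≤ minNorm z := by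
  obtain ⟨R, hR⟩ := exists_norm_tensorRep_le z
  refine le_csSup ⟨R, ?_⟩ ⟨H, _, _, inferInstance, K, _, _, inferInstance, π, ρ, rfl⟩
  rintro _ ⟨H, _, _, _, K, _, _, _, π, ρ, rfl⟩
  exact hR H K π ρ

theorem minNorm_le {z : A ⊗[ℂ] C} {R : ℝ} (hR : 0 ≤ R)
    (h : ∀ (H : Type u) [NormedAddCommGroup H] [InnerProductSpace ℂ H] [CompleteSpace H]
      (K : Type v) [NormedAddCommGroup K] [InnerProductSpace ℂ K] [CompleteSpace K]
      (π : A →⋆ₙₐ[ℂ] (H →L[ℂ] H)) (ρ : C →⋆ₙₐ[ℂ] (K →L[ℂ] K)), ‖tensorRep π ρ z‖ ≤ R) :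
    minNorm z ≤ R := by
  refine Real.sSup_le ?_ hR
  rintro _ ⟨H, _, _, _, K, _, _, _, π, ρ, rfl⟩
  exact h H K π ρ

theorem minNorm_nonneg (z : A ⊗[ℂ] C) : 0 ≤ minNorm z := by
  refine Real.sSup_nonneg ?_
  rintro _ ⟨H, _, _, _, K, _, _, _, π, ρ, rfl⟩
  exact ContinuousLinearMap.opNorm_nonneg _

theorem minNorm_mul_le (z w : A ⊗[ℂ] C) : minNorm (z * w) ≤ minNorm z * minNorm w := by
  refine minNorm_le (mul_nonneg (minNorm_nonneg _) (minNorm_nonneg _))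
    fun H _ _ _ K _ _ _ π ρ => ?_
  rw [tensorRep_mul]
  exact (ContinuousLinearMap.opNorm_comp_le _ _).trans
    (mul_le_mul (norm_tensorRep_le_minNorm π ρ z) (norm_tensorRep_le_minNorm π ρ w)
      (ContinuousLinearMap.opNorm_nonneg _) (minNorm_nonneg _))

theorem minNorm_star_mul_self_le (z : A ⊗[ℂ] C) : minNorm (star z * z) ≤ minNorm z ^ 2 := by
  refine (minNorm_mul_le _ _).trans ?_
  rw [sq]
  refine mul_le_mul_of_nonneg_right (minNorm_le (minNorm_nonneg _) fun H _ _ _ K _ _ _ π ρ => ?_)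
    (minNorm_nonneg _)
  exact (norm_tensorRep_star_le π ρ z).trans (norm_tensorRep_le_minNorm π ρ z)

end MinNorm

/-! ### Removing constants from asymptotic bounds -/

section PowerTrick

variable {E : Type*} [Ring E] [StarRing E] [Algebra ℂ E] {I : Type*} {l : Filter I} {m : I → ℕ}
  {S : ∀ i, E →ₗ[ℂ] Mat (m i)}

/-- For an asymptotic homomorphism, a bound up to a constant by a submultiplicative quantity implies
the bound with constant one. -/
theorem IsAsympHom.eventually_norm_le (hS : IsAsympHom l S) {p : E → ℝ} (hp0 : ∀ y, 0 ≤ p y)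
    (hp : ∀ y, p (y * y) ≤ p y ^ 2) (hps : ∀ y, p (star y * y) ≤ p y ^ 2) {M : ℝ} (hM0 : 0 ≤ M)
    (hM : ∀ w, ∀ ε : ℝ, 0 < ε → ∀ᶠ i in l, ‖S i w‖ ≤ M * p w + ε) (u : E) {ε : ℝ} (hε : 0 < ε) :
    ∀ᶠ i in l, ‖S i u‖ ≤ p u + ε := by
  by_contra hcon
  have hfr : ∃ᶠ i in l, p u + ε < ‖S i u‖ := by
    simpa only [Filter.not_eventually, not_le] using hcon
  set y := star u * u
  have hpow : ∀ k : ℕ, p (y ^ 2 ^ k) ≤ (p u ^ 2) ^ 2 ^ k := by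
    intro k
    induction k with
    | zero => simpa using hps u
    | succ k ih =>
      rw [pow_succ 2 k, pow_mul y, pow_mul, sq (y ^ 2 ^ k)]
      exact (hp _).trans (pow_le_pow_left₀ (hp0 _) ih 2)
  have hbd : EvBdd l fun i => star (S i u) * S i u := (hS.bdd u).conj.mul (hS.bdd u)
  have hae : ∀ k : ℕ, EvBdd l (fun i => (star (S i u) * S i u) ^ 2 ^ k) ∧
      AsympEq l (fun i => S i (y ^ 2 ^ k)) (fun i => (star (S i u) * S i u) ^ 2 ^ k) := by
    intro k
    induction k with
    | zero =>
      simp only [pow_zero, pow_one]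
      exact ⟨hbd, (hS.asymp_mul _ _).trans ((hS.asymp_star u).mul (.refl _) (hS.bdd u).conj
        (hS.bdd u))⟩
    | succ k ih =>
      simp only [pow_succ 2 k, pow_mul _ (2 ^ k) 2, sq (_ ^ 2 ^ k)]
      exact ⟨ih.1.mul ih.1, (hS.asymp_mul _ _).trans (ih.2.mul ih.2 ih.1 (hS.bdd _))⟩
  have hr0 : 0 ≤ p u + ε := add_nonneg (hp0 u) hε.le
  have key : (p u + ε) ^ 2 ≤ p u ^ 2 := by
    -- Here `k` and `δ` are fixed before the index `i` is chosen, so only finitely many eventual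
    -- conditions meet the frequent one; then `δ → 0`, and finally `k → ∞` removes `M`.
    refine le_of_pow_two_pow_le (C := M) (by positivity) fun k => ?_
    refine le_of_forall_pos_le_add fun δ hδ => ?_
    obtain ⟨i, hi, h1, h2⟩ := (hfr.and_eventually (((hae k).2.eventually_le (half_pos hδ)).and
      (hM (y ^ 2 ^ k) (δ / 2) (half_pos hδ)))).exists
    have h3 : ‖(star (S i u) * S i u) ^ 2 ^ k‖ = (‖S i u‖ ^ 2) ^ 2 ^ k := by
      rw [(IsSelfAdjoint.star_mul_self (S i u)).norm_pow_two_pow, CStarRing.norm_star_mul_self, sq]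
    calc ((p u + ε) ^ 2) ^ 2 ^ k ≤ (‖S i u‖ ^ 2) ^ 2 ^ k :=
          pow_le_pow_left₀ (by positivity) (pow_le_pow_left₀ hr0 hi.le 2) _
      _ = ‖(star (S i u) * S i u) ^ 2 ^ k‖ := h3.symm
      _ ≤ ‖S i (y ^ 2 ^ k)‖ + ‖S i (y ^ 2 ^ k) - (star (S i u) * S i u) ^ 2 ^ k‖ := norm_le_insert _ _
      _ ≤ M * p (y ^ 2 ^ k) + δ / 2 + δ / 2 := add_le_add h2 h1
      _ ≤ M * (p u ^ 2) ^ 2 ^ k + δ := by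
          have := mul_le_mul_of_nonneg_left (hpow k) hM0
          linarith
  have := (abs_le_of_sq_le_sq' key (hp0 u)).2
  linarith

end PowerTrick

/-! ### Tensoring with a fixed matrix representation -/

section Evaluation

variable {A : Type u} {C : Type} [CStarAlgebra A] [CStarAlgebra C]

/-- The matrix entries of `(id ⊗ ρ)(w)`. -/
noncomputable def tensorEntry {n : ℕ} (ρ : C →⋆ₐ[ℂ] Mat n) (p q : Fin n) : A ⊗[ℂ] C →ₗ[ℂ] A :=
  (TensorProduct.rid ℂ A).toLinearMap ∘ₗ
    TensorProduct.map LinearMap.id (Matrix.entryLinearMap ℂ ℂ p q ∘ₗ ρ.toAlgHom.toLinearMap)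

theorem tensorEntry_tmul {n : ℕ} (ρ : C →⋆ₐ[ℂ] Mat n) (p q : Fin n) (a : A) (c : C) :
    tensorEntry ρ p q (a ⊗ₜ c) = ρ c p q • a := rfl

theorem kronMap_eq_sum {m n : ℕ} (s : A →ₗ[ℂ] Mat m) (ρ : C →⋆ₐ[ℂ] Mat n) (w : A ⊗[ℂ] C) :
    kronMap s ρ.toAlgHom.toLinearMap w = ∑ p, ∑ q, kronLeft m n (s (tensorEntry ρ p q w)) *
      kronRight m n (Matrix.single p q 1) := by
  induction w with
  | zero => simp
  | add x y hx hy => simp only [map_add, hx, hy, add_mul, Finset.sum_add_distrib]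
  | tmul a c =>
    simp only [kronMap_tmul, tensorEntry_tmul, map_smul, smul_mul_assoc]
    have : ρ c = ∑ p, ∑ q, ρ c p q • Matrix.single p q (1 : ℂ) := by
      simpa using Matrix.matrix_eq_sum_single (ρ c)
    change kronLeft m n (s a) * kronRight m n (ρ c) = _
    conv_lhs => rw [this]
    simp only [map_sum, map_smul, Finset.mul_sum, mul_smul_comm]

/-- In the GNS representation of a state attaining the norm of `a* a`, the cyclic vector `j 1`
satisfies `‖π a (j 1)‖ = ‖a‖`. The inner product of `π a (j 1)` with itself is then a coefficient of
`π ⊗ ρ'` at `w`, between vectors of norms `‖a‖` and `1`. -/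
theorem norm_tensorEntry_le {n : ℕ} (ρ : C →⋆ₐ[ℂ] Mat n) (p q : Fin n) (w : A ⊗[ℂ] C) :
    ‖tensorEntry ρ p q w‖ ≤ minNorm w := by
  set a := tensorEntry ρ p q w with ha
  rcases eq_or_ne ‖a‖ 0 with h0 | h0
  · rw [h0]; exact minNorm_nonneg w
  obtain ⟨φ, hφ, hφa⟩ : ∃ φ : WeakDual ℂ A, IsState φ ∧ φ (star a * a) = ((‖a‖ ^ 2 : ℝ) : ℂ) := by
    have h1 : ‖star (((‖a‖⁻¹ : ℝ) : ℂ) • a) * (((‖a‖⁻¹ : ℝ) : ℂ) • a)‖ = 1 := by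
      rw [CStarRing.norm_star_mul_self, norm_smul, Complex.norm_real, norm_inv, norm_norm,
        inv_mul_cancel₀ h0, one_mul]
    obtain ⟨φ, hφ, h2⟩ := exists_isState_eq_one h1
    refine ⟨φ, hφ, ?_⟩
    rw [star_smul, smul_mul_smul_comm, map_smul, smul_eq_mul] at h2
    have h3 : star ((‖a‖⁻¹ : ℝ) : ℂ) = ((‖a‖⁻¹ : ℝ) : ℂ) := Complex.conj_ofReal _
    have h4 : (‖a‖ : ℂ) ≠ 0 := by exact_mod_cast h0
    rw [h3] at h2
    push_cast at h2 ⊢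
    field_simp at h2
    exact h2
  obtain ⟨H, _, _, _, π, j, -, hj, hπ⟩ := hφ.exists_gns
  let ρ' : C →⋆ₐ[ℂ] (EuclideanSpace ℂ (Fin n) →L[ℂ] EuclideanSpace ℂ (Fin n)) :=
    (Matrix.toEuclideanCLM (n := Fin n) (𝕜 := ℂ)).toStarAlgHom.comp ρ
  have hρ' : ∀ c, (inner ℂ (EuclideanSpace.single p (1 : ℂ)) (ρ' c (EuclideanSpace.single q (1 : ℂ))) : ℂ) =
      ρ c p q := by
    intro c
    have h1 : (ρ' c (EuclideanSpace.single q (1 : ℂ))).ofLp p = ρ c p q := by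
      change (Matrix.toEuclideanCLM (n := Fin n) (𝕜 := ℂ) (ρ c)
        (EuclideanSpace.single q (1 : ℂ))).ofLp p = _
      rw [Matrix.ofLp_toEuclideanCLM]
      simp
    rw [EuclideanSpace.inner_single_left, map_one, one_mul, h1]
  have key : ∀ η, (inner ℂ (η ⊗ₜ EuclideanSpace.single p (1 : ℂ)) (tensorRep
      (π : A →⋆ₙₐ[ℂ] (H →L[ℂ] H)) (ρ' : C →⋆ₙₐ[ℂ] _) w
        (j 1 ⊗ₜ EuclideanSpace.single q (1 : ℂ))) : ℂ) = inner ℂ η (π a (j 1)) := by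
    intro η
    rw [ha]
    clear_value a
    clear ha hφa h0
    induction w with
    | zero => simp
    | add x y hx hy =>
      rw [map_add, map_add, map_add]
      rw [add_apply, add_apply, inner_add_right, inner_add_right, ← hx, ← hy]
    | tmul b c =>
      rw [tensorRep_tmul_apply, TensorProduct.inner_tmul, tensorEntry_tmul, map_smul]
      change inner ℂ η (π b (j 1)) * inner ℂ _ (ρ' c _) = inner ℂ η (ρ c p q • π b (j 1))
      rw [hρ', inner_smul_right, mul_comm]
  have hj1 : ‖j 1‖ = 1 := by
    have h1 : ‖j 1‖ ^ 2 = 1 := by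
      rw [norm_sq_eq_re_inner (𝕜 := ℂ), hj, star_one, one_mul, hφ.2]; simp
    exact (pow_eq_one_iff_of_nonneg (norm_nonneg _) two_ne_zero).1 h1
  have hη : ‖π a (j 1)‖ = ‖a‖ := by
    have h1 : ‖π a (j 1)‖ ^ 2 = ‖a‖ ^ 2 := by
      rw [norm_sq_eq_re_inner (𝕜 := ℂ), hπ, mul_one, hj, hφa]; exact Complex.ofReal_re _
    exact (sq_eq_sq₀ (norm_nonneg _) (norm_nonneg _)).1 h1
  have h1 := norm_inner_le_norm (𝕜 := ℂ) (π a (j 1) ⊗ₜ[ℂ] EuclideanSpace.single p (1 : ℂ))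
    (tensorRep (π : A →⋆ₙₐ[ℂ] (H →L[ℂ] H)) (ρ' : C →⋆ₙₐ[ℂ] _) w
      (j 1 ⊗ₜ EuclideanSpace.single q (1 : ℂ)))
  have h2 := (tensorRep (π : A →⋆ₙₐ[ℂ] (H →L[ℂ] H)) (ρ' : C →⋆ₙₐ[ℂ] _) w).le_opNorm
    (j 1 ⊗ₜ EuclideanSpace.single q (1 : ℂ))
  rw [key, TensorProduct.norm_tmul, hη, PiLp.norm_single, norm_one, mul_one,
    inner_self_eq_norm_sq_to_K, hη] at h1
  rw [TensorProduct.norm_tmul, hj1, PiLp.norm_single, norm_one, mul_one, mul_one] at h2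
  have h3 : ‖((‖a‖ : ℝ) : ℂ) ^ 2‖ = ‖a‖ * ‖a‖ := by
    rw [norm_pow, Complex.norm_real, norm_norm, sq]
  have h4 : ‖a‖ * ‖a‖ ≤ ‖a‖ * minNorm w :=
    (h3.symm.trans_le h1).trans (mul_le_mul_of_nonneg_left
      (h2.trans (norm_tensorRep_le_minNorm _ _ w)) (norm_nonneg _))
  exact le_of_mul_le_mul_left h4 (lt_of_le_of_ne (norm_nonneg _) h0.symm)

theorem isAsympHom_const {I : Type*} (l : Filter I) {n : ℕ} (ρ : C →⋆ₐ[ℂ] Mat n) :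
    IsAsympHom l fun _ : I => ρ.toAlgHom.toLinearMap where
  asymp_one := .of_eq fun _ => map_one ρ
  asymp_mul a b := .of_eq fun _ => map_mul ρ a b
  asymp_star a := .of_eq fun _ => map_star ρ a
  bdd a := ⟨‖ρ a‖, Eventually.of_forall fun _ => le_rfl⟩

/-- Tensor products of a contractive asymptotic homomorphism with a matrix representation are
asymptotically contractive for the spatial norm. -/
theorem eventually_norm_kronMap_le {I : Type*} {l : Filter I} {m : I → ℕ}
    {s : ∀ i, A →ₗ[ℂ] Mat (m i)} (hs : IsAsympHom l s) (hc : Contractive l s) {n : ℕ}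
    (ρ : C →⋆ₐ[ℂ] Mat n) (u : A ⊗[ℂ] C) {ε : ℝ} (hε : 0 < ε) :
    ∀ᶠ i in l, ‖kronMap (s i) ρ.toAlgHom.toLinearMap u‖ ≤ minNorm u + ε := by
  -- Expanding in matrix units bounds the norm by `M` times the spatial norm; the power trick
  -- replaces `M` by one.
  set M : ℝ := ∑ p : Fin n, ∑ q : Fin n, ‖(Matrix.single p q 1 : Mat n)‖
  have hM0 : 0 ≤ M := Finset.sum_nonneg fun p _ => Finset.sum_nonneg fun q _ => norm_nonneg _
  refine (hs.kron (isAsympHom_const l ρ)).eventually_norm_le minNorm_nonneg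
    (fun y => (minNorm_mul_le y y).trans_eq (sq _).symm) minNorm_star_mul_self_le hM0
    (fun w δ hδ => ?_) u hε
  have hδ' : 0 < δ / (M + 1) := by positivity
  have hall : ∀ᶠ i in l, ∀ p q, ‖s i (tensorEntry ρ p q w)‖ ≤ minNorm w + δ / (M + 1) := by
    simp only [eventually_all]
    intro p q
    filter_upwards [hc (tensorEntry ρ p q w) _ hδ'] with i hi
    linarith [norm_tensorEntry_le ρ p q w]
  filter_upwards [hall] with i hi
  rw [kronMap_eq_sum]
  calc _ ≤ ∑ p, ∑ q, (minNorm w + δ / (M + 1)) * ‖(Matrix.single p q 1 : Mat n)‖ := by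
        refine norm_sum_le_of_le _ fun p _ => norm_sum_le_of_le _ fun q _ => ?_
        exact (norm_kron_le _ _ _ _).trans (mul_le_mul_of_nonneg_right (hi p q) (norm_nonneg _))
    _ = (minNorm w + δ / (M + 1)) * M := by
        simp only [M, Finset.mul_sum]
    _ ≤ M * minNorm w + δ := by
        have : δ / (M + 1) * M ≤ δ := by
          rw [div_mul_eq_mul_div, div_le_iff₀ (by positivity)]
          nlinarith
        linarith

end Evaluation

/-! ### Copies of C*-algebras in a small universe -/

section SmallCopy

/-- A C*-algebra of small cardinality is isomorphic to one in the small universe. -/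
theorem exists_starAlgEquiv_of_small (B : Type v) [CStarAlgebra B] [Small.{w} B] :
    ∃ (D : Type w) (_ : CStarAlgebra D), Nonempty (B ≃⋆ₐ[ℂ] D) := by
  let E : Shrink.{w} B ≃ B := (equivShrink B).symm
  let D := Shrink.{w} B
  let _ : Ring D := E.ring
  let _ : Algebra ℂ D := E.algebra ℂ
  let F : D ≃ₐ[ℂ] B := E.algEquiv ℂ
  let _ : StarRing D :=
    { star := fun x => F.symm (star (F x))
      star_involutive := fun x => by simp
      star_mul := fun x y => F.injective (by simp)
      star_add := fun x y => F.injective (by simp) }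
  have hstar : ∀ x : D, F (star x) = star (F x) := fun x => F.apply_symm_apply _
  let _ : NormedRing D := NormedRing.induced D B F F.injective
  have hnorm : ∀ x : D, ‖x‖ = ‖F x‖ := fun _ => rfl
  let _ : NormedAlgebra ℂ D := NormedAlgebra.induced ℂ D B F
  have hiso : Isometry F := AddMonoidHomClass.isometry_of_norm F fun x => (hnorm x).symm
  have : CompleteSpace D :=
    (IsometryEquiv.mk F.toEquiv hiso).completeSpace
  have : CStarRing D := ⟨fun x => by
    rw [hnorm, hnorm, map_mul, hstar, CStarRing.norm_star_mul_self]⟩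
  have : StarModule ℂ D := ⟨fun r x => F.injective (by
    rw [hstar, map_smul, map_smul, hstar, star_smul])⟩
  let _ : CStarAlgebra D := {}
  exact ⟨D, inferInstance, ⟨StarAlgEquiv.symm (StarAlgEquiv.ofAlgEquiv F hstar)⟩⟩

end SmallCopy

/-! ### An isometric asymptotic homomorphism as an extension by null sequences -/

section Lift

open scoped ENNReal

variable {B : Type v} [CStarAlgebra B] {n : ℕ → ℕ} {t : ∀ k, B →ₗ[ℂ] Mat (n k)}

noncomputable instance instCStarAlgebraLp [∀ k, Nontrivial (Mat (n k))] :
    CStarAlgebra (lp (fun k => Mat (n k)) ∞) where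

/-- The sequences that are asymptotic to the images of some element. -/
def asympRange [∀ k, Nontrivial (Mat (n k))] (ht : IsAsympHom atTop t) :
    StarSubalgebra ℂ (lp (fun k => Mat (n k)) ∞) where
  carrier := {c | ∃ b, AsympEq atTop (fun k => c k) (fun k => t k b)}
  mul_mem' := by
    rintro c d ⟨a, ha⟩ ⟨b, hb⟩
    refine ⟨a * b, AsympEq.trans ?_ (ht.asymp_mul a b).symm⟩
    exact ha.mul hb (ht.bdd a) (hb.evBdd (ht.bdd b))
  add_mem' := by
    rintro c d ⟨a, ha⟩ ⟨b, hb⟩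
    refine ⟨a + b, ?_⟩
    simp only [map_add]
    exact ha.add hb
  algebraMap_mem' r := by
    refine ⟨algebraMap ℂ B r, ?_⟩
    simp only [Algebra.algebraMap_eq_smul_one, map_smul]
    exact ht.asymp_one.symm.smul r
  star_mem' := by
    rintro c ⟨a, ha⟩
    exact ⟨star a, ha.conj.trans (ht.asymp_star a).symm⟩

theorem eq_of_asympEq (hn : ∀ b, Tendsto (fun k => ‖t k b‖) atTop (𝓝 ‖b‖)) {a b : B}
    (h : AsympEq atTop (fun k => t k a) (fun k => t k b)) : a = b := by
  have h1 := hn (a - b)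
  simp only [map_sub] at h1
  exact sub_eq_zero.1 (norm_eq_zero.1 (tendsto_nhds_unique h1 h))

/-- Since `t` is isometric in the limit, distances between the elements represented are at most
distances between the sequences; a convergent sequence of members therefore gives a Cauchy sequence
in `B`. -/
theorem isClosed_asympRange [∀ k, Nontrivial (Mat (n k))] (ht : IsAsympHom atTop t)
    (hn : ∀ b, Tendsto (fun k => ‖t k b‖) atTop (𝓝 ‖b‖)) :
    IsClosed (asympRange ht : Set (lp (fun k => Mat (n k)) ∞)) := by
  refine isClosed_of_closure_subset fun c hc => ?_
  obtain ⟨d, hd, hdc⟩ := mem_closure_iff_seq_limit.1 hc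
  choose b hb using hd
  have hle : ∀ i j, ‖b i - b j‖ ≤ ‖d i - d j‖ := by
    intro i j
    have h1 : Tendsto (fun k => ‖d i k - d j k‖) atTop (𝓝 ‖b i - b j‖) := by
      refine ((hb i).sub (hb j)).tendsto_norm ?_
      simpa only [map_sub] using hn (b i - b j)
    exact le_of_tendsto' h1 fun k => lp.norm_apply_le_norm ENNReal.top_ne_zero (d i - d j) k
  have hcau : CauchySeq b := by
    rw [Metric.cauchySeq_iff]
    intro ε hε
    obtain ⟨N, hN⟩ := Metric.cauchySeq_iff.1 hdc.cauchySeq ε hε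
    refine ⟨N, fun i hi j hj => ?_⟩
    rw [dist_eq_norm]
    exact (hle i j).trans_lt (by rw [← dist_eq_norm]; exact hN i hi j hj)
  obtain ⟨b₀, hb₀⟩ := cauchySeq_tendsto_of_complete hcau
  refine ⟨b₀, asympEq_of_eventually_le fun ε hε => ?_⟩
  have hε4 : 0 < ε / 4 := by positivity
  obtain ⟨i, hi1, hi2⟩ := ((hdc.eventually (Metric.ball_mem_nhds c hε4)).and
    (hb₀.eventually (Metric.ball_mem_nhds b₀ hε4))).exists
  rw [dist_eq_norm] at hi1 hi2
  filter_upwards [(hb i).eventually_le hε4,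
    ((hn (b i - b₀)).eventually (gt_mem_nhds hi2))] with k h1 h2
  have h3 : ‖d i k - c k‖ ≤ ‖d i - c‖ := lp.norm_apply_le_norm ENNReal.top_ne_zero (d i - c) k
  rw [map_sub] at h2
  calc ‖c k - t k b₀‖ = ‖-(d i k - c k) + (d i k - t k (b i)) + (t k (b i) - t k b₀)‖ := by
        congr 1; abel
    _ ≤ ‖d i k - c k‖ + ‖d i k - t k (b i)‖ + ‖t k (b i) - t k b₀‖ := by
        refine (norm_add₃_le).trans_eq ?_
        rw [norm_neg]
    _ ≤ ε := by linarith

/-- An isometric asymptotic homomorphism of `B` into matrix algebras presents a copy of `B` as a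
quotient of an algebra of bounded sequences, by an ideal of sequences tending to zero. -/
theorem exists_asympLift (hpos : ∀ k, 0 < n k) (ht : IsAsympHom atTop t)
    (hn : ∀ b, Tendsto (fun k => ‖t k b‖) atTop (𝓝 ‖b‖)) :
    ∃ (C D : Type) (_ : CStarAlgebra C) (_ : CStarAlgebra D) (q : C →⋆ₐ[ℂ] D) (f : B →⋆ₐ[ℂ] D)
      (ev : ∀ k, C →⋆ₐ[ℂ] Mat (n k)) (T : B →ₗ[ℂ] C), Function.Surjective q ∧
      (∀ k b, ev k (T b) = t k b) ∧ (∀ b, q (T b) = f b) ∧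
      ∀ c, q c = 0 → Tendsto (fun k => ‖ev k c‖) atTop (𝓝 0) := by
  have hne : ∀ k, Nonempty (Fin (n k)) := fun k => ⟨⟨0, hpos k⟩⟩
  have hnt : ∀ k, Nontrivial (Mat (n k)) := fun k => inferInstance
  let C := asympRange ht
  have hC : IsClosed (C : Set (lp (fun k => Mat (n k)) ∞)) := isClosed_asympRange ht hn
  let _ : CStarAlgebra C := StarSubalgebra.cstarAlgebra C (h_closed := hC)
  let T : B →ₗ[ℂ] C :=
    { toFun := fun b => ⟨⟨fun k => t k b, memℓp_infty (hn b).bddAbove_range⟩, b, .refl _⟩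
      map_add' := fun a b => Subtype.ext (Subtype.ext (funext fun k => map_add (t k) a b))
      map_smul' := fun r a => Subtype.ext (Subtype.ext (funext fun k => map_smul (t k) r a)) }
  have hTinj : Function.Injective T := fun a b h => by
    refine eq_of_asympEq hn (.of_eq fun k => ?_)
    exact congrFun (congrArg Subtype.val (congrArg Subtype.val h)) k
  -- Exactness is tested on algebras in the lowest universe; `B` embeds in sequences of matrices and
  -- so has a copy there.
  have : Small.{0} B := small_of_injective hTinj
  obtain ⟨D, _, ⟨e⟩⟩ := exists_starAlgEquiv_of_small.{v, 0} B
  choose g hg using fun c : C => c.2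
  have hguniq : ∀ (c : C) (b : B), AsympEq atTop (fun k => c.1 k) (fun k => t k b) → g c = b :=
    fun c b h => eq_of_asympEq hn ((hg c).symm.trans h)
  let q₀ : C →⋆ₐ[ℂ] B :=
    { toFun := g
      map_one' := hguniq 1 1 ht.asymp_one.symm
      map_mul' := fun c d => hguniq _ _ (((hg c).mul (hg d) (ht.bdd _)
        ((hg d).evBdd (ht.bdd _))).trans (ht.asymp_mul _ _).symm)
      map_zero' := hguniq 0 0 (.of_eq fun k => (map_zero (t k)).symm)
      map_add' := fun c d => hguniq _ _ (((hg c).add (hg d)).trans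
        (.of_eq fun k => (map_add (t k) _ _).symm))
      commutes' := fun r => hguniq _ _ (by
        simp only [Algebra.algebraMap_eq_smul_one, map_smul]
        exact ht.asymp_one.symm.smul r)
      map_star' := fun c => hguniq _ _ ((hg c).conj.trans (ht.asymp_star _).symm) }
  have hqT : ∀ b, q₀ (T b) = b := fun b => hguniq _ _ (.refl _)
  let ev : ∀ k, C →⋆ₐ[ℂ] Mat (n k) := fun k =>
    { toFun := fun c => c.1 k
      map_one' := rfl
      map_mul' := fun _ _ => rfl
      map_zero' := rfl
      map_add' := fun _ _ => rfl
      commutes' := fun _ => rfl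
      map_star' := fun _ => rfl }
  refine ⟨C, D, inferInstance, inferInstance, e.toStarAlgHom.comp q₀, e.toStarAlgHom, ev, T,
    fun d => ⟨T (e.symm d), ?_⟩, fun k b => rfl, fun b => ?_, fun c hc => ?_⟩
  · change e (q₀ (T (e.symm d))) = d
    rw [hqT, StarAlgEquiv.apply_symm_apply]
  · change e (q₀ (T b)) = e b
    rw [hqT]
  · have h1 : e (g c) = 0 := hc
    have h2 : g c = 0 := e.injective (h1.trans (map_zero e).symm)
    have h3 := hg c
    rw [h2] at h3
    simp only [AsympEq, map_zero, sub_zero] at h3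
    exact h3

end Lift

/-! ### Exactness and tensor products of asymptotic homomorphisms -/

section Exactness

variable {A : Type u} {B : Type v} [CStarAlgebra A] [CStarAlgebra B]

/-- On `a ⊗ c` the norm is at most `‖s j a‖ ‖ev k c‖`, with the first factor bounded and the second
tending to `0`. -/
theorem eventually_norm_kronMap_le_of_mem_span {C : Type*} [CStarAlgebra C] {m n : ℕ → ℕ}
    {s : ∀ j, A →ₗ[ℂ] Mat (m j)} (hs : ∀ a, EvBdd atTop fun j => s j a)
    {ev : ∀ k, C →ₗ[ℂ] Mat (n k)} {J : Set C}
    (hJ : ∀ c ∈ J, Tendsto (fun k => ‖ev k c‖) atTop (𝓝 0)) {y : A ⊗[ℂ] C}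
    (hy : y ∈ Submodule.span ℂ {w | ∃ (a : A) (c : C), c ∈ J ∧ w = a ⊗ₜ[ℂ] c}) :
    ∀ ε : ℝ, 0 < ε → ∀ᶠ k in atTop, ∀ᶠ j in atTop, ‖kronMap (s j) (ev k) y‖ ≤ ε := by
  induction hy using Submodule.span_induction with
  | zero => exact fun ε hε => by simp [hε.le]
  | add x y _ _ hx hy =>
    intro ε hε
    filter_upwards [hx _ (half_pos hε), hy _ (half_pos hε)] with k h1 h2
    filter_upwards [h1, h2] with j h3 h4
    rw [map_add]
    linarith [norm_add_le (kronMap (s j) (ev k) x) (kronMap (s j) (ev k) y)]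
  | smul r x _ hx =>
    intro ε hε
    have hr : 0 < ‖r‖ + 1 := by positivity
    filter_upwards [hx (ε / (‖r‖ + 1)) (by positivity)] with k h1
    filter_upwards [h1] with j h2
    rw [map_smul, norm_smul]
    calc ‖r‖ * ‖kronMap (s j) (ev k) x‖ ≤ (‖r‖ + 1) * (ε / (‖r‖ + 1)) := by
          gcongr
          linarith
      _ = ε := mul_div_cancel₀ _ hr.ne'
  | mem w hw =>
    obtain ⟨a, c, hc, rfl⟩ := hw
    intro ε hε
    obtain ⟨R, hR⟩ := hs a
    have hR' : 0 < |R| + 1 := by positivity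
    filter_upwards [(hJ c hc).eventually (gt_mem_nhds (div_pos hε hR'))] with k h1
    filter_upwards [hR] with j h2
    refine (norm_kron_le _ _ _ _).trans ?_
    calc ‖s j a‖ * ‖ev k c‖ ≤ (|R| + 1) * (ε / (|R| + 1)) :=
          mul_le_mul (by linarith [le_abs_self R]) h1.le (norm_nonneg _) hR'.le
      _ = ε := mul_div_cancel₀ _ hR'.ne'

/-- Lift `z` to sequences by `T` and use exactness to subtract `y`, a tensor of null sequences, so
that the spatial norm of the rest is almost at most the given norm of `z`. For fixed `k`, the `k`-th
coordinate is a genuine matrix representation, so the rest obeys the bound as `j → ∞`; the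
contribution of `y` is small for large `k`. This dictates the order of the limits. -/
theorem IsExact.eventually_norm_kronMap_le (hA : IsExact A) (ν : CStarTensorNorm A B)
    {m n : ℕ → ℕ} {s : ∀ j, A →ₗ[ℂ] Mat (m j)} (hs : IsAsympHom atTop s)
    (hc : Contractive atTop s) {t : ∀ k, B →ₗ[ℂ] Mat (n k)} (hpos : ∀ k, 0 < n k)
    (ht : IsAsympHom atTop t) (hn : ∀ b, Tendsto (fun k => ‖t k b‖) atTop (𝓝 ‖b‖))
    (z : A ⊗[ℂ] B) {ε : ℝ} (hε : 0 < ε) :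
    ∀ᶠ k in atTop, ∀ᶠ j in atTop, ‖kronMap (s j) (t k) z‖ ≤ ‖ν.incl z‖ + ε := by
  obtain ⟨C, D, _, _, q, f, ev, T, hq, hev, hqT, hnull⟩ := exists_asympLift hpos ht hn
  have hε3 : 0 < ε / 3 := by positivity
  obtain ⟨y, hy, hmin⟩ := hA C D (q : C →⋆ₙₐ[ℂ] D) hq (TensorProduct.map LinearMap.id T z) (ε / 3) hε3
  have h1 : minNorm (TensorProduct.map LinearMap.id ((q : C →⋆ₙₐ[ℂ] D) : C →ₗ[ℂ] D)
      (TensorProduct.map LinearMap.id T z)) ≤ ‖ν.incl z‖ := by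
    -- On the quotient the lift `T` becomes the homomorphism `f`, so every representation there
    -- gives one of `A` and `B`, which the C*-norm dominates by minimality of the spatial norm.
    refine minNorm_le (norm_nonneg _) fun H _ _ _ K _ _ _ π ρ => ?_
    have : tensorRep π ρ (TensorProduct.map LinearMap.id ((q : C →⋆ₙₐ[ℂ] D) : C →ₗ[ℂ] D)
        (TensorProduct.map LinearMap.id T z)) =
        tensorRep π (ρ.comp (f : B →⋆ₙₐ[ℂ] D)) z := by
      refine LinearMap.congr_fun (f := tensorRep π ρ ∘ₗ TensorProduct.map LinearMap.id
        ((q : C →⋆ₙₐ[ℂ] D) : C →ₗ[ℂ] D) ∘ₗ TensorProduct.map LinearMap.id T)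
        (TensorProduct.ext' fun a b => ?_) z
      change tensorRep π ρ (a ⊗ₜ q (T b)) = _
      rw [hqT]
      rfl
    rw [this]
    exact ν.norm_tensorRep_le π _ z
  have h2 := eventually_norm_kronMap_le_of_mem_span (J := {c | q c = 0}) hs.bdd
    (ev := fun k => (ev k).toAlgHom.toLinearMap) hnull hy _ hε3
  filter_upwards [h2] with k h3
  filter_upwards [h3, MFAlg.eventually_norm_kronMap_le hs hc (ev k)
    (TensorProduct.map LinearMap.id T z - y) hε3] with j h4 h5
  have h6 : kronMap (s j) (t k) z =
      kronMap (s j) (ev k).toAlgHom.toLinearMap (TensorProduct.map LinearMap.id T z) := by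
    rw [kronMap_map]
    congr 1
    have : t k = (ev k).toAlgHom.toLinearMap ∘ₗ T := LinearMap.ext fun b => (hev k b).symm
    rw [this]
  have h7 : kronMap (s j) (ev k).toAlgHom.toLinearMap (TensorProduct.map LinearMap.id T z) =
      kronMap (s j) (ev k).toAlgHom.toLinearMap (TensorProduct.map LinearMap.id T z - y) +
      kronMap (s j) (ev k).toAlgHom.toLinearMap y := by
    rw [← map_add, sub_add_cancel]
  rw [h6, h7]
  refine (norm_add_le _ _).trans ?_
  linarith

/-- The C*-norm on `B ⊗ A` that corresponds to a C*-norm on `A ⊗ B`. -/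
noncomputable def CStarTensorNorm.flip (ν : CStarTensorNorm A B) : CStarTensorNorm B A where
  toFun w := ν.toFun (Algebra.TensorProduct.comm ℂ B A w)
  map_zero' := by rw [map_zero]; exact ν.map_zero'
  add_le' x y := by rw [map_add]; exact ν.add_le' _ _
  neg' x := by rw [map_neg]; exact ν.neg' _
  mul_le' x y := by rw [map_mul]; exact ν.mul_le' _ _
  eq_zero_of_map_eq_zero' x h :=
    (map_eq_zero_iff _ (Algebra.TensorProduct.comm ℂ B A).injective).1
      (ν.eq_zero_of_map_eq_zero' _ h)
  smul' r x := by rw [map_smul]; exact ν.smul' _ _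
  cstar' x := by
    have : Algebra.TensorProduct.comm ℂ B A (star x) = star (Algebra.TensorProduct.comm ℂ B A x) := by
      induction x with
      | zero => simp
      | add x y hx hy => rw [star_add, map_add, hx, hy, map_add, star_add]
      | tmul b a => simp
    rw [map_mul, this]
    exact ν.cstar' _

theorem CStarTensorNorm.norm_incl_flip (ν : CStarTensorNorm A B) (z : A ⊗[ℂ] B) :
    ‖ν.flip.incl (TensorProduct.comm ℂ A B z)‖ = ‖ν.incl z‖ := by
  rw [norm_incl, norm_incl]
  have : Algebra.TensorProduct.comm ℂ B A (TensorProduct.comm ℂ A B z) = z :=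
    TensorProduct.comm_comm _ _ _ z
  change ν.toFun (Algebra.TensorProduct.comm ℂ B A (TensorProduct.comm ℂ A B z)) = ν.toFun z
  rw [this]

theorem norm_kronMap_comm {m n : ℕ} (f : A →ₗ[ℂ] Mat m) (g : B →ₗ[ℂ] Mat n) (z : A ⊗[ℂ] B) :
    ‖kronMap g f (TensorProduct.comm ℂ A B z)‖ = ‖kronMap f g z‖ := by
  let e : Fin (m * n) ≃ Fin (n * m) :=
    (finProdFinEquiv.symm.trans (Equiv.prodComm _ _)).trans finProdFinEquiv
  have : kronMap g f (TensorProduct.comm ℂ A B z) = reindexStar e (kronMap f g z) := by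
    induction z with
    | zero => simp
    | add x y hx hy => simp only [map_add, hx, hy]
    | tmul a b =>
      rw [TensorProduct.comm_tmul, kronMap_tmul, kronMap_tmul, kron_mul_eq, kron_mul_eq]
      ext i j
      change g b _ _ * f a _ _ = f a _ _ * g b _ _
      have he : ∀ i, finProdFinEquiv.symm (e.symm i) = (finProdFinEquiv.symm i).swap :=
        fun i => finProdFinEquiv.symm_apply_apply _
      rw [mul_comm]
      change _ = f a (finProdFinEquiv.symm (e.symm i)).1 (finProdFinEquiv.symm (e.symm j)).1 *
        g b (finProdFinEquiv.symm (e.symm i)).2 (finProdFinEquiv.symm (e.symm j)).2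
      rw [he, he]
      rfl
  rw [this]
  exact NonUnitalStarAlgHom.norm_map (reindexStar e) (reindexStar e).injective _

/-- If one of the factors is exact, the tensor products of two isometric asymptotic homomorphisms
are asymptotically contractive for every C*-norm, along a suitable filter. -/
theorem exists_filter_norm_kronMap_le (hAB : IsExact A ∨ IsExact B) (ν : CStarTensorNorm A B)
    {m n : ℕ → ℕ} {s : ∀ j, A →ₗ[ℂ] Mat (m j)} (hm : ∀ j, 0 < m j) (hs : IsAsympHom atTop s)
    (hsn : ∀ a, Tendsto (fun j => ‖s j a‖) atTop (𝓝 ‖a‖))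
    {t : ∀ k, B →ₗ[ℂ] Mat (n k)} (hn : ∀ k, 0 < n k)
    (ht : IsAsympHom atTop t) (htn : ∀ b, Tendsto (fun k => ‖t k b‖) atTop (𝓝 ‖b‖)) :
    ∃ l : Filter (ℕ × ℕ), l.NeBot ∧ l ≤ atTop ×ˢ atTop ∧ ∀ (z : A ⊗[ℂ] B) (ε : ℝ), 0 < ε →
      ∀ᶠ p in l, ‖kronMap (s p.1) (t p.2) z‖ ≤ ‖ν.incl z‖ + ε := by
  -- The curried filter expresses "eventually in the first variable, eventually in the second". The
  -- index of the exact factor must be the inner one, hence the swap when `A` is exact and none when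
  -- `B` is.
  have hne : (atTop.curry atTop : Filter (ℕ × ℕ)).NeBot := by
    refine ⟨fun h => ?_⟩
    have : ∀ᶠ p in (atTop.curry atTop : Filter (ℕ × ℕ)), False := by rw [h]; trivial
    rw [eventually_curry_iff] at this
    obtain ⟨k, hk⟩ := this.exists
    exact hk.exists.choose_spec
  rcases hAB with hA | hB
  · have hcont : Contractive atTop s := fun a ε hε =>
      ((hsn a).eventually (gt_mem_nhds (lt_add_of_pos_right _ hε))).mono fun _ h => h.le
    refine ⟨(atTop.curry atTop).map Prod.swap, hne.map _, ?_, fun z ε hε => ?_⟩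
    · exact (Filter.map_mono curry_le_prod).trans_eq Filter.prod_comm.symm
    · rw [Filter.eventually_map, eventually_curry_iff]
      exact hA.eventually_norm_kronMap_le ν hs hcont hn ht htn z hε
  · refine ⟨atTop.curry atTop, hne, curry_le_prod, fun z ε hε => ?_⟩
    rw [eventually_curry_iff]
    have hcont : Contractive atTop t := fun b ε hε =>
      ((htn b).eventually (gt_mem_nhds (lt_add_of_pos_right _ hε))).mono fun _ h => h.le
    have := hB.eventually_norm_kronMap_le ν.flip ht hcont hm hs hsn
      (TensorProduct.comm ℂ A B z) hε
    simpa only [norm_kronMap_comm, ν.norm_incl_flip] using this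

end Exactness

/-! ### Tensor products of MF-traces -/

section TensorTraces

theorem IsAsympHom.comp_tendsto {A I J : Type*} [Ring A] [StarRing A] [Algebra ℂ A] {l : Filter I}
    {l' : Filter J} {m : J → ℕ} {s : ∀ j, A →ₗ[ℂ] Mat (m j)} (h : IsAsympHom l' s) {f : I → J}
    (hf : Tendsto f l l') : IsAsympHom l fun i => s (f i) where
  asymp_one := h.asymp_one.comp hf
  asymp_mul a b := (h.asymp_mul a b).comp hf
  asymp_star a := (h.asymp_star a).comp hf
  bdd a := by
    obtain ⟨C, hC⟩ := h.bdd a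
    exact ⟨C, hf.eventually hC⟩

variable {A : Type u} {B : Type v} [CStarAlgebra A] [CStarAlgebra B]

theorem tendsto_normTrace_kronMap {I : Type*} {l : Filter I} {m n : I → ℕ}
    {s : ∀ i, A →ₗ[ℂ] Mat (m i)} {t : ∀ i, B →ₗ[ℂ] Mat (n i)} {f : A →ₗ[ℂ] ℂ} {g : B →ₗ[ℂ] ℂ}
    (hs : ∀ a, Tendsto (fun i => normTrace (m i) (s i a)) l (𝓝 (f a)))
    (ht : ∀ b, Tendsto (fun i => normTrace (n i) (t i b)) l (𝓝 (g b))) (z : A ⊗[ℂ] B) :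
    Tendsto (fun i => normTrace (m i * n i) (kronMap (s i) (t i) z)) l (𝓝 (prodFun f g z)) := by
  induction z with
  | zero => simpa [normTrace] using tendsto_const_nhds
  | add x y hx hy => simpa only [map_add, normTrace_add] using hx.add hy
  | tmul a b => simpa only [kronMap_tmul, prodFun_tmul, normTrace_kron] using (hs a).mul (ht b)

theorem apply_mem_of_generates {D E : Type*} [CStarAlgebra D] [CStarAlgebra E] {ι : Type*} {d : ι → D}
    (hd : Generates d) (f : D →⋆ₐ[ℂ] E) {S : StarSubalgebra ℂ E} (hcl : IsClosed (S : Set E))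
    (hf : ∀ i, f (d i) ∈ S) (a : D) : f a ∈ S := by
  have hc : IsClosed {a | f a ∈ S} := hcl.preimage
    (AddMonoidHomClass.continuous_of_bound f 1 fun a => by
      simpa using NonUnitalStarAlgHom.norm_apply_le f a)
  have hle : StarAlgebra.adjoin ℂ (Set.range d) ≤ S.comap f := by
    rw [StarAlgebra.adjoin_le_iff]
    rintro _ ⟨i, rfl⟩
    exact hf i
  exact hc.closure_subset_iff.2 (fun b hb => hle hb) (hd a)

namespace CStarTensorNorm

variable (ν : CStarTensorNorm A B)

theorem generates_tensor {ι κ : Type*} {x : ι → A} {y : κ → B} (hx : Generates x)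
    (hy : Generates y) :
    Generates (Sum.elim (fun i => ν.inl (x i)) fun j => ν.inr (y j)) := by
  set S := (StarAlgebra.adjoin ℂ (Set.range
    (Sum.elim (fun i => ν.inl (x i)) fun j => ν.inr (y j)))).topologicalClosure with hS
  have hcl : IsClosed (S : Set ν.Tensor) := StarSubalgebra.isClosed_topologicalClosure _
  have hmem : ∀ c, Sum.elim (fun i => ν.inl (x i)) (fun j => ν.inr (y j)) c ∈ S := fun c =>
    StarSubalgebra.le_topologicalClosure _ (StarAlgebra.subset_adjoin ℂ _ ⟨c, rfl⟩)
  have hl : ∀ a, ν.inl a ∈ S := apply_mem_of_generates hx ν.inl hcl fun i => hmem (Sum.inl i)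
  have hr : ∀ b, ν.inr b ∈ S := apply_mem_of_generates hy ν.inr hcl fun j => hmem (Sum.inr j)
  have hi : ∀ z, ν.incl z ∈ S := fun z => by
    induction z with
    | zero => rw [map_zero]; exact zero_mem S
    | add z w hz hw => rw [map_add]; exact add_mem hz hw
    | tmul a b => rw [← ν.inl_mul_inr]; exact mul_mem (hl a) (hr b)
  intro z
  have : z ∈ S := UniformSpace.Completion.induction_on z hcl fun z => hi z
  exact this

/-- A bounded functional on the algebraic tensor product extends to the completion. -/
theorem exists_extension {θ : A ⊗[ℂ] B →ₗ[ℂ] ℂ} (hθ : ∀ z, ‖θ z‖ ≤ ‖ν.incl z‖) :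
    ∃ γ : WeakDual ℂ ν.Tensor, ∀ z, γ (ν.incl z) = θ z := by
  let θ' : ν.Alg →ₗ[ℂ] ℂ := { toFun := fun z => θ z, map_add' := θ.map_add, map_smul' := θ.map_smul }
  let θ₀ : ν.Alg →L[ℂ] ℂ := θ'.mkContinuous 1 fun z => by
    rw [one_mul]
    exact (hθ z).trans_eq (ν.norm_incl z)
  refine ⟨StrongDual.toWeakDual (θ₀.extend (UniformSpace.Completion.toComplL (𝕜 := ℂ))), fun z => ?_⟩
  exact ContinuousLinearMap.extend_eq (e := UniformSpace.Completion.toComplL (𝕜 := ℂ)) θ₀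
    UniformSpace.Completion.denseRange_coe
    (UniformSpace.Completion.isUniformInducing_coe ν.Alg) (ν.ofTensor z)

theorem isTracialState_of_incl {γ : WeakDual ℂ ν.Tensor}
    (hpos : ∀ z, 0 ≤ γ (ν.incl (star z * z))) (h1 : γ 1 = 1)
    (hcomm : ∀ z w, γ (ν.incl (z * w)) = γ (ν.incl (w * z))) : IsTracialState γ := by
  have hc : Continuous γ := (WeakDual.toStrongDual γ).continuous
  refine ⟨fun a => ?_, h1, fun a b => ?_⟩
  · induction a using UniformSpace.Completion.induction_on with
    | hp => exact isClosed_le continuous_const (hc.comp (continuous_star.mul continuous_id))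
    | ih z =>
      rw [star_coe, ← UniformSpace.Completion.coe_mul]
      exact hpos z
  · induction a, b using UniformSpace.Completion.induction_on₂ with
    | hp =>
      exact isClosed_eq (hc.comp (continuous_fst.mul continuous_snd))
        (hc.comp (continuous_snd.mul continuous_fst))
    | ih z w =>
      rw [← UniformSpace.Completion.coe_mul, ← UniformSpace.Completion.coe_mul]
      exact hcomm z w

/-- The product functional extends to the completion by Takesaki's theorem, without exactness.
Exactness bounds the norms of the tensored matrix models from above, and the MF property of the
tensor product then makes these bounds sufficient. -/
theorem exists_tensor_trace (hν : IsMF ν.Tensor) (hAB : IsExact A ∨ IsExact B) {ι κ : Type*}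
    [Finite ι] [Finite κ] {x : ι → A} (hx : Generates x) {y : κ → B} (hy : Generates y)
    {α : WeakDual ℂ A} {β : WeakDual ℂ B} (hα : α ∈ MFTraces x) (hβ : β ∈ MFTraces y) :
    ∃ γ : WeakDual ℂ ν.Tensor, (∀ a b, γ (ν.tmul a b) = α a * β b) ∧
      ∀ {ι' : Type*} (z : ι' → ν.Tensor), γ ∈ MFTraces z := by
  obtain ⟨γ, hγ⟩ := ν.exists_extension
    (ν.norm_prodFun_le hα.1.isState hβ.1.isState)
  refine ⟨γ, fun a b => hγ (a ⊗ₜ b), fun z => ?_⟩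
  obtain ⟨m, hm, s, hs, hs'⟩ := exists_isAsympHom_of_mem_MFTraces hx hα
  obtain ⟨n, hn, t, ht, ht'⟩ := exists_isAsympHom_of_mem_MFTraces hy hβ
  obtain ⟨l, hl, hle, hK⟩ := exists_filter_norm_kronMap_le hAB ν hm hs (fun a => (hs' a).1) hn ht
    fun b => (ht' b).1
  have h1 : Tendsto Prod.fst l (atTop : Filter ℕ) := tendsto_fst.mono_left hle
  have h2 : Tendsto Prod.snd l (atTop : Filter ℕ) := tendsto_snd.mono_left hle
  have hkron : IsAsympHom l fun p : ℕ × ℕ => kronMap (s p.1) (t p.2) :=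
    (hs.comp_tendsto h1).kron (ht.comp_tendsto h2)
  have htr : ∀ z : A ⊗[ℂ] B, Tendsto (fun p : ℕ × ℕ => normTrace (m p.1 * n p.2)
      (kronMap (s p.1) (t p.2) z)) l (𝓝 (γ (ν.incl z))) := fun z => by
    rw [hγ]
    exact tendsto_normTrace_kronMap (f := toLin α) (g := toLin β)
      (fun a => (hs' a).2.comp h1) (fun b => (ht' b).2.comp h2) z
  let K : ∀ p : ℕ × ℕ, ν.Alg →ₗ[ℂ] Mat (m p.1 * n p.2) := fun p =>
    { toFun := fun z => kronMap (s p.1) (t p.2) z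
      map_add' := (kronMap (s p.1) (t p.2)).map_add
      map_smul' := (kronMap (s p.1) (t p.2)).map_smul }
  have hK' : IsAsympHom l K :=
    ⟨hkron.asymp_one, hkron.asymp_mul, hkron.asymp_star, hkron.bdd⟩
  have hcont : Contractive l K := fun z ε hε => by
    have h3 := hK z ε hε
    rw [ν.norm_incl (show A ⊗[ℂ] B from z)] at h3
    exact h3
  let τ : WeakDual ℂ ν.Alg := StrongDual.toWeakDual
    ((WeakDual.toStrongDual γ).comp (UniformSpace.Completion.toComplL (𝕜 := ℂ)))
  have hτ : ∀ z, τ z = γ (ν.incl z) := fun z => rfl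
  have htr' : ∀ z, Tendsto (fun p => normTrace (m p.1 * n p.2) (K p z)) l (𝓝 (τ z)) := htr
  -- Positivity and traciality are inherited from the matrices on the algebraic tensor product, and
  -- pass to the completion by density.
  have hst : IsTracialState τ := isTracialState_of_tendsto hK'
    (Eventually.of_forall fun p => Nat.mul_pos (hm _) (hn _)) htr'
  have hγst : IsTracialState γ := ν.isTracialState_of_incl hst.1
    ((congrArg γ (map_one ν.incl)).symm.trans hst.2.1) hst.2.2
  -- The asymptotic homomorphism is defined on the algebraic tensor product only, so the criterion
  -- is verified for generators there and moved along the isometric inclusion.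
  let w : ι ⊕ κ → ν.Alg := Sum.elim (fun i => ν.ofTensor (x i ⊗ₜ 1)) fun j => ν.ofTensor (1 ⊗ₜ y j)
  have hup := hK'.upperApprox hcont hst.2.1 htr' w
  let f : ν.Alg →⋆ₐ[ℂ] ν.Tensor :=
    { toFun := fun z => ν.incl z
      map_one' := map_one ν.incl
      map_mul' := map_mul ν.incl
      map_zero' := map_zero ν.incl
      map_add' := map_add ν.incl
      commutes' := AlgHomClass.commutes ν.incl
      map_star' := map_star ν.incl }
  have hw : (fun c => f (w c)) = Sum.elim (fun i => ν.inl (x i)) fun j => ν.inr (y j) := by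
    funext c
    rcases c with i | j <;> rfl
  have hup' : UpperApprox (fun c => f (w c)) γ := by
    intro F ε hε
    obtain ⟨k, hk, T, hT⟩ := hup F ε hε
    refine ⟨k, hk, T, fun p hp => ?_⟩
    have h3 := hT p hp
    have h4 : ‖f (starEval w p)‖ = ‖starEval w p‖ := ν.norm_incl _
    have h5 : τ (starEval w p) = γ (f (starEval w p)) := rfl
    rwa [h5, ← h4, map_starEval] at h3
  rw [hw] at hup'
  exact mem_MFTraces_of_generates (ν.generates_tensor hx hy)
    (mem_MFTraces_of_upperApprox hν hγst hup') z

end CStarTensorNorm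

end TensorTraces

end MFAlg

theorem mainTheorem4 {A : Type u} [CStarAlgebra A] [Nontrivial A] (hA : IsMF A)
    {n : ℕ} (x : Fin n → A) (hx : Generates x) :
    ((MFTraces x).Nonempty ∧ Convex ℝ (MFTraces x) ∧ IsCompact (MFTraces x)) ∧
    (∀ τ : WeakDual ℂ A, IsTracialState τ → IsFiniteDimensionalTrace.{v} τ → τ ∈ MFTraces x) ∧
    (∀ (C : Type v) [CStarAlgebra C] (π : A →⋆ₐ[ℂ] C), IsMF π.range →
      ∀ (κ : Type w) (y : κ → π.range), Generates y →
        (compRange π) '' MFTraces y ⊆ MFTraces x) ∧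
    (∀ ψ : WeakDual ℂ A, IsTracialState ψ →
      (ψ ∈ MFTraces x ↔
        ∃ α : Ultrafilter ℕ, (α : Filter ℕ) ≤ Filter.cofinite ∧
          ∃ π : A →⋆ₐ[ℂ] MatUltraproduct α, ∀ a, ψ a = ultraTrace α (π a))) ∧
    (∀ B : StarSubalgebra ℂ A, IsClosed (B : Set A) →
      ∀ (κ : Type w) (y : κ → B), Generates y →
        ∀ φ ∈ MFTraces x, restrictTo B φ ∈ MFTraces y) ∧
    (∀ (B : Type v) [CStarAlgebra B], IsMF B →
      ∀ (m : ℕ) (y : Fin m → B), Generates y →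
      ∀ ν : CStarTensorNorm A B, IsMF ν.Tensor → (IsExact A ∨ IsExact B) →
      ∀ α ∈ MFTraces x, ∀ β ∈ MFTraces y,
        ∃ γ : WeakDual ℂ ν.Tensor, (∀ a b, γ (ν.tmul a b) = α a * β b) ∧
          ∀ (κ : Type w) (z : κ → ν.Tensor), Generates z → γ ∈ MFTraces z) := by
  refine ⟨⟨MFTraces_nonempty hA x, convex_MFTraces hA x, isCompact_MFTraces hA x⟩,
    fun τ _ h => mem_MFTraces_of_isFiniteDimensionalTrace hA x h, ?_, ?_, ?_, ?_⟩
  · rintro C _ π - κ y hy _ ⟨φ, hφ, rfl⟩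
    exact compRange_mem_MFTraces hA x π hy hφ
  · intro ψ hψ
    exact ⟨fun h => exists_ultraproduct_of_mem_MFTraces hx h,
      fun ⟨α, _, π, h⟩ => mem_MFTraces_of_ultraproduct hA x hψ α π h⟩
  · intro B _ κ y _ φ hφ
    exact restrictTo_mem_MFTraces hx B y hφ
  · intro B _ _ m y hy ν hν hAB α hα β hβ
    obtain ⟨γ, hγ, h⟩ := ν.exists_tensor_trace hν hAB hx hy hα hβ
    exact ⟨γ, hγ, fun κ z _ => h z⟩
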